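/- Consider spatially flat FRW space-times $ds^2=-dt^2+a(t)^2\sum_{i=1}^3(dx^i)^2$ with a scalar field $\phi(t)$ with potential $V\ge 0$, and let $K=3\dot a/a$. The expanding solutions are the solutions with $K>0$ of $$\ddot\phi=-K\dot\phi-V'(\phi),\qquad \dot K=-\tfrac32\dot\phi^2,\qquad K^2=3V(\phi)+\tfrac32\dot\phi^2 .$$ A cosmology with potential $V$ is such a solution up to time translation, i.e. an orbit in the phase space $\Omega_V=\{(K,\phi,\dot\phi)\in\mathbb R^3: K>0,\ K^2=3V(\phi)+\frac32\dot\phi^2\}$; the set of cosmologies carries the quotient topology of $\Omega_V$. The massless scalar field cosmologies are those with $V\equiv 0$; they are $K=1/t$, $\phi=\pm\sqrt{2/3}\,\ln(t/c)$, $\dot\phi=\pm\sqrt{2/3}/t$ $(t>0)$, one for each sign and each $c>0$. A $C^2$ function $V:\mathbb R\to[0,\infty)$ is well behaved at $+\infty$ of exponential order $N\in\mathbb R$ if $V(\phi)>0$ for all large $\phi$ and $W(\phi)=V'(\phi)/V(\phi)-N\to0$ as $\phi\to\infty$. It is of class $k$ if moreover $V$ is $C^k$ and there are $\phi_0>0$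 and a strictly decreasing $C^{k+1}$ function $f$ mapping $[\phi_0,\infty)$ onto $(0,\epsilon]$, $\epsilon=f(\phi_0)$, with $f(\phi)\to0$ as $\phi\to\infty$ and $V>0$ on $[\phi_0,\infty)$, such that $W\circ f^{-1}$ and $f'\circ f^{-1}$, completed at $0$ by their limits, are $C^k$ on $[0,\epsilon]$ and have vanishing first derivative at $0$. $V$ is class $k$ well behaved at $-\infty$ of order $N_{-\infty}$ if $\phi\mapsto V(-\phi)$ is class $k$ well behaved at $+\infty$ of order $N_{-\infty}$. Theorem. Let $V$ be class 2 well behaved at $+\infty$ and at $-\infty$, of exponential orders with $N_{+\infty}^2<6$ and $N_{-\infty}^2<6$. Then there is a set $S$ of cosmologies with potential $V$ such that: (1) $S$ contains almost all cosmologies: the set of $(\phi,\dot\phi)\in\mathbb R^2$ that are initial data, i.e. coordinates of a point of $\Omega_V$, of a cosmology not in $S$ has Lebesgue measure zero; (2) every cosmology in $S$ has an initial singularity: it exists on an interval $(t_0,\infty)$ with $t_0$ finite, and $K\to\infty$ and $a\to0$ as $t\to t_0^+$; (3) $S$ (with the subspace topology) is homeomorphic to the space of massless scalar field cosmologies, and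 this homeomorphism is realised asymptotically: a cosmology $s$ with potential $V$ belongs to $S$ and corresponds to the massless cosmology $m$ if and only if, for some sign $\pm$ and some $c>0$, $m$ is the massless cosmology with parameters $(\pm,c)$ and, for a suitable choice of the origin of time, $s$ is a solution on $(0,\infty)$ that satisfies, as $t\to0^+$, $$K=\frac1t+O(\varepsilon_V^{\pm}(t)),\qquad \phi=\pm\sqrt{\tfrac23}\,\ln\frac tc+O(t\,\varepsilon_V^{\pm}(t)),\qquad \dot\phi=\pm\sqrt{\tfrac23}\,\frac1t+O(\varepsilon_V^{\pm}(t)),$$ where $\varepsilon_V^{\pm}(t)=t\,V\!\left(\pm\sqrt{\tfrac23}\,\ln t\right)$. -/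

import Mathlib

open Filter Topology Asymptotics MeasureTheory

namespace FRW

/-- `V` is a `C²` non-negative potential that is well behaved at `+∞` with exponential order `N`:
it is positive for large `φ` and `V'/V - N → 0` as `φ → ∞`. -/
def WellBehavedAtInfinity (V : ℝ → ℝ) (N : ℝ) : Prop :=
  ContDiff ℝ 2 V ∧ (∀ φ, 0 ≤ V φ) ∧
    ∃ φ₀ > 0, (∀ φ > φ₀, 0 < V φ) ∧ Tendsto (fun φ => deriv V φ / V φ - N) atTop (𝓝 0)

/-- In the coordinate `z = f φ` on `[φ₀, ∞)`, the function `g`, completed at `z = 0` by its limit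
at `φ = ∞`, is a `C^k` function `gbar` on the closed interval `[0, f φ₀]` whose first derivative
vanishes at `z = 0`. -/
def IsSmoothInCoordinate (k : ℕ) (f : ℝ → ℝ) (φ₀ : ℝ) (g : ℝ → ℝ) : Prop :=
  ∃ gbar : ℝ → ℝ,
    (∀ φ ≥ φ₀, gbar (f φ) = g φ) ∧ Tendsto g atTop (𝓝 (gbar 0)) ∧
    ContDiffOn ℝ k gbar (Set.Icc 0 (f φ₀)) ∧
    HasDerivWithinAt gbar 0 (Set.Icc 0 (f φ₀)) 0

/-- `V` is a class `k` potential, well behaved at `+∞`, of exponential order `N`. -/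
def ClassWellBehaved (k : ℕ) (V : ℝ → ℝ) (N : ℝ) : Prop :=
  ContDiff ℝ k V ∧ WellBehavedAtInfinity V N ∧
    ∃ φ₀ > 0, ∃ f : ℝ → ℝ,
      (∀ φ ≥ φ₀, 0 < V φ) ∧
      f '' Set.Ici φ₀ = Set.Ioc 0 (f φ₀) ∧ Tendsto f atTop (𝓝 0) ∧
      ContDiffOn ℝ (k + 1) f (Set.Ici φ₀) ∧ StrictAntiOn f (Set.Ici φ₀) ∧
      IsSmoothInCoordinate k f φ₀ (fun φ => deriv V φ / V φ - N) ∧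
      IsSmoothInCoordinate k f φ₀ (fun φ => derivWithin f (Set.Ici φ₀) φ)

/-- `(K, φ, ψ)`, with `ψ` the time derivative of `φ`, is an expanding spatially flat FRW
scalar-field solution on the time set `I`: evolution equations and Hamiltonian constraint. -/
def IsSolutionOn (V : ℝ → ℝ) (I : Set ℝ) (K φ ψ : ℝ → ℝ) : Prop :=
  ∀ t ∈ I,
    HasDerivAt φ (ψ t) t ∧
    HasDerivAt ψ (-K t * ψ t - deriv V (φ t)) t ∧
    HasDerivAt K (-(3 / 2) * ψ t ^ 2) t ∧
    0 < K t ∧ K t ^ 2 = 3 * V (φ t) + 3 / 2 * ψ t ^ 2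

/-- The phase space of physical expanding states `(K, φ, ψ)`, a subspace of `ℝ³`. -/
abbrev PhaseSpace (V : ℝ → ℝ) : Type :=
  {p : ℝ × ℝ × ℝ // 0 < p.1 ∧ p.1 ^ 2 = 3 * V p.2.1 + 3 / 2 * p.2.2 ^ 2}

/-- Two states lie on one solution curve. -/
def SameOrbit (V : ℝ → ℝ) (p q : PhaseSpace V) : Prop :=
  ∃ (a b : ℝ) (K φ ψ : ℝ → ℝ), IsSolutionOn V (Set.Ioo a b) K φ ψ ∧
    (∃ t ∈ Set.Ioo a b, (K t, φ t, ψ t) = p.1) ∧ (∃ t ∈ Set.Ioo a b, (K t, φ t, ψ t) = q.1)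

/-- The space of cosmologies with potential `V`: solutions up to time translation, i.e. orbits in
phase space, with the quotient topology. -/
abbrev Cosmology (V : ℝ → ℝ) : Type := Quot (SameOrbit V)

/-- The cosmology through a state. -/
def cosmologyOf {V : ℝ → ℝ} (p : PhaseSpace V) : Cosmology V := Quot.mk _ p

/-- `(K, φ, ψ)` is a solution on `(t₀, ∞)` belonging to the cosmology `s`. -/
def IsHistory (V : ℝ → ℝ) (s : Cosmology V) (t₀ : ℝ) (K φ ψ : ℝ → ℝ) : Prop :=
  IsSolutionOn V (Set.Ioi t₀) K φ ψ ∧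
    ∃ t > t₀, ∃ p : PhaseSpace V, p.1 = (K t, φ t, ψ t) ∧ cosmologyOf p = s

/-- The cosmology `s` has an initial singularity: at some finite past time `t₀` its expansion `K`
diverges to `+∞` and its scale factor `a` (where `K = 3 a'/a`, so that `a` is determined up to a
constant factor) tends to `0`. -/
def HasInitialSingularity (V : ℝ → ℝ) (s : Cosmology V) : Prop :=
  ∃ (t₀ : ℝ) (K φ ψ : ℝ → ℝ), IsHistory V s t₀ K φ ψ ∧ Tendsto K (𝓝[>] t₀) atTop ∧
    ∀ a : ℝ → ℝ, (∀ t > t₀, 0 < a t ∧ DifferentiableAt ℝ a t ∧ K t = 3 * (deriv a t / a t)) →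
      Tendsto a (𝓝[>] t₀) (𝓝 0)

/-- The error function `ε_V^σ(t) = t V(σ √(2/3) ln t)`. -/
noncomputable def errorFn (V : ℝ → ℝ) (σ : ℝ) (t : ℝ) : ℝ :=
  t * V (σ * √(2 / 3) * Real.log t)

/-- The scalar field `σ √(2/3) ln (t/c)` of a massless cosmology. -/
noncomputable def masslessField (σ c : ℝ) (t : ℝ) : ℝ := σ * √(2 / 3) * Real.log (t / c)

/-- `m` is the massless scalar field cosmology given by the exact solution
`K = 1/t`, `φ = σ √(2/3) ln (t/c)`, `φ' = σ √(2/3)/t`, `t > 0`. -/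
def IsMasslessWith (m : Cosmology (fun _ => 0)) (σ c : ℝ) : Prop :=
  IsHistory (fun _ => 0) m 0 (fun t => 1 / t) (masslessField σ c) (fun t => σ * √(2 / 3) / t)

/-- The cosmology `s`, with time measured from a suitable origin, has the asymptotic form of the
massless cosmology with parameters `σ`, `c` as `t → 0⁺`. -/
def HasMasslessAsymptotics (V : ℝ → ℝ) (s : Cosmology V) (σ c : ℝ) : Prop :=
  ∃ K φ ψ : ℝ → ℝ, IsHistory V s 0 K φ ψ ∧
    (fun t => K t - 1 / t) =O[𝓝[>] 0] errorFn V σ ∧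
    (fun t => φ t - masslessField σ c t) =O[𝓝[>] 0] (fun t => t * errorFn V σ t) ∧
    (fun t => ψ t - σ * √(2 / 3) / t) =O[𝓝[>] 0] errorFn V σ

end FRW

/-!
The initial data `(φ, ψ)` determine the expansion `K = √(3 V + 3/2 ψ²)`, and in the logarithmic time
`τ` with `dτ = K dt` the evolution is a global flow `logFlow` on the set of physical data. Two facts
about it are used throughout: `φ` moves with speed `ψ / K` in `[-κ, κ]`, where `κ = √(2/3)`, and the
evolution field has divergence `-1` (`divergence_logField`), so the past flow expands area by the
factor `e` per unit of `τ`.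

The condition `N² < 6` at both ends says that `|V'| ≤ 3 κ ν V` for large `|φ|`, with some `ν < 1`
(`exists_isAdmissible`). Fix `μ` in `(ν, 1)`. For large `|φ|` a speed above `κ μ` directed outwards
to the past keeps growing to the past, so that the states with this property form two regions, one
for each sign `σ`, which the past flow does not leave (`trapped_past`). There the potential energy
fraction `V / K²` decays exponentially to the past. The set `S` consists of the cosmologies entering
one of these regions.

*Almost all.* If the initial data are outside both basins, the speed cannot exceed `κ μ` at large
energy (`mem_basin_of_speed`), whence `|ψ| ≤ C exp (3/2 κ ν |φ|)`. This exceptional set therefore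
has finite measure for the weight `exp (-3/2 κ μ |φ|)`. It is invariant under the flow. Along the
past flow the weight loses at most the factor `exp (-μ)` per unit of `τ`, while area gains the factor
`e`; since `μ < 1`, the measure is zero (`volume_exceptional`).

*Coordinates on `S`.* The phase `ln K + σ √(3/2) φ` is constant on massless solutions of sign `σ`. On a
trapped solution it decreases to the past, by at most a multiple of the present energy fraction
(`asymptote_mem_Icc`), so it has a limit `L`, which depends continuously on the initial data. Of two
trapped solutions compared at equal `φ`, the one with the larger `K` has the smaller energy fraction,
hence the larger speed, and so the phases move apart to the past (`phase_lt_asymptote`). Thus `L`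
determines the solution and is an open map, and it takes all real values by the intermediate value
theorem (`exists_asymptote_eq`). Hence `(σ, L)` is a homeomorphism from `S` onto the product of a
two-point space with `ℝ` (`parametersHomeomorph`). The same applies to `V = 0`, where `S` consists of
all cosmologies and `L = -ln c`; composing the two homeomorphisms gives the asserted one.

*Singularity and asymptotics.* Cosmic time has a finite infimum on a trapped solution. Measuring it
from there, `1 / K` lies between `t (1 - 3 V / K²)` and `t` (`clock_bounds`). Together with the bounds on
`L` this gives the pointwise estimates `trapped_estimates` in terms of `V φ`, in which `φ` may be
replaced by `σ κ ln t` because the difference is bounded (`exists_history`). Conversely, the asymptotic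
form forces a solution into the trapped region and determines `L`
(`mem_basin_of_hasMasslessAsymptotics`).
-/

namespace FRW
/-! ### Calculus and ordinary differential equations -/

lemma monotoneOn_of_hasDerivAt_nonneg {s : Set ℝ} (hs : Convex ℝ s) {f f' : ℝ → ℝ}
    (hf : ∀ x ∈ s, HasDerivAt f (f' x) x) (h0 : ∀ x ∈ s, 0 ≤ f' x) : MonotoneOn f s :=
  monotoneOn_of_hasDerivWithinAt_nonneg hs
    (fun x hx => (hf x hx).continuousAt.continuousWithinAt)
    (fun x hx => (hf x (interior_subset hx)).hasDerivWithinAt)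
    (fun x hx => h0 x (interior_subset hx))

lemma antitoneOn_of_hasDerivAt_nonpos {s : Set ℝ} (hs : Convex ℝ s) {f f' : ℝ → ℝ}
    (hf : ∀ x ∈ s, HasDerivAt f (f' x) x) (h0 : ∀ x ∈ s, f' x ≤ 0) : AntitoneOn f s :=
  antitoneOn_of_hasDerivWithinAt_nonpos hs
    (fun x hx => (hf x hx).continuousAt.continuousWithinAt)
    (fun x hx => (hf x (interior_subset hx)).hasDerivWithinAt)
    (fun x hx => h0 x (interior_subset hx))

lemma hasDerivAt_fst {z : ℝ → ℝ × ℝ} {z' : ℝ × ℝ} {t : ℝ} (h : HasDerivAt z z' t) :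
    HasDerivAt (fun s => (z s).1) z'.1 t :=
  (hasFDerivAt_fst (𝕜 := ℝ) (E := ℝ) (F := ℝ) (p := z t)).comp_hasDerivAt t h

lemma hasDerivAt_snd {z : ℝ → ℝ × ℝ} {z' : ℝ × ℝ} {t : ℝ} (h : HasDerivAt z z' t) :
    HasDerivAt (fun s => (z s).2) z'.2 t :=
  (hasFDerivAt_snd (𝕜 := ℝ) (E := ℝ) (F := ℝ) (p := z t)).comp_hasDerivAt t h

/-- Continuous induction: a curve that cannot be the first to leave an open set never leaves it. -/
lemma mem_of_continuous_induction {E : Type*} [TopologicalSpace E] {g : ℝ → E} (hg : Continuous g)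
    {O : Set E} (hO : IsOpen O)
    (h : ∀ s ≥ 0, (∀ r, 0 ≤ r → r < s → g r ∈ O) → g s ∈ O) : ∀ s ≥ 0, g s ∈ O := by
  by_contra! hcon
  obtain ⟨s, hs0, hs⟩ := hcon
  set B : Set ℝ := Set.Ici 0 ∩ g ⁻¹' Oᶜ
  have hB : IsClosed B := isClosed_Ici.inter (hO.isClosed_compl.preimage hg)
  have hne : B.Nonempty := ⟨s, hs0, hs⟩
  have hbd : BddBelow B := ⟨0, fun x hx => hx.1⟩
  have hmem := hB.csInf_mem hne hbd
  refine hmem.2 (h _ hmem.1 fun r hr0 hr => ?_)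
  by_contra hrO
  exact absurd (csInf_le hbd ⟨hr0, hrO⟩) (not_le.mpr hr)

/-- A differentiable function with continuous positive derivative on an open interval has a
differentiable inverse there. -/
lemma exists_hasDerivAt_inverse {I : Set ℝ} (hI : IsOpen I) (hc : Convex ℝ I) {g g' : ℝ → ℝ}
    (hg : ∀ x ∈ I, HasDerivAt g (g' x) x) (hcont : ContinuousOn g' I) (hpos : ∀ x ∈ I, 0 < g' x) :
    ∃ h : ℝ → ℝ, (∀ x ∈ I, h (g x) = x) ∧
      ∀ x ∈ I, HasDerivAt h (g' x)⁻¹ (g x) := by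
  have hinj : Set.InjOn g I := by
    refine (strictMonoOn_of_hasDerivWithinAt_pos (f' := g') hc
      (fun x hx => (hg x hx).continuousAt.continuousWithinAt)
      (fun x hx => (hg x (interior_subset hx)).hasDerivWithinAt)
      (fun x hx => hpos x (interior_subset hx))).injOn
  have hleft : ∀ x ∈ I, Function.invFunOn g I (g x) = x := fun x hx => hinj.leftInvOn_invFunOn hx
  refine ⟨Function.invFunOn g I, hleft, fun x hx => ?_⟩
  have hst : HasStrictDerivAt g (g' x) x := by
    refine hasStrictDerivAt_of_hasDerivAt_of_continuousAt ?_ (hcont.continuousAt (hI.mem_nhds hx))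
    filter_upwards [hI.mem_nhds hx] with y hy using hg y hy
  have hne := (hpos x hx).ne'
  refine (hst.to_localInverse hne).hasDerivAt.congr_of_eventuallyEq ?_
  have hr := hst.eventually_right_inverse hne
  have hcl : ContinuousAt (hst.localInverse g (g' x) x hne) (g x) :=
    (hst.to_localInverse hne).hasDerivAt.continuousAt
  have hx' : hst.localInverse g (g' x) x hne (g x) = x :=
    (hst.eventually_left_inverse hne).self_of_nhds
  have hin : ∀ᶠ y in 𝓝 (g x), hst.localInverse g (g' x) x hne y ∈ I :=
    hcl.eventually_mem (by rw [hx']; exact hI.mem_nhds hx)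
  filter_upwards [hr, hin] with y hy hyI
  conv_lhs => rw [← hy]
  exact hleft _ hyI

/-- Picard–Lindelöf for a bounded field that is globally Lipschitz in the state: solutions exist on
intervals of any length. -/
lemma exists_solution_of_lipschitz_of_bounded {E : Type*} [NormedAddCommGroup E] [NormedSpace ℝ E]
    [CompleteSpace E] {f : ℝ → E → E} {L : NNReal} {C T : ℝ} (hT : 0 < T)
    (hL : ∀ t, LipschitzWith L (f t)) (hc : ∀ x, Continuous fun t => f t x)
    (hC : ∀ t x, ‖f t x‖ ≤ C) (x₀ : E) :
    ∃ γ : ℝ → E, γ 0 = x₀ ∧ ∀ t ∈ Set.Ioo (-T) T, HasDerivAt γ (f t (γ t)) t := by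
  have hC0 : 0 ≤ C := (norm_nonneg _).trans (hC 0 x₀)
  have h0 : (0 : ℝ) ∈ Set.Icc (-T) T := ⟨by linarith, hT.le⟩
  have hP : IsPicardLindelof f (⟨0, h0⟩ : Set.Icc (-T) T) x₀ ⟨C * T, by positivity⟩ 0 ⟨C, hC0⟩ L :=
    { lipschitzOnWith := fun t _ => (hL t).lipschitzOnWith
      continuousOn := fun x _ => (hc x).continuousOn
      norm_le := fun t _ x _ => hC t x
      mul_max_le := by simpa using! le_rfl }
  obtain ⟨γ, hγ0, hγ⟩ := hP.exists_eq_forall_mem_Icc_hasDerivWithinAt₀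
  exact ⟨γ, hγ0, fun t ht => (hγ t (Set.Ioo_subset_Icc_self ht)).hasDerivAt (Icc_mem_nhds ht.1 ht.2)⟩

/-- Uniqueness for an autonomous field that need only be `C¹` near the points of one of the two
solutions. -/
lemma eqOn_Ioo_of_contDiffAt {E : Type*} [NormedAddCommGroup E] [NormedSpace ℝ E]
    {v : E → E} {f g : ℝ → E} {a b t₀ : ℝ} (ht₀ : t₀ ∈ Set.Ioo a b)
    (hv : ∀ t ∈ Set.Ioo a b, ContDiffAt ℝ 1 v (f t))
    (hf : ∀ t ∈ Set.Ioo a b, HasDerivAt f (v (f t)) t)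
    (hg : ∀ t ∈ Set.Ioo a b, HasDerivAt g (v (g t)) t) (h0 : f t₀ = g t₀) :
    Set.EqOn f g (Set.Ioo a b) := by
  have key : ∀ t ∈ Set.Ioo a b, f t = g t → f =ᶠ[𝓝 t] g := by
    intro t ht hfg
    obtain ⟨K, s, hs, hK⟩ := (hv t ht).exists_lipschitzOnWith
    have hI : ∀ᶠ r in 𝓝 t, r ∈ Set.Ioo a b := isOpen_Ioo.mem_nhds ht
    refine ODE_solution_unique_of_eventually (v := fun _ => v) (s := fun _ => s)
      (Eventually.of_forall fun _ => hK) ?_ ?_ hfg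
    · filter_upwards [hI, (hf t ht).continuousAt.eventually_mem hs] with r hr hrs
      exact ⟨hf r hr, hrs⟩
    · filter_upwards [hI, (hg t ht).continuousAt.eventually_mem (hfg ▸ hs)] with r hr hrs
      exact ⟨hg r hr, hrs⟩
  have hsub : Set.Ioo a b ⊆ {t | f =ᶠ[𝓝 t] g} := by
    refine isPreconnected_Ioo.subset_of_closure_inter_subset isOpen_setOfPred_eventually_nhds
      ⟨t₀, ht₀, key t₀ ht₀ h0⟩ ?_
    rintro t ⟨ht, htI⟩
    refine key t htI ?_
    by_contra hne
    have : ∀ᶠ r in 𝓝 t, f r ≠ g r :=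
      (hf t htI).continuousAt.ne_iff_eventually_ne (hg t htI).continuousAt |>.mp hne
    obtain ⟨r, hr1, hr2⟩ := mem_closure_iff_nhds.mp ht _ this
    exact hr1 hr2.self_of_nhds
  exact fun t ht => (hsub ht).self_of_nhds

/-- Truncation of a real number to `[-R, R]`. -/
noncomputable def clamp (R a : ℝ) : ℝ := max (-R) (min R a)

lemma clamp_eq {R a : ℝ} (h : |a| ≤ R) : clamp R a = a := by
  rw [abs_le] at h; simp [clamp, h.1, h.2]

lemma abs_clamp_le {R : ℝ} (hR : 0 ≤ R) (a : ℝ) : |clamp R a| ≤ R :=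
  abs_le.mpr ⟨le_max_left _ _, max_le (by linarith) (min_le_left _ _)⟩

lemma abs_clamp_le_abs {R : ℝ} (hR : 0 ≤ R) (a : ℝ) : |clamp R a| ≤ |a| := by
  rcases le_total |a| R with h | h
  · rw [clamp_eq h]
  · exact (abs_clamp_le hR a).trans h

lemma lipschitzWith_clamp (R : ℝ) : LipschitzWith 1 (clamp R) :=
  (LipschitzWith.id.const_min R).const_max (-R)

/-- A linear equation in the plane with bounded coefficients is solvable on `[0, 1]`. The equation is
solved with the state truncated at the Grönwall bound, which the solution does not exceed. -/
lemma exists_solution_linear {A : ℝ → (ℝ × ℝ) →L[ℝ] (ℝ × ℝ)} {C : NNReal} (hA : Continuous A)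
    (hC : ∀ t, ‖A t‖ ≤ C) (y₀ : ℝ × ℝ) :
    ∃ y : ℝ → ℝ × ℝ, y 0 = y₀ ∧ ∀ t ∈ Set.Icc (0 : ℝ) 1, HasDerivAt y (A t (y t)) t := by
  set R : ℝ := ‖y₀‖ * Real.exp C with hR
  have hR0 : 0 ≤ R := by positivity
  set c : ℝ × ℝ → ℝ × ℝ := fun y => (clamp R y.1, clamp R y.2) with hc
  have hcL : LipschitzWith 1 c := by
    have := ((lipschitzWith_clamp R).comp LipschitzWith.prod_fst).prodMk
      ((lipschitzWith_clamp R).comp LipschitzWith.prod_snd)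
    simpa using this
  have hcn : ∀ y, ‖c y‖ ≤ ‖y‖ := fun y =>
    max_le_max (abs_clamp_le_abs hR0 _) (abs_clamp_le_abs hR0 _)
  have hcR : ∀ y, ‖c y‖ ≤ R := fun y => max_le (abs_clamp_le hR0 _) (abs_clamp_le hR0 _)
  obtain ⟨y, hy0, hy⟩ := exists_solution_of_lipschitz_of_bounded (f := fun t y => A t (c y))
    (L := C * 1) (C := C * R) (T := 2) two_pos
    (fun t => ((A t).lipschitz.weaken (by exact_mod_cast hC t)).comp hcL)
    (fun x => hA.clm_apply continuous_const)
    (fun t x => ((A t).le_opNorm _).trans (mul_le_mul (hC t) (hcR x) (norm_nonneg _) C.2)) y₀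
  refine ⟨y, hy0, fun t ht => ?_⟩
  have hsub : ∀ t ∈ Set.Icc (0 : ℝ) 1, t ∈ Set.Ioo (-2 : ℝ) 2 := fun t ht =>
    ⟨by linarith [ht.1], by linarith [ht.2]⟩
  have hb : ‖y t‖ ≤ R := by
    have := norm_le_gronwallBound_of_norm_deriv_right_le (f := y) (f' := fun t => A t (c (y t)))
      (δ := ‖y₀‖) (K := C) (ε := 0) (a := 0) (b := 1)
      (fun t ht => (hy t (hsub t ht)).continuousAt.continuousWithinAt)
      (fun t ht => (hy t (hsub t ⟨ht.1, ht.2.le⟩)).hasDerivWithinAt) (by rw [hy0])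
      (fun t _ => by
        rw [add_zero]
        exact ((A t).le_opNorm _).trans (mul_le_mul (hC t) (hcn _) (norm_nonneg _) C.2)) t ht
    rw [gronwallBound_ε0] at this
    refine this.trans (mul_le_mul_of_nonneg_left (Real.exp_le_exp.mpr ?_) (norm_nonneg _))
    have := C.2
    nlinarith [ht.1, ht.2]
  have hcy : c (y t) = y t :=
    Prod.ext (clamp_eq ((norm_fst_le _).trans hb)) (clamp_eq ((norm_snd_le _).trans hb))
  simpa [hcy] using hy t (hsub t ht)

/-- Differentiability of the time-one map of a flow at `p`, for a compactly supported `C¹` vector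
field: the derivative is the time-one value of a solution `M` of the variational equation. -/
lemma hasFDerivAt_flow {E : Type*} [NormedAddCommGroup E] [NormedSpace ℝ E] {G : E → E}
    (hG : ContDiff ℝ 1 G) (hsupp : HasCompactSupport G) {L : NNReal} (hL : LipschitzWith L G)
    {γ : E → ℝ → E} {p : E} {M : ℝ → E →L[ℝ] E}
    (h0 : ∀ᶠ q in 𝓝 p, γ q 0 = q)
    (hγ : ∀ᶠ q in 𝓝 p, ∀ t ∈ Set.Icc (0 : ℝ) 1, HasDerivAt (γ q) (G (γ q t)) t)
    (hM0 : M 0 = ContinuousLinearMap.id ℝ E)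
    (hM : ∀ h, ∀ t ∈ Set.Icc (0 : ℝ) 1,
      HasDerivAt (fun t => M t h) (fderiv ℝ G (γ p t) (M t h)) t) :
    HasFDerivAt (fun q => γ q 1) (M 1) p := by
  have hp0 := h0.self_of_nhds
  have hγp := hγ.self_of_nhds
  have hfd : ∀ x, ‖fderiv ℝ G x‖ ≤ L := fun x => norm_fderiv_le_of_lipschitz ℝ hL
  -- the derivative of `G` is uniformly continuous
  have huc : UniformContinuous (fderiv ℝ G) :=
    (hsupp.fderiv ℝ).uniformContinuous_of_continuous (hG.continuous_fderiv one_ne_zero)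
  set c₁ := Real.exp L with hc₁
  have hc₁0 : 0 < c₁ := Real.exp_pos _
  have hclose : ∀ᶠ q in 𝓝 p, ∀ t ∈ Set.Icc (0 : ℝ) 1, ‖γ q t - γ p t‖ ≤ c₁ * ‖q - p‖ := by
    filter_upwards [h0, hγ] with q hq0 hq t ht
    have := dist_le_of_trajectories_ODE (v := fun _ => G) (K := L) (f := γ q) (g := γ p) (a := 0)
      (b := 1) (δ := ‖q - p‖) (fun _ => hL)
      (fun t ht => (hq t ht).continuousAt.continuousWithinAt)
      (fun t ht => (hq t ⟨ht.1, ht.2.le⟩).hasDerivWithinAt)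
      (fun t ht => (hγp t ht).continuousAt.continuousWithinAt)
      (fun t ht => (hγp t ⟨ht.1, ht.2.le⟩).hasDerivWithinAt)
      (by rw [hq0, hp0, dist_eq_norm]) t ht
    rw [dist_eq_norm] at this
    refine this.trans ?_
    rw [mul_comm]
    refine mul_le_mul_of_nonneg_right (Real.exp_le_exp.mpr ?_) (norm_nonneg _)
    have := L.2
    nlinarith [ht.1, ht.2]
  set B := gronwallBound 0 L 1 1 with hB
  have hlin : ∀ ε, gronwallBound 0 L ε 1 = ε * B := by
    intro ε
    rw [hB]
    unfold gronwallBound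
    split_ifs <;> ring
  have hB0 : 0 ≤ B := by
    have := gronwallBound_mono (δ := 0) (ε := 1) (K := L) le_rfl zero_le_one L.2
      (zero_le_one (α := ℝ))
    simpa [gronwallBound_x0] using this
  rw [hasFDerivAt_iff_isLittleO, Asymptotics.isLittleO_iff]
  intro c hc
  obtain ⟨η, hη0, hη⟩ : ∃ η > 0, η * c₁ * B ≤ c := by
    refine ⟨c / (c₁ * B + 1), by positivity, ?_⟩
    rw [mul_assoc, div_mul_eq_mul_div, div_le_iff₀ (by positivity)]
    nlinarith
  obtain ⟨r, hr, hrη⟩ := Metric.uniformContinuous_iff.mp huc η hη0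
  have hsmall : ∀ᶠ q in 𝓝 p, c₁ * ‖q - p‖ < r := by
    have : Tendsto (fun q => c₁ * ‖q - p‖) (𝓝 p) (𝓝 0) := by
      have : Continuous fun q : E => c₁ * ‖q - p‖ := by fun_prop
      simpa using this.tendsto p
    exact this.eventually_lt_const hr
  filter_upwards [h0, hγ, hclose, hsmall] with q hq0 hq hqc hqr
  have htay : ∀ t ∈ Set.Icc (0 : ℝ) 1,
      ‖G (γ q t) - G (γ p t) - fderiv ℝ G (γ p t) (γ q t - γ p t)‖ ≤ η * (c₁ * ‖q - p‖) := by
    intro t ht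
    have hmv := (convex_ball (γ p t) r).norm_image_sub_le_of_norm_fderiv_le' (𝕜 := ℝ) (f := G)
      (φ := fderiv ℝ G (γ p t)) (C := η) (x := γ p t) (y := γ q t)
      (fun x _ => (hG.differentiable one_ne_zero) x)
      (fun x hx => by rw [← dist_eq_norm]; exact (hrη hx).le) (Metric.mem_ball_self hr)
      (by rw [Metric.mem_ball, dist_eq_norm]; exact (hqc t ht).trans_lt hqr)
    exact hmv.trans (mul_le_mul_of_nonneg_left (hqc t ht) hη0.le)
  have hder : ∀ t ∈ Set.Icc (0 : ℝ) 1, HasDerivAt (fun t => γ q t - γ p t - M t (q - p))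
      (G (γ q t) - G (γ p t) - fderiv ℝ G (γ p t) (M t (q - p))) t := fun t ht =>
    ((hq t ht).sub (hγp t ht)).sub (hM _ t ht)
  have := norm_le_gronwallBound_of_norm_deriv_right_le
    (f := fun t => γ q t - γ p t - M t (q - p))
    (f' := fun t => G (γ q t) - G (γ p t) - fderiv ℝ G (γ p t) (M t (q - p)))
    (δ := 0) (K := L) (ε := η * (c₁ * ‖q - p‖)) (a := 0) (b := 1)
    (fun t ht => (hder t ht).continuousAt.continuousWithinAt)
    (fun t ht => (hder t ⟨ht.1, ht.2.le⟩).hasDerivWithinAt)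
    (by simp [hq0, hp0, hM0])
    (fun t ht => by
      have h1 := htay t ⟨ht.1, ht.2.le⟩
      have h2 : ‖fderiv ℝ G (γ p t) (γ q t - γ p t - M t (q - p))‖
          ≤ L * ‖γ q t - γ p t - M t (q - p)‖ :=
        ((fderiv ℝ G (γ p t)).le_opNorm _).trans
          (mul_le_mul_of_nonneg_right (hfd _) (norm_nonneg _))
      have h3 : G (γ q t) - G (γ p t) - fderiv ℝ G (γ p t) (M t (q - p))
          = (G (γ q t) - G (γ p t) - fderiv ℝ G (γ p t) (γ q t - γ p t))
            + fderiv ℝ G (γ p t) (γ q t - γ p t - M t (q - p)) := by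
        rw [map_sub (fderiv ℝ G (γ p t)) (γ q t - γ p t)]; abel
      rw [h3]
      exact (norm_add_le _ _).trans (by linarith)) 1 (by simp)
  rw [sub_zero, hlin] at this
  refine this.trans ?_
  calc η * (c₁ * ‖q - p‖) * B = (η * c₁ * B) * ‖q - p‖ := by ring
    _ ≤ c * ‖q - p‖ := mul_le_mul_of_nonneg_right hη (norm_nonneg _)

/-- Liouville's formula in the plane: along a vector field of divergence `1`, the time-one map of
the flow is differentiable with Jacobian determinant `e`. -/
lemma exists_hasFDerivAt_flow_det {G : ℝ × ℝ → ℝ × ℝ}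
    (hG : ContDiff ℝ 1 G) (hsupp : HasCompactSupport G)
    {γ : ℝ × ℝ → ℝ → ℝ × ℝ} {p : ℝ × ℝ} (hcont : Continuous (γ p))
    (h0 : ∀ᶠ q in 𝓝 p, γ q 0 = q)
    (hγ : ∀ᶠ q in 𝓝 p, ∀ t ∈ Set.Icc (0 : ℝ) 1, HasDerivAt (γ q) (G (γ q t)) t)
    (htr : ∀ t ∈ Set.Icc (0 : ℝ) 1,
      (fderiv ℝ G (γ p t) (1, 0)).1 + (fderiv ℝ G (γ p t) (0, 1)).2 = 1) :
    ∃ D : (ℝ × ℝ) →L[ℝ] (ℝ × ℝ), HasFDerivAt (fun q => γ q 1) D p ∧ D.det = Real.exp 1 := by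
  obtain ⟨L, hL⟩ := hG.lipschitzWith_of_hasCompactSupport hsupp one_ne_zero
  have hA : Continuous fun t => fderiv ℝ G (γ p t) :=
    (hG.continuous_fderiv one_ne_zero).comp hcont
  have hAC : ∀ t, ‖fderiv ℝ G (γ p t)‖ ≤ L := fun t => norm_fderiv_le_of_lipschitz ℝ hL
  obtain ⟨y, hy0, hy⟩ := exists_solution_linear hA hAC (1, 0)
  obtain ⟨z, hz0, hz⟩ := exists_solution_linear hA hAC (0, 1)
  let M : ℝ → (ℝ × ℝ) →L[ℝ] (ℝ × ℝ) := fun t =>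
    (ContinuousLinearMap.fst ℝ ℝ ℝ).smulRight (y t) + (ContinuousLinearMap.snd ℝ ℝ ℝ).smulRight (z t)
  have hMv : ∀ t h, M t h = h.1 • y t + h.2 • z t := fun t h => rfl
  refine ⟨M 1, hasFDerivAt_flow hG hsupp hL h0 hγ ?_ ?_, ?_⟩
  · ext <;> simp [hMv, hy0, hz0]
  · intro h t ht
    simp only [hMv, map_add, map_smul]
    exact ((hy t ht).const_smul h.1).add ((hz t ht).const_smul h.2)
  · have hdet : ∀ t, (M t).det = (y t).1 * (z t).2 - (z t).1 * (y t).2 := by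
      intro t
      rw [ContinuousLinearMap.det, ← LinearMap.det_toMatrix (Module.Basis.finTwoProd ℝ), Matrix.det_fin_two]
      simp [LinearMap.toMatrix_apply, hMv]
    have hexp : ∀ v : ℝ × ℝ, ∀ B : (ℝ × ℝ) →L[ℝ] (ℝ × ℝ),
        B v = v.1 • B (1, 0) + v.2 • B (0, 1) := by
      intro v B
      rw [← map_smul, ← map_smul, ← map_add]
      congr 1
      ext <;> simp
    set d : ℝ → ℝ := fun t => (y t).1 * (z t).2 - (z t).1 * (y t).2 with hd
    have hdd : ∀ t ∈ Set.Icc (0 : ℝ) 1, HasDerivAt d (d t) t := by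
      intro t ht
      have e1 := htr t ht
      have hyt := hy t ht
      have hzt := hz t ht
      rw [hexp] at hyt hzt
      convert! ((hasDerivAt_fst hyt).mul (hasDerivAt_snd hzt)).sub
        ((hasDerivAt_fst hzt).mul (hasDerivAt_snd hyt)) using 1
      simp only [hd, Prod.fst_add, Prod.snd_add, Prod.smul_fst, Prod.smul_snd, smul_eq_mul]
      linear_combination (-((y t).1 * (z t).2 - (z t).1 * (y t).2)) * e1
    have hconst : ∀ t ∈ Set.Icc (0 : ℝ) 1, d t * Real.exp (-t) = d 0 * Real.exp (-0) := by
      refine constant_of_has_deriv_right_zero (f := fun t => d t * Real.exp (-t))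
        (fun t ht => ?_) (fun t ht => ?_)
      · exact ((hdd t ht).continuousAt.mul (by fun_prop)).continuousWithinAt
      · have := (hdd t ⟨ht.1, ht.2.le⟩).mul ((hasDerivAt_neg t).exp)
        convert! this.hasDerivWithinAt using 1
        ring
    have h1 := hconst 1 (by simp)
    rw [hdet]
    have hd0 : d 0 = 1 := by simp [hd, hy0, hz0]
    rw [hd0] at h1
    have : d 1 = Real.exp 1 := by
      rw [Real.exp_neg] at h1
      field_simp at h1
      simpa using h1
    exact this

end FRW

namespace FRW
/-! ### The flow in logarithmic time -/

/-- The slope `√(2/3)` of a massless scalar field as a function of `ln t`. -/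
noncomputable def κ : ℝ := √(2 / 3)

lemma κ_pos : 0 < κ := Real.sqrt_pos.mpr (by norm_num)

lemma κ_mul_self : κ * κ = 2 / 3 := Real.mul_self_sqrt (by norm_num)

lemma κ_lt_one : κ < 1 := by nlinarith [κ_mul_self, κ_pos]

/-- The square `3 V(φ) + 3/2 ψ²` of the expansion, at the initial data `(φ, ψ)`. -/
noncomputable def energy (V : ℝ → ℝ) (p : ℝ × ℝ) : ℝ := 3 * V p.1 + 3 / 2 * p.2 ^ 2

/-- The expansion `K` determined by the initial data `(φ, ψ)`. -/
noncomputable def expansion (V : ℝ → ℝ) (p : ℝ × ℝ) : ℝ := √(energy V p)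

/-- The evolution field of `(φ, ψ)` with respect to the logarithmic time `τ`, `dτ = K dt`. It is
meaningful where the energy is positive. -/
noncomputable def logField (V : ℝ → ℝ) (p : ℝ × ℝ) : ℝ × ℝ :=
  (p.2 / expansion V p, -p.2 - deriv V p.1 / expansion V p)

/-- A non-negative `C²` potential. -/
structure IsPotential (V : ℝ → ℝ) : Prop where
  contDiff : ContDiff ℝ 2 V
  nonneg : ∀ φ, 0 ≤ V φ

variable {V : ℝ → ℝ}

lemma IsPotential.hasDerivAt (hV : IsPotential V) (x : ℝ) : HasDerivAt V (deriv V x) x :=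
  ((hV.contDiff.differentiable two_ne_zero) x).hasDerivAt

lemma IsPotential.contDiff_deriv (hV : IsPotential V) : ContDiff ℝ 1 (deriv V) :=
  (contDiff_succ_iff_deriv (n := 1).1 (by simpa [one_add_one_eq_two] using hV.contDiff)).2.2

lemma IsPotential.continuous (hV : IsPotential V) : Continuous V := hV.contDiff.continuous

lemma energy_nonneg (hV : IsPotential V) (p : ℝ × ℝ) : 0 ≤ energy V p := by
  have := hV.nonneg p.1
  unfold energy; positivity

lemma sq_le_energy (hV : IsPotential V) (p : ℝ × ℝ) : 3 / 2 * p.2 ^ 2 ≤ energy V p := by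
  have := hV.nonneg p.1
  unfold energy; linarith

lemma contDiff_energy (hV : IsPotential V) : ContDiff ℝ 2 (energy V) :=
  (contDiff_const.mul (hV.contDiff.comp contDiff_fst)).add
    (contDiff_const.mul (contDiff_snd.pow 2))

lemma continuous_energy (hV : IsPotential V) : Continuous (energy V) :=
  (contDiff_energy hV).continuous

lemma continuous_expansion (hV : IsPotential V) : Continuous (expansion V) :=
  Real.continuous_sqrt.comp (continuous_energy hV)

lemma expansion_pos {p : ℝ × ℝ} (hp : 0 < energy V p) : 0 < expansion V p := Real.sqrt_pos.mpr hp

lemma expansion_sq (hV : IsPotential V) (p : ℝ × ℝ) : expansion V p ^ 2 = energy V p :=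
  Real.sq_sqrt (energy_nonneg hV p)

lemma hasDerivAt_energy (hV : IsPotential V) {z : ℝ → ℝ × ℝ} {w : ℝ × ℝ} {t : ℝ}
    (hz : HasDerivAt z w t) :
    HasDerivAt (fun s => energy V (z s)) (3 * (deriv V (z t).1 * w.1) + 3 * (z t).2 * w.2) t := by
  have h1 : HasDerivAt (fun s => V (z s).1) (deriv V (z t).1 * w.1) t :=
    (hV.hasDerivAt (z t).1).comp t (hasDerivAt_fst hz)
  convert! (h1.const_mul 3).add (((hasDerivAt_snd hz).pow 2).const_mul (3 / 2)) using 1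
  simp; ring

lemma abs_snd_le (hV : IsPotential V) (p : ℝ × ℝ) : |p.2| ≤ κ * expansion V p := by
  refine abs_le_of_sq_le_sq ?_ (mul_nonneg κ_pos.le (Real.sqrt_nonneg _))
  rw [mul_pow, expansion_sq hV, pow_two κ, κ_mul_self]
  linarith [sq_le_energy hV p]

lemma abs_logField_fst_le (hV : IsPotential V) (p : ℝ × ℝ) : |(logField V p).1| ≤ κ := by
  have h0 : 0 ≤ expansion V p := Real.sqrt_nonneg _
  simp only [logField, abs_div, abs_of_nonneg h0]
  exact div_le_of_le_mul₀ h0 κ_pos.le (abs_snd_le hV p)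

lemma contDiffAt_logField (hV : IsPotential V) {p : ℝ × ℝ} (hp : 0 < energy V p) :
    ContDiffAt ℝ 1 (logField V) p := by
  have hK : ContDiffAt ℝ 1 (expansion V) p :=
    ((contDiff_energy hV).contDiffAt.of_le one_le_two).sqrt hp.ne'
  have hne := (expansion_pos hp).ne'
  exact (contDiffAt_snd.div hK hne).prodMk (contDiffAt_snd.neg.sub
    ((hV.contDiff_deriv.contDiffAt.comp p contDiffAt_fst).div hK hne))

/-- In logarithmic time `φ` has speed at most `κ`, and the energy is nonincreasing but decays at most
like `exp (-2 τ)`; so solutions stay in compact sets of physical data for bounded times. The bounds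
remain valid if the field is multiplied by a cutoff `c`. -/
lemma apriori_bounds (hV : IsPotential V) {z : ℝ → ℝ × ℝ} {T : ℝ}
    (hz : ∀ t ∈ Set.Ioo (-T) T, ∃ c ∈ Set.Icc (0 : ℝ) 1, HasDerivAt z (c • logField V (z t)) t)
    {t : ℝ} (ht : t ∈ Set.Ioo (-T) T) :
    |(z t).1 - (z 0).1| ≤ κ * |t| ∧ Real.exp (-2 * |t|) * energy V (z 0) ≤ energy V (z t) ∧
      energy V (z t) ≤ Real.exp (2 * |t|) * energy V (z 0) := by
  have h0 : (0 : ℝ) ∈ Set.Ioo (-T) T := ⟨by linarith [ht.1, ht.2], by linarith [ht.1, ht.2]⟩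
  choose! c hc hzc using hz
  have hconv : Convex ℝ (Set.Ioo (-T) T) := convex_Ioo (-T) T
  have hφ : ∀ s ∈ Set.Ioo (-T) T, HasDerivAt (fun s => (z s).1) (c s * (logField V (z s)).1) s :=
    fun s hs => hasDerivAt_fst (hzc s hs)
  have hb : ∀ s ∈ Set.Ioo (-T) T, |c s * (logField V (z s)).1| ≤ κ := by
    intro s hs
    rw [abs_mul, abs_of_nonneg (hc s hs).1]
    nlinarith [abs_logField_fst_le hV (z s), (hc s hs).1, (hc s hs).2,
      abs_nonneg (logField V (z s)).1, κ_pos]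
  have hup : MonotoneOn (fun s => (z s).1 + κ * s) (Set.Ioo (-T) T) :=
    monotoneOn_of_hasDerivAt_nonneg hconv
      (fun s hs => (hφ s hs).add ((hasDerivAt_id s).const_mul κ))
      (fun s hs => by linarith [(abs_le.mp (hb s hs)).1])
  have hdn : AntitoneOn (fun s => (z s).1 - κ * s) (Set.Ioo (-T) T) :=
    antitoneOn_of_hasDerivAt_nonpos hconv
      (fun s hs => (hφ s hs).sub ((hasDerivAt_id s).const_mul κ))
      (fun s hs => by linarith [(abs_le.mp (hb s hs)).2])
  have hk : ∀ s ∈ Set.Ioo (-T) T,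
      HasDerivAt (fun s => energy V (z s)) (-3 * c s * (z s).2 ^ 2) s := by
    intro s hs
    convert! hasDerivAt_energy hV (hzc s hs) using 1
    simp only [logField, Prod.smul_mk, smul_eq_mul]
    ring
  have hk1 : AntitoneOn (fun s => energy V (z s)) (Set.Ioo (-T) T) :=
    antitoneOn_of_hasDerivAt_nonpos hconv hk (fun s hs => by
      have := (hc s hs).1
      nlinarith [sq_nonneg (z s).2, mul_nonneg this (sq_nonneg (z s).2)])
  have hk2 : MonotoneOn (fun s => energy V (z s) * Real.exp (2 * s)) (Set.Ioo (-T) T) :=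
    monotoneOn_of_hasDerivAt_nonneg hconv
      (fun s hs => (hk s hs).mul (((hasDerivAt_id s).const_mul 2).exp)) (fun s hs => by
      have h1 := sq_le_energy hV (z s)
      have h2 := mul_le_mul_of_nonneg_right (hc s hs).2 (sq_nonneg (z s).2)
      have h3 := (Real.exp_pos (2 * s)).le
      have : 0 ≤ (-3 * c s * (z s).2 ^ 2 + energy V (z s) * 2) * Real.exp (2 * s) :=
        mul_nonneg (by linarith) h3
      simp only [id]
      linarith)
  have hk0 := energy_nonneg hV (z 0)
  rcases le_total 0 t with h | h
  · have a1 := hup h0 ht h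
    have a2 := hdn h0 ht h
    have a3 := hk1 h0 ht h
    have a4 := hk2 h0 ht h
    simp only [mul_zero, Real.exp_zero, mul_one, add_zero, sub_zero] at a1 a2 a3 a4
    rw [abs_of_nonneg h]
    refine ⟨abs_le.mpr ⟨by linarith, by linarith⟩, ?_, ?_⟩
    · rw [neg_mul, Real.exp_neg, inv_mul_le_iff₀ (Real.exp_pos _)]
      linarith
    · have := Real.one_le_exp (x := 2 * t) (by linarith)
      nlinarith
  · have a1 := hup ht h0 h
    have a2 := hdn ht h0 h
    have a3 := hk1 ht h0 h
    have a4 := hk2 ht h0 h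
    simp only [mul_zero, Real.exp_zero, mul_one, add_zero, sub_zero] at a1 a2 a3 a4
    rw [abs_of_nonpos h]
    refine ⟨abs_le.mpr ⟨by linarith, by linarith⟩, ?_, ?_⟩
    · have := Real.exp_le_one_iff.mpr (show -2 * -t ≤ 0 by linarith)
      nlinarith
    · rw [show 2 * -t = -(2 * t) by ring, Real.exp_neg, ← div_eq_inv_mul,
        le_div_iff₀ (Real.exp_pos _)]
      exact a4

/-- Near given initial data and for bounded times, the evolution field can be replaced by a
compactly supported `C¹` field. -/
lemma exists_cutoff (hV : IsPotential V) {p : ℝ × ℝ} (hp : 0 < energy V p) {T : ℝ} (hT : 0 < T) :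
    ∃ G : ℝ × ℝ → ℝ × ℝ, ContDiff ℝ 1 G ∧ HasCompactSupport G ∧
      (∀ x, ∃ c ∈ Set.Icc (0 : ℝ) 1, G x = c • logField V x) ∧
      ∀ᶠ q in 𝓝 p, ∀ x : ℝ × ℝ, |x.1 - q.1| ≤ T → Real.exp (-2 * T) * energy V q ≤ energy V x →
        energy V x ≤ Real.exp (2 * T) * energy V q → G =ᶠ[𝓝 x] logField V := by
  set lo := Real.exp (-2 * T) * (energy V p / 2) with hlo
  set hi := Real.exp (2 * T) * (2 * energy V p) with hhi
  have hlo0 : 0 < lo := by positivity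
  have hlohi : lo < hi := by
    have h1 := Real.exp_le_one_iff.mpr (show -2 * T ≤ 0 by linarith)
    have h2 := Real.one_le_exp (x := 2 * T) (by linarith)
    nlinarith
  let b₁ : ContDiffBump p.1 := ⟨T + 1, T + 2, by linarith, by linarith⟩
  let b₂ : ContDiffBump ((lo + hi) / 2) :=
    ⟨(lo + hi) / 2 - lo, (lo + hi) / 2 - lo / 2, by linarith, by linarith⟩
  set χ : ℝ × ℝ → ℝ := fun x => b₁ x.1 * b₂ (energy V x) with hχ
  have hχd : ContDiff ℝ 1 χ := (b₁.contDiff.comp contDiff_fst).mul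
    (b₂.contDiff.comp ((contDiff_energy hV).of_le one_le_two))
  have hb2 : ∀ k, k ≤ lo / 2 → b₂ k = 0 := by
    intro k hk
    refine b₂.zero_of_le_dist ?_
    rw [Real.dist_eq]
    refine le_trans ?_ (neg_abs_le _ |> neg_le.mp)
    simp only [b₂]; linarith
  have hb2' : ∀ k, hi + lo ≤ k → b₂ k = 0 := by
    intro k hk
    refine b₂.zero_of_le_dist ?_
    rw [Real.dist_eq]
    refine le_trans ?_ (le_abs_self _)
    simp only [b₂]; linarith
  refine ⟨fun x => χ x • logField V x, ?_, ?_, fun x => ⟨χ x, ⟨?_, ?_⟩, rfl⟩, ?_⟩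
  · rw [contDiff_iff_contDiffAt]
    intro x
    rcases lt_or_ge 0 (energy V x) with hx | hx
    · exact hχd.contDiffAt.smul (contDiffAt_logField hV hx)
    · have : ∀ᶠ y in 𝓝 x, energy V y < lo / 2 :=
        (continuous_energy hV).continuousAt.eventually_lt_const (by linarith)
      refine (contDiffAt_const (c := (0 : ℝ × ℝ))).congr_of_eventuallyEq ?_
      filter_upwards [this] with y hy
      simp [hχ, hb2 _ hy.le]
  · refine HasCompactSupport.intro (K := Metric.closedBall p.1 (T + 2) ×ˢ
      Metric.closedBall 0 (hi + lo + 1)) ((isCompact_closedBall _ _).prod (isCompact_closedBall _ _))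
      fun x hx => ?_
    simp only [Set.mem_prod, not_and_or, Metric.mem_closedBall, not_le] at hx
    rcases hx with hx | hx
    · have : b₁ x.1 = 0 := b₁.zero_of_le_dist hx.le
      simp [hχ, this]
    · have h1 := sq_le_energy hV x
      rw [Real.dist_eq, sub_zero] at hx
      have h2 : hi + lo ≤ energy V x := by
        rw [← sq_abs] at h1
        nlinarith
      simp [hχ, hb2' _ h2]
  · exact mul_nonneg b₁.nonneg b₂.nonneg
  · exact mul_le_one₀ b₁.le_one b₂.nonneg b₂.le_one
  · have e1 : ∀ᶠ q : ℝ × ℝ in 𝓝 p, |q.1 - p.1| < 1 := by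
      have : ContinuousAt (fun q : ℝ × ℝ => |q.1 - p.1|) p := by fun_prop
      exact this.eventually_lt_const (by simp)
    have e2 : ∀ᶠ q in 𝓝 p, energy V p / 2 < energy V q :=
      (continuous_energy hV).continuousAt.eventually_const_lt (by linarith)
    have e3 : ∀ᶠ q in 𝓝 p, energy V q < 2 * energy V p :=
      (continuous_energy hV).continuousAt.eventually_lt_const (by linarith)
    filter_upwards [e1, e2, e3] with q h1 h2 h3 x hx1 hx2 hx3
    have hlt : lo < energy V x := by
      refine lt_of_lt_of_le ?_ hx2
      exact mul_lt_mul_of_pos_left h2 (Real.exp_pos _)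
    have hgt : energy V x < hi := by
      refine lt_of_le_of_lt hx3 ?_
      exact mul_lt_mul_of_pos_left h3 (Real.exp_pos _)
    have f1 : ∀ᶠ y : ℝ × ℝ in 𝓝 x, b₁ y.1 = 1 := by
      refine continuous_fst.continuousAt.eventually (b₁.eventuallyEq_one_of_mem_ball ?_)
      rw [Metric.mem_ball, Real.dist_eq]
      have := abs_sub_le x.1 q.1 p.1
      simp only [b₁]; linarith
    have f2 : ∀ᶠ y in 𝓝 x, b₂ (energy V y) = 1 := by
      refine (continuous_energy hV).continuousAt.eventually (b₂.eventuallyEq_one_of_mem_ball ?_)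
      rw [Metric.mem_ball, Real.dist_eq, abs_lt]
      simp only [b₂]; constructor <;> linarith
    filter_upwards [f1, f2] with y hy1 hy2
    simp [hχ, hy1, hy2]

/-- A solution of the evolution equation in logarithmic time on all of `ℝ`. -/
def IsLogSolution (V : ℝ → ℝ) (p : ℝ × ℝ) (z : ℝ → ℝ × ℝ) : Prop :=
  z 0 = p ∧ ∀ t, HasDerivAt z (logField V (z t)) t

lemma energy_pos_of_solution (hV : IsPotential V) {z : ℝ → ℝ × ℝ} {T : ℝ}
    (hz : ∀ t ∈ Set.Ioo (-T) T, HasDerivAt z (logField V (z t)) t) (h0 : 0 < energy V (z 0)) :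
    ∀ t ∈ Set.Ioo (-T) T, 0 < energy V (z t) := fun t ht =>
  lt_of_lt_of_le (by positivity) (apriori_bounds hV
    (fun t ht => ⟨1, by simp, by simpa using hz t ht⟩) ht).2.1

/-- The cutoff field has a solution on `(-T, T)`; by the a priori bounds it never meets the cutoff. -/
lemma exists_solution_Ioo (hV : IsPotential V) {p : ℝ × ℝ} (hp : 0 < energy V p) (T : ℝ) :
    ∃ z : ℝ → ℝ × ℝ, z 0 = p ∧ ∀ t ∈ Set.Ioo (-T) T, HasDerivAt z (logField V (z t)) t := by
  rcases le_or_gt T 0 with hT | hT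
  · exact ⟨fun _ => p, rfl, fun t ht => by linarith [ht.1, ht.2]⟩
  obtain ⟨G, hG, hGs, hGc, hGe⟩ := exists_cutoff hV hp hT
  obtain ⟨L, hL⟩ := hG.lipschitzWith_of_hasCompactSupport hGs one_ne_zero
  obtain ⟨C, hC⟩ := hGs.exists_bound_of_continuous hG.continuous
  obtain ⟨z, hz0, hz⟩ := exists_solution_of_lipschitz_of_bounded (f := fun _ => G) hT (fun _ => hL)
    (fun _ => continuous_const) (fun _ => hC) p
  refine ⟨z, hz0, fun t ht => ?_⟩
  obtain ⟨b1, b2, b3⟩ := apriori_bounds hV (z := z) (T := T) (fun s hs => by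
    obtain ⟨c, hc, hcG⟩ := hGc (z s)
    exact ⟨c, hc, hcG ▸ hz s hs⟩) ht
  rw [hz0] at b1 b2 b3
  have htT : |t| ≤ T := abs_le.mpr ⟨ht.1.le, ht.2.le⟩
  have := hGe.self_of_nhds (z t) (by nlinarith [κ_lt_one, κ_pos, abs_nonneg t])
    (le_trans (mul_le_mul_of_nonneg_right (Real.exp_le_exp.mpr (by linarith)) hp.le) b2)
    (le_trans b3 (mul_le_mul_of_nonneg_right (Real.exp_le_exp.mpr (by linarith)) hp.le))
  rw [← this.self_of_nhds]
  exact hz t ht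

lemma exists_isLogSolution (hV : IsPotential V) {p : ℝ × ℝ} (hp : 0 < energy V p) :
    ∃ z, IsLogSolution V p z := by
  choose y hy0 hy using exists_solution_Ioo hV hp
  -- solutions on nested intervals agree, hence glue
  have huniq : ∀ S T, S ≤ T → Set.EqOn (y S) (y T) (Set.Ioo (-S) S) := by
    intro S T hST t ht
    have h0 : (0 : ℝ) ∈ Set.Ioo (-S) S := ⟨by linarith [ht.1, ht.2], by linarith [ht.1, ht.2]⟩
    refine eqOn_Ioo_of_contDiffAt h0 (fun s hs => contDiffAt_logField hV ?_) (hy S)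
      (fun s hs => hy T s ⟨by linarith [hs.1], by linarith [hs.2]⟩) (by rw [hy0, hy0]) ht
    exact energy_pos_of_solution hV (hy S) (by rw [hy0]; exact hp) s hs
  refine ⟨fun t => y (|t| + 1) t, by simp [hy0], fun t => ?_⟩
  have hev : (fun s => y (|s| + 1) s) =ᶠ[𝓝 t] y (|t| + 2) := by
    have : ∀ᶠ s in 𝓝 t, |s| < |t| + 1 :=
      continuous_abs.continuousAt.eventually_lt_const (by linarith)
    filter_upwards [this] with s hs
    refine huniq _ _ (by linarith) ⟨?_, ?_⟩
    · linarith [neg_abs_le s]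
    · linarith [le_abs_self s]
  have hmem : t ∈ Set.Ioo (-(|t| + 2)) (|t| + 2) :=
    ⟨by linarith [neg_abs_le t], by linarith [le_abs_self t]⟩
  have := (hy (|t| + 2) t hmem).congr_of_eventuallyEq hev
  rwa [← hev.self_of_nhds] at this

open Classical in
/-- The flow in logarithmic time: the state reached from the initial data `p` after time `τ`. By
convention `p` stays at rest if there is no global solution, which does not happen for physical data. -/
noncomputable def logFlow (V : ℝ → ℝ) (p : ℝ × ℝ) : ℝ → ℝ × ℝ :=
  if h : ∃ z, IsLogSolution V p z then h.choose else fun _ => p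

lemma isLogSolution_logFlow (hV : IsPotential V) {p : ℝ × ℝ} (hp : 0 < energy V p) :
    IsLogSolution V p (logFlow V p) := by
  have h := exists_isLogSolution hV hp
  rw [logFlow, dif_pos h]
  exact h.choose_spec

lemma logFlow_zero (hV : IsPotential V) {p : ℝ × ℝ} (hp : 0 < energy V p) : logFlow V p 0 = p :=
  (isLogSolution_logFlow hV hp).1

lemma hasDerivAt_logFlow (hV : IsPotential V) {p : ℝ × ℝ} (hp : 0 < energy V p) (t : ℝ) :
    HasDerivAt (logFlow V p) (logField V (logFlow V p t)) t := (isLogSolution_logFlow hV hp).2 t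

lemma continuous_logFlow (hV : IsPotential V) {p : ℝ × ℝ} (hp : 0 < energy V p) :
    Continuous (logFlow V p) :=
  continuous_iff_continuousAt.mpr fun t => (hasDerivAt_logFlow hV hp t).continuousAt

lemma logFlow_bounds (hV : IsPotential V) {p : ℝ × ℝ} (hp : 0 < energy V p) (t : ℝ) :
    |(logFlow V p t).1 - p.1| ≤ κ * |t| ∧
      Real.exp (-2 * |t|) * energy V p ≤ energy V (logFlow V p t) ∧
      energy V (logFlow V p t) ≤ Real.exp (2 * |t|) * energy V p := by
  have := apriori_bounds hV (z := logFlow V p) (T := |t| + 1)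
    (fun s _ => ⟨1, by simp, by simpa using hasDerivAt_logFlow hV hp s⟩)
    (t := t) ⟨by linarith [neg_abs_le t], by linarith [le_abs_self t]⟩
  rwa [logFlow_zero hV hp] at this

lemma energy_logFlow_pos (hV : IsPotential V) {p : ℝ × ℝ} (hp : 0 < energy V p) (t : ℝ) :
    0 < energy V (logFlow V p t) :=
  lt_of_lt_of_le (by positivity) (logFlow_bounds hV hp t).2.1

lemma logFlow_add (hV : IsPotential V) {p : ℝ × ℝ} (hp : 0 < energy V p) (s t : ℝ) :
    logFlow V (logFlow V p s) t = logFlow V p (s + t) := by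
  have hq := energy_logFlow_pos hV hp s
  have hmem : t ∈ Set.Ioo (-(|t| + 1)) (|t| + 1) :=
    ⟨by linarith [neg_abs_le t], by linarith [le_abs_self t]⟩
  refine eqOn_Ioo_of_contDiffAt (v := logField V) (g := fun r => logFlow V p (s + r)) (t₀ := 0)
    ⟨by linarith [abs_nonneg t], by linarith [abs_nonneg t]⟩
    (fun r _ => contDiffAt_logField hV (energy_logFlow_pos hV hq r))
    (fun r _ => hasDerivAt_logFlow hV hq r) (fun r _ => ?_) ?_ hmem
  · exact (hasDerivAt_logFlow hV hp (s + r)).comp_const_add s r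
  · simp [logFlow_zero hV hq]

lemma logFlow_neg_cancel (hV : IsPotential V) {p : ℝ × ℝ} (hp : 0 < energy V p) (s : ℝ) :
    logFlow V (logFlow V p s) (-s) = p := by
  rw [logFlow_add hV hp, add_neg_cancel, logFlow_zero hV hp]

/-- The compactly supported field of `exists_cutoff` drives the flow near `p` for bounded times. -/
lemma exists_local_model (hV : IsPotential V) {p : ℝ × ℝ} (hp : 0 < energy V p) {T : ℝ}
    (hT : 0 < T) :
    ∃ G : ℝ × ℝ → ℝ × ℝ, ContDiff ℝ 1 G ∧ HasCompactSupport G ∧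
      ∀ᶠ q in 𝓝 p, 0 < energy V q ∧
        ∀ t ∈ Set.Icc (-T) T, G =ᶠ[𝓝 (logFlow V q t)] logField V := by
  obtain ⟨G, hG, hGs, -, hGe⟩ := exists_cutoff hV hp hT
  refine ⟨G, hG, hGs, ?_⟩
  filter_upwards [hGe, (continuous_energy hV).continuousAt.eventually_const_lt hp] with q hq hq0
  refine ⟨hq0, fun t ht => ?_⟩
  obtain ⟨b1, b2, b3⟩ := logFlow_bounds hV hq0 t
  have htT : |t| ≤ T := abs_le.mpr ⟨ht.1, ht.2⟩
  exact hq _ (by nlinarith [κ_lt_one, κ_pos, abs_nonneg t])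
    (le_trans (mul_le_mul_of_nonneg_right (Real.exp_le_exp.mpr (by linarith)) hq0.le) b2)
    (le_trans b3 (mul_le_mul_of_nonneg_right (Real.exp_le_exp.mpr (by linarith)) hq0.le))

/-- Continuous dependence on the initial data. -/
lemma continuousAt_logFlow (hV : IsPotential V) {p : ℝ × ℝ} (hp : 0 < energy V p) (t : ℝ) :
    ContinuousAt (fun q => logFlow V q t) p := by
  obtain ⟨G, hG, hGs, hGe⟩ := exists_local_model hV hp (T := |t| + 1) (by positivity)
  obtain ⟨L, hL⟩ := hG.lipschitzWith_of_hasCompactSupport hGs one_ne_zero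
  -- flow along the field `sign t • G` for the time `|t|`
  obtain ⟨ε, hε, hεt⟩ : ∃ ε : ℝ, |ε| ≤ 1 ∧ ε * |t| = t := by
    rcases le_total 0 t with h | h
    · exact ⟨1, by simp, by rw [abs_of_nonneg h, one_mul]⟩
    · exact ⟨-1, by simp, by rw [abs_of_nonpos h]; ring⟩
  have hder : ∀ᶠ q in 𝓝 p, 0 < energy V q ∧ ∀ s ∈ Set.Icc 0 |t|,
      HasDerivAt (fun s => logFlow V q (ε * s)) (ε • G (logFlow V q (ε * s))) s := by
    filter_upwards [hGe] with q hq
    refine ⟨hq.1, fun s hs => ?_⟩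
    have hεs : |ε * s| ≤ |t| + 1 := by
      rw [abs_mul, abs_of_nonneg hs.1]; nlinarith [hs.1, hs.2]
    rw [(hq.2 (ε * s) (abs_le.mp hεs)).self_of_nhds]
    have h2 : HasDerivAt (fun s : ℝ => ε * s) ε s := by simpa using (hasDerivAt_id s).const_mul ε
    exact (hasDerivAt_logFlow hV hq.1 (ε * s)).scomp s h2
  have hLip : LipschitzWith L fun x => ε • G x := by
    refine LipschitzWith.of_dist_le_mul fun x y => ?_
    rw [dist_smul₀, Real.norm_eq_abs]
    exact (mul_le_of_le_one_left dist_nonneg hε).trans (hL.dist_le_mul x y)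
  have hp' := hder.self_of_nhds
  rw [ContinuousAt, tendsto_iff_dist_tendsto_zero]
  have hlim : Tendsto (fun q => dist q p * Real.exp (L * (|t| - 0))) (𝓝 p) (𝓝 0) := by
    have : Continuous fun q : ℝ × ℝ => dist q p * Real.exp (L * (|t| - 0)) := by fun_prop
    simpa using this.tendsto p
  refine tendsto_of_tendsto_of_tendsto_of_le_of_le' tendsto_const_nhds hlim
    (Eventually.of_forall fun _ => dist_nonneg) ?_
  filter_upwards [hder] with q hq
  have := dist_le_of_trajectories_ODE (v := fun _ x => ε • G x) (K := L)
    (f := fun s => logFlow V q (ε * s)) (g := fun s => logFlow V p (ε * s)) (a := 0) (b := |t|)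
    (δ := dist q p) (fun _ => hLip)
    (fun s hs => (hq.2 s hs).continuousAt.continuousWithinAt)
    (fun s hs => (hq.2 s ⟨hs.1, hs.2.le⟩).hasDerivWithinAt)
    (fun s hs => (hp'.2 s hs).continuousAt.continuousWithinAt)
    (fun s hs => (hp'.2 s ⟨hs.1, hs.2.le⟩).hasDerivWithinAt)
    (by simp [logFlow_zero hV hq.1, logFlow_zero hV hp]) |t| ⟨abs_nonneg t, le_rfl⟩
  simpa [hεt] using this

lemma expansion_hasDerivAt_fst (hV : IsPotential V) {p : ℝ × ℝ} (hp : 0 < energy V p) :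
    HasDerivAt (fun s => expansion V (s, p.2)) (3 * deriv V p.1 / (2 * expansion V p)) p.1 ∧
    HasDerivAt (fun s => expansion V (p.1, s)) (3 * p.2 / (2 * expansion V p)) p.2 := by
  have h1 := hasDerivAt_energy hV ((hasDerivAt_id p.1).prodMk (hasDerivAt_const p.1 p.2))
  have h2 := hasDerivAt_energy hV ((hasDerivAt_const p.2 p.1).prodMk (hasDerivAt_id p.2))
  constructor
  · convert! h1.sqrt hp.ne' using 1
    simp [expansion]
  · convert! h2.sqrt hp.ne' using 1
    simp [expansion]

/-- In logarithmic time the evolution field has divergence `-1`. -/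
lemma divergence_logField (hV : IsPotential V) {p : ℝ × ℝ} (hp : 0 < energy V p) :
    (fderiv ℝ (logField V) p (1, 0)).1 + (fderiv ℝ (logField V) p (0, 1)).2 = -1 := by
  have hF := ((contDiffAt_logField hV hp).differentiableAt one_ne_zero).hasFDerivAt
  obtain ⟨k1, k2⟩ := expansion_hasDerivAt_fst hV hp
  have hK := expansion_pos hp
  have e1 : HasDerivAt (fun s => logField V (s, p.2)) (fderiv ℝ (logField V) p (1, 0)) p.1 :=
    HasFDerivAt.comp_hasDerivAt p.1 (f := fun s => (s, p.2)) hF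
      ((hasDerivAt_id p.1).prodMk (hasDerivAt_const p.1 p.2))
  have e2 : HasDerivAt (fun s => logField V (p.1, s)) (fderiv ℝ (logField V) p (0, 1)) p.2 :=
    HasFDerivAt.comp_hasDerivAt p.2 (f := fun s => (p.1, s)) hF
      ((hasDerivAt_const p.2 p.1).prodMk (hasDerivAt_id p.2))
  have d1 : HasDerivAt (fun s => (logField V (s, p.2)).1) _ p.1 :=
    (hasDerivAt_const p.1 p.2).div k1 hK.ne'
  have d2 : HasDerivAt (fun s => (logField V (p.1, s)).2) _ p.2 :=
    (hasDerivAt_neg p.2).sub ((hasDerivAt_const p.2 (deriv V p.1)).div k2 hK.ne')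
  rw [(hasDerivAt_fst e1).unique d1, (hasDerivAt_snd e2).unique d2]
  field_simp
  ring

/-- The flow for logarithmic time `-1` expands areas by the factor `e`. -/
lemma exists_hasFDerivAt_logFlow (hV : IsPotential V) {p : ℝ × ℝ} (hp : 0 < energy V p) :
    ∃ D : (ℝ × ℝ) →L[ℝ] (ℝ × ℝ),
      HasFDerivAt (fun q => logFlow V q (-1)) D p ∧ D.det = Real.exp 1 := by
  obtain ⟨G, hG, hGs, hGe⟩ := exists_local_model hV hp one_pos
  have hG' : HasCompactSupport fun x => -G x := hGs.neg
  have hmem : ∀ t ∈ Set.Icc (0 : ℝ) 1, -t ∈ Set.Icc (-1 : ℝ) 1 := fun t ht =>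
    ⟨by linarith [ht.2], by linarith [ht.1]⟩
  refine exists_hasFDerivAt_flow_det (G := fun x => -G x) (γ := fun q t => logFlow V q (-t))
    hG.neg hG' ((continuous_logFlow hV hp).comp continuous_neg) ?_ ?_ ?_
  · filter_upwards [hGe] with q hq
    simp [logFlow_zero hV hq.1]
  · filter_upwards [hGe] with q hq t ht
    rw [(hq.2 (-t) (hmem t ht)).self_of_nhds]
    have := (hasDerivAt_logFlow hV hq.1 (-t)).scomp t (hasDerivAt_neg t)
    rw [neg_one_smul] at this
    exact this
  · intro t ht
    have h1 := (hGe.self_of_nhds.2 (-t) (hmem t ht)).fderiv_eq (𝕜 := ℝ)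
    have h2 := divergence_logField hV (energy_logFlow_pos hV hp (-t))
    have h3 : fderiv ℝ (fun x => -G x) (logFlow V p (-t))
        = -fderiv ℝ (logField V) (logFlow V p (-t)) := by rw [fderiv_fun_neg, h1]
    rw [h3]
    simp only [neg_apply, Prod.fst_neg, Prod.snd_neg]
    linarith

end FRW

namespace FRW
/-! ### Regions from which the past flow cannot escape -/

/-- A potential that grows at most like `exp (√6 ν |φ|)`, with `ν < 1`, for `|φ| ≥ R`, in the
infinitesimal sense `|V'| ≤ √6 ν V`; note `√6 = 3κ`. The number `μ` is any choice in `(ν, 1)`. -/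
structure IsAdmissible (V : ℝ → ℝ) (ν μ R : ℝ) : Prop extends IsPotential V where
  ν_nonneg : 0 ≤ ν
  ν_lt : ν < μ
  μ_lt : μ < 1
  R_nonneg : 0 ≤ R
  abs_deriv_le : ∀ φ, R ≤ |φ| → |deriv V φ| ≤ 3 * κ * ν * V φ

variable {V : ℝ → ℝ} {ν μ R : ℝ}

lemma IsAdmissible.μ_pos (h : IsAdmissible V ν μ R) : 0 < μ := h.ν_nonneg.trans_lt h.ν_lt

/-- Velocity of `φ` in logarithmic time; it lies in `[-κ, κ]`. -/
noncomputable def speed (V : ℝ → ℝ) (p : ℝ × ℝ) : ℝ := p.2 / expansion V p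

/-- The potential energy fraction `V / K²`. -/
noncomputable def ratio (V : ℝ → ℝ) (p : ℝ × ℝ) : ℝ := V p.1 / energy V p

lemma abs_speed_le (hV : IsPotential V) (p : ℝ × ℝ) : |speed V p| ≤ κ := abs_logField_fst_le hV p

lemma ratio_nonneg (hV : IsPotential V) (p : ℝ × ℝ) : 0 ≤ ratio V p :=
  div_nonneg (hV.nonneg _) (energy_nonneg hV p)

/-- The constraint equation in the normalised variables. -/
lemma speed_sq (hV : IsPotential V) {p : ℝ × ℝ} (hp : 0 < energy V p) :
    3 / 2 * speed V p ^ 2 = 1 - 3 * ratio V p := by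
  rw [speed, div_pow, expansion_sq hV, ratio]
  field_simp
  unfold energy
  ring

section derivatives

variable (hV : IsPotential V) {p : ℝ × ℝ} (hp : 0 < energy V p)
include hV hp

lemma hasDerivAt_fst_logFlow (t : ℝ) :
    HasDerivAt (fun s => (logFlow V p s).1) (speed V (logFlow V p t)) t :=
  hasDerivAt_fst (hasDerivAt_logFlow hV hp t)

lemma hasDerivAt_energy_logFlow (t : ℝ) :
    HasDerivAt (fun s => energy V (logFlow V p s)) (-3 * (logFlow V p t).2 ^ 2) t := by
  convert! hasDerivAt_energy hV (hasDerivAt_logFlow hV hp t) using 1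
  simp only [logField]
  ring

lemma hasDerivAt_expansion_logFlow (t : ℝ) :
    HasDerivAt (fun s => expansion V (logFlow V p s))
      (-(3 / 2) * speed V (logFlow V p t) ^ 2 * expansion V (logFlow V p t)) t := by
  have hk := energy_logFlow_pos hV hp t
  have hK := expansion_pos hk
  convert! (hasDerivAt_energy_logFlow hV hp t).sqrt hk.ne' using 1
  change _ = _ / (2 * expansion V (logFlow V p t))
  rw [speed]
  field_simp

lemma hasDerivAt_speed_logFlow (t : ℝ) :
    HasDerivAt (fun s => speed V (logFlow V p s))
      (-3 * ratio V (logFlow V p t) * speed V (logFlow V p t)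
        - deriv V (logFlow V p t).1 / energy V (logFlow V p t)) t := by
  have hk := energy_logFlow_pos hV hp t
  have hK := expansion_pos hk
  convert! (hasDerivAt_snd (hasDerivAt_logFlow hV hp t)).div
    (hasDerivAt_expansion_logFlow hV hp t) hK.ne' using 1
  have h1 := speed_sq hV hk
  rw [show -3 * ratio V (logFlow V p t) = 3 / 2 * speed V (logFlow V p t) ^ 2 - 1 by linarith,
    ← expansion_sq hV]
  simp only [logField, speed]
  field_simp
  ring

lemma hasDerivAt_ratio_logFlow (t : ℝ) :
    HasDerivAt (fun s => ratio V (logFlow V p s))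
      (deriv V (logFlow V p t).1 * speed V (logFlow V p t) / energy V (logFlow V p t)
        + 3 * speed V (logFlow V p t) ^ 2 * ratio V (logFlow V p t)) t := by
  have hk := energy_logFlow_pos hV hp t
  have hK := expansion_pos hk
  have h1 : HasDerivAt (fun s => V (logFlow V p s).1)
      (deriv V (logFlow V p t).1 * speed V (logFlow V p t)) t :=
    (hV.hasDerivAt _).comp t (hasDerivAt_fst_logFlow hV hp t)
  convert! h1.div (hasDerivAt_energy_logFlow hV hp t) hk.ne' using 1
  simp only [speed, ratio, ← expansion_sq hV]
  field_simp
  ring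

lemma continuous_speed_logFlow : Continuous fun s => speed V (logFlow V p s) :=
  continuous_iff_continuousAt.mpr fun t => (hasDerivAt_speed_logFlow hV hp t).continuousAt

lemma energy_logFlow_antitone : Antitone fun s => energy V (logFlow V p s) := by
  refine antitone_of_hasDerivAt_nonpos (hasDerivAt_energy_logFlow hV hp) fun t => ?_
  change -3 * (logFlow V p t).2 ^ 2 ≤ 0
  nlinarith [sq_nonneg (logFlow V p t).2]

end derivatives

/-- States with `|φ| > R` for which `|φ|` increases to the past at more than the fraction `μ` of the
maximal speed `κ`. For `σ = 1` they
have `φ < 0` and `φ` increasing with time. -/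
def trapped (V : ℝ → ℝ) (σ μ R : ℝ) : Set (ℝ × ℝ) :=
  {p | 0 < energy V p ∧ σ * p.1 < -R ∧ κ * μ < σ * speed V p}

lemma sign_mul_self {σ : ℝ} (hσ : σ = 1 ∨ σ = -1) : σ * σ = 1 := by rcases hσ with rfl | rfl <;> norm_num

lemma abs_sign {σ : ℝ} (hσ : σ = 1 ∨ σ = -1) : |σ| = 1 := by rcases hσ with rfl | rfl <;> norm_num

lemma isOpen_initialData (hV : IsPotential V) : IsOpen {p | 0 < energy V p} :=
  isOpen_lt continuous_const (continuous_energy hV)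

lemma continuousAt_speed (hV : IsPotential V) {p : ℝ × ℝ} (hp : 0 < energy V p) :
    ContinuousAt (speed V) p :=
  continuousAt_snd.div (continuous_expansion hV).continuousAt (expansion_pos hp).ne'

lemma isOpen_trapped (hV : IsPotential V) (σ μ R : ℝ) : IsOpen (trapped V σ μ R) := by
  rw [isOpen_iff_mem_nhds]
  rintro p ⟨hp, h1, h2⟩
  have c1 : ContinuousAt (fun q : ℝ × ℝ => σ * q.1) p := by fun_prop
  have c2 : ContinuousAt (fun q : ℝ × ℝ => σ * speed V q) p :=
    continuousAt_const.mul (continuousAt_speed hV hp)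
  filter_upwards [(isOpen_initialData hV).mem_nhds hp, c1.eventually_lt_const h1,
    c2.eventually_const_lt h2] with q q0 q1 q2 using ⟨q0, q1, q2⟩

/-- Where the growth bound of `V` applies, a speed above `κ ν` increases to the past. -/
lemma sign_mul_speed_deriv_nonpos (h : IsAdmissible V ν μ R) {σ : ℝ} (hσ : σ = 1 ∨ σ = -1)
    {q : ℝ × ℝ} (hq : 0 < energy V q) (hR : R ≤ |q.1|) (hX : κ * ν ≤ σ * speed V q) :
    σ * (-3 * ratio V q * speed V q - deriv V q.1 / energy V q) ≤ 0 := by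
  have h1 := h.abs_deriv_le q.1 hR
  have h2 : |σ * (deriv V q.1 / energy V q)| ≤ 3 * κ * ν * ratio V q := by
    rw [abs_mul, abs_sign hσ, one_mul, abs_div, abs_of_pos hq, ratio, ← mul_div_assoc]
    gcongr
  have h3 := (abs_le.mp h2).1
  have h4 := mul_le_mul_of_nonneg_left hX (ratio_nonneg h.toIsPotential q)
  nlinarith

/-- The past evolution keeps the speed above `κ μ` once it starts in the outer region, or with an
expansion so large that the potential is negligible in the inner region. -/
lemma speed_gt_of_past (h : IsAdmissible V ν μ R) {σ : ℝ} (hσ : σ = 1 ∨ σ = -1) {k₀ : ℝ}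
    (hk₀ : ∀ φ, |φ| ≤ R → 3 * V φ < (1 - μ ^ 2) * k₀)
    {p : ℝ × ℝ} (hp : 0 < energy V p) (hX : κ * μ < σ * speed V p)
    (hor : σ * p.1 < -R ∨ k₀ ≤ energy V p) :
    ∀ s ≥ 0, κ * μ < σ * speed V (logFlow V p (-s)) := by
  have hV := h.toIsPotential
  have hκμ : 0 < κ * μ := mul_pos κ_pos h.μ_pos
  have hgc : Continuous fun s => σ * speed V (logFlow V p (-s)) :=
    continuous_const.mul ((continuous_speed_logFlow hV hp).comp continuous_neg)
  have hgd : ∀ s, HasDerivAt (fun s => σ * speed V (logFlow V p (-s)))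
      (-(σ * (-3 * ratio V (logFlow V p (-s)) * speed V (logFlow V p (-s))
        - deriv V (logFlow V p (-s)).1 / energy V (logFlow V p (-s))))) s := by
    intro s
    convert! (((hasDerivAt_speed_logFlow hV hp (-s)).comp s (hasDerivAt_neg s)).const_mul σ) using 1
    ring
  have hφd : ∀ s, HasDerivAt (fun s => σ * (logFlow V p (-s)).1)
      (-(σ * speed V (logFlow V p (-s)))) s := by
    intro s
    convert! (((hasDerivAt_fst_logFlow hV hp (-s)).comp s (hasDerivAt_neg s)).const_mul σ) using 1
    ring
  refine mem_of_continuous_induction hgc isOpen_Ioi (O := Set.Ioi (κ * μ)) fun s hs hind => ?_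
  simp only [Set.mem_Ioi] at hind ⊢
  rcases hs.eq_or_lt with rfl | hs
  · simpa [logFlow_zero hV hp] using hX
  have hge : ∀ r ∈ Set.Icc 0 s, κ * μ ≤ σ * speed V (logFlow V p (-r)) := by
    have hcl : Set.Icc 0 s ⊆ closure (Set.Ico 0 s) := by rw [closure_Ico hs.ne]
    intro r hr
    exact closure_minimal (fun r hr => (hind r hr.1 hr.2).le)
      (isClosed_le continuous_const hgc) (hcl hr)
  have hφ : σ * (logFlow V p (-s)).1 ≤ σ * p.1 := by
    have := antitoneOn_of_hasDerivAt_nonpos (convex_Icc 0 s) (fun r _ => hφd r)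
      (fun r hr => by linarith [hge r hr]) ⟨le_rfl, hs.le⟩ ⟨hs.le, le_rfl⟩ hs.le
    simpa [logFlow_zero hV hp] using this
  have hqs := energy_logFlow_pos hV hp (-s)
  rcases le_or_gt |(logFlow V p (-s)).1| R with hR | hR
  · have hk : k₀ ≤ energy V (logFlow V p (-s)) := by
      rcases hor with hor | hor
      · have h1 : |σ * (logFlow V p (-s)).1| ≤ R := by rwa [abs_mul, abs_sign hσ, one_mul]
        linarith [(abs_le.mp h1).1]
      · have := energy_logFlow_antitone hV hp (show -s ≤ 0 by linarith)
        simp only [logFlow_zero hV hp] at this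
        linarith
    have h1 := hk₀ _ hR
    have hμ2 : 0 < 1 - μ ^ 2 := by nlinarith [h.μ_lt, h.μ_pos]
    have h2 : 3 * ratio V (logFlow V p (-s)) < 1 - μ ^ 2 := by
      rw [ratio, ← mul_div_assoc, div_lt_iff₀ hqs]
      nlinarith
    have h3 := speed_sq hV hqs
    have h4 : (κ * μ) ^ 2 < (σ * speed V (logFlow V p (-s))) ^ 2 := by
      have e1 : (κ * μ) ^ 2 = 2 / 3 * μ ^ 2 := by rw [mul_pow, pow_two κ, κ_mul_self]
      have e2 : (σ * speed V (logFlow V p (-s))) ^ 2 = speed V (logFlow V p (-s)) ^ 2 := by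
        rw [mul_pow, pow_two σ, sign_mul_self hσ, one_mul]
      rw [e1, e2]; linarith
    exact lt_of_pow_lt_pow_left₀ 2 (hκμ.le.trans (hge s ⟨hs.le, le_rfl⟩)) h4
  · -- just before `s` the speed was already above `κ μ`, and it does not decrease to the past
    have hc : Continuous fun r => |(logFlow V p (-r)).1| :=
      (continuous_fst.comp ((continuous_logFlow hV hp).comp continuous_neg)).abs
    obtain ⟨ε, hε, hεR⟩ := Metric.eventually_nhds_iff.mp (hc.continuousAt.eventually_const_lt hR)
    set r := max 0 (s - ε / 2) with hr
    have hr0 : 0 ≤ r := le_max_left _ _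
    have hrs : r < s := max_lt hs (by linarith)
    have hmono := monotoneOn_of_hasDerivAt_nonneg (convex_Icc r s) (fun x _ => hgd x)
      (fun x hx => by
        have hx1 : R ≤ |(logFlow V p (-x)).1| := by
          refine (hεR ?_).le
          rw [Real.dist_eq, abs_lt]
          have := le_max_right 0 (s - ε / 2)
          constructor <;> linarith [hx.1, hx.2]
        have hx2 := hge x ⟨hr0.trans hx.1, hx.2⟩
        have hx3 : κ * ν ≤ κ * μ := mul_le_mul_of_nonneg_left h.ν_lt.le κ_pos.le
        have := sign_mul_speed_deriv_nonpos h hσ (energy_logFlow_pos hV hp (-x)) hx1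
          (hx3.trans hx2)
        linarith)
    exact (hind r hr0 hrs).trans_le (hmono ⟨le_rfl, hrs.le⟩ ⟨hrs.le, le_rfl⟩ hrs.le)

lemma sign_mul_fst_le_of_past (hV : IsPotential V) {σ : ℝ} {p : ℝ × ℝ} (hp : 0 < energy V p)
    (hX : ∀ s ≥ 0, κ * μ < σ * speed V (logFlow V p (-s))) {s : ℝ} (hs : 0 ≤ s) :
    σ * (logFlow V p (-s)).1 ≤ σ * p.1 - κ * μ * s := by
  have hd : ∀ s, HasDerivAt (fun s => σ * (logFlow V p (-s)).1 + κ * μ * s)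
      (-(σ * speed V (logFlow V p (-s))) + κ * μ) s := by
    intro s
    convert! (((hasDerivAt_fst_logFlow hV hp (-s)).comp s (hasDerivAt_neg s)).const_mul σ).add
      ((hasDerivAt_id s).const_mul (κ * μ)) using 1
    simp
  have := antitoneOn_of_hasDerivAt_nonpos (convex_Ici 0) (fun r _ => hd r)
    (fun r hr => by linarith [hX r hr]) (Set.self_mem_Ici) (show s ∈ Set.Ici 0 from hs) hs
  simp only [neg_zero, logFlow_zero hV hp, mul_zero, add_zero] at this
  linarith

lemma exists_energy_bound (h : IsAdmissible V ν μ R) :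
    ∃ k₀, 0 < k₀ ∧ ∀ φ, |φ| ≤ R → 3 * V φ < (1 - μ ^ 2) * k₀ := by
  obtain ⟨C, hC⟩ := (isCompact_Icc (a := -R) (b := R)).exists_bound_of_continuousOn
    h.toIsPotential.continuous.continuousOn
  have hμ2 : 0 < 1 - μ ^ 2 := by nlinarith [h.μ_lt, h.μ_pos]
  refine ⟨(3 * |C| + 1) / (1 - μ ^ 2), by positivity, fun φ hφ => ?_⟩
  rw [mul_div_cancel₀ _ hμ2.ne']
  have := hC φ (abs_le.mp hφ)
  have := le_abs_self (V φ)
  rw [Real.norm_eq_abs] at *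
  linarith [le_abs_self C]

/-- The trapped region is invariant to the past, and `φ` recedes in it at a definite rate. -/
lemma trapped_past (h : IsAdmissible V ν μ R) {σ : ℝ} (hσ : σ = 1 ∨ σ = -1) {p : ℝ × ℝ}
    (hp : p ∈ trapped V σ μ R) {t : ℝ} (ht : t ≤ 0) :
    logFlow V p t ∈ trapped V σ μ R ∧ σ * (logFlow V p t).1 ≤ σ * p.1 + κ * μ * t := by
  obtain ⟨k₀, -, hk₀⟩ := exists_energy_bound h
  have hX := speed_gt_of_past h hσ hk₀ hp.1 hp.2.2 (.inl hp.2.1)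
  have h1 := sign_mul_fst_le_of_past h.toIsPotential hp.1 hX (s := -t) (by linarith)
  have h2 := hX (-t) (by linarith)
  rw [neg_neg] at h1 h2
  have h3 : κ * μ * t ≤ 0 := mul_nonpos_of_nonneg_of_nonpos (mul_pos κ_pos h.μ_pos).le ht
  exact ⟨⟨energy_logFlow_pos h.toIsPotential hp.1 t, by linarith [hp.2.1], h2⟩, by linarith⟩

/-- Initial data whose orbit meets the trapped region, so that `φ → -σ ∞` to the past. -/
def basin (V : ℝ → ℝ) (σ μ R : ℝ) : Set (ℝ × ℝ) :=
  {p | 0 < energy V p ∧ ∃ t, logFlow V p t ∈ trapped V σ μ R}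

lemma isOpen_basin (hV : IsPotential V) (σ μ R : ℝ) : IsOpen (basin V σ μ R) := by
  rw [isOpen_iff_mem_nhds]
  rintro p ⟨hp, t, ht⟩
  filter_upwards [(isOpen_initialData hV).mem_nhds hp,
    (continuousAt_logFlow hV hp t).eventually_mem ((isOpen_trapped hV σ μ R).mem_nhds ht)]
    with q hq hqt using ⟨hq, t, hqt⟩

lemma trapped_subset_basin (hV : IsPotential V) {σ : ℝ} : trapped V σ μ R ⊆ basin V σ μ R :=
  fun p hp => ⟨hp.1, 0, by rwa [logFlow_zero hV hp.1]⟩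

lemma basin_eventually (h : IsAdmissible V ν μ R) {σ : ℝ} (hσ : σ = 1 ∨ σ = -1) {p : ℝ × ℝ}
    (hp : p ∈ basin V σ μ R) : ∃ T, ∀ t ≤ T, logFlow V p t ∈ trapped V σ μ R := by
  obtain ⟨hp0, T, hT⟩ := hp
  refine ⟨T, fun t ht => ?_⟩
  have := (trapped_past h hσ hT (t := t - T) (by linarith)).1
  rwa [logFlow_add h.toIsPotential hp0, add_sub_cancel] at this

lemma logFlow_mem_basin_iff (hV : IsPotential V) {σ : ℝ} {p : ℝ × ℝ} (hp : 0 < energy V p) (s : ℝ) :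
    logFlow V p s ∈ basin V σ μ R ↔ p ∈ basin V σ μ R := by
  constructor
  · rintro ⟨-, t, ht⟩
    exact ⟨hp, s + t, by rwa [logFlow_add hV hp] at ht⟩
  · rintro ⟨-, t, ht⟩
    exact ⟨energy_logFlow_pos hV hp s, t - s, by rwa [logFlow_add hV hp, add_sub_cancel]⟩

lemma basin_disjoint (h : IsAdmissible V ν μ R) :
    Disjoint (basin V 1 μ R) (basin V (-1) μ R) := by
  rw [Set.disjoint_left]
  intro p h1 h2
  obtain ⟨T, hT⟩ := basin_eventually h (.inl rfl) h1
  obtain ⟨T', hT'⟩ := basin_eventually h (.inr rfl) h2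
  have a := (hT (min T T') (min_le_left _ _)).2.1
  have b := (hT' (min T T') (min_le_right _ _)).2.1
  linarith [h.R_nonneg]

/-- At large energy a speed above `κ μ` leads into the trapped region: the bound on the speed persists
to the past, also through `|φ| ≤ R`, so that `φ` is carried beyond `R`. -/
lemma mem_basin_of_speed (h : IsAdmissible V ν μ R) {σ : ℝ} (hσ : σ = 1 ∨ σ = -1) {k₀ : ℝ}
    (hk₀ : ∀ φ, |φ| ≤ R → 3 * V φ < (1 - μ ^ 2) * k₀) {p : ℝ × ℝ} (hp : 0 < energy V p)
    (hX : κ * μ < σ * speed V p) (hk : k₀ ≤ energy V p) : p ∈ basin V σ μ R := by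
  have hV := h.toIsPotential
  have hs := speed_gt_of_past h hσ hk₀ hp hX (.inr hk)
  have hκμ : 0 < κ * μ := mul_pos κ_pos h.μ_pos
  set s := (|σ * p.1| + R + 1) / (κ * μ)
  have hs0 : 0 ≤ s := div_nonneg (by linarith [abs_nonneg (σ * p.1), h.R_nonneg]) hκμ.le
  refine ⟨hp, -s, energy_logFlow_pos hV hp _, ?_, hs s hs0⟩
  have := sign_mul_fst_le_of_past hV hp hs hs0
  rw [mul_div_cancel₀ _ hκμ.ne'] at this
  linarith [le_abs_self (σ * p.1)]

/-! ### Exceptional initial data -/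

/-- Growth of an admissible potential on each of the two outer half lines. -/
lemma potential_le (h : IsAdmissible V ν μ R) {σ : ℝ} (hσ : σ = 1 ∨ σ = -1) {a b : ℝ}
    (ha : R ≤ σ * a) (hb : R ≤ σ * b) : V b ≤ V a * Real.exp (3 * κ * ν * |b - a|) := by
  have hd : ∀ x, HasDerivAt (fun x => V (σ * x)) (deriv V (σ * x) * σ) x := fun x =>
    (h.toIsPotential.hasDerivAt (σ * x)).comp x (by simpa using (hasDerivAt_id x).const_mul σ)
  have hbd : ∀ x ∈ Set.Ici R, |deriv V (σ * x) * σ| ≤ 3 * κ * ν * V (σ * x) := by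
    intro x hx
    rw [abs_mul, abs_sign hσ, mul_one]
    refine h.abs_deriv_le _ ?_
    rw [abs_mul, abs_sign hσ, one_mul]
    exact le_trans hx (le_abs_self x)
  have hE : ∀ c x : ℝ, HasDerivAt (fun x => Real.exp (c * x)) (Real.exp (c * x) * c) x :=
    fun c x => by simpa using ((hasDerivAt_id x).const_mul c).exp
  have hup : MonotoneOn (fun x => V (σ * x) * Real.exp (3 * κ * ν * x)) (Set.Ici R) :=
    monotoneOn_of_hasDerivAt_nonneg (convex_Ici R) (fun x _ => (hd x).mul (hE _ x)) fun x hx => by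
      have := (abs_le.mp (hbd x hx)).1
      have h2 := Real.exp_pos (3 * κ * ν * x)
      nlinarith
  have hdn : AntitoneOn (fun x => V (σ * x) * Real.exp (-(3 * κ * ν) * x)) (Set.Ici R) :=
    antitoneOn_of_hasDerivAt_nonpos (convex_Ici R) (fun x _ => (hd x).mul (hE _ x)) fun x hx => by
      have := (abs_le.mp (hbd x hx)).2
      have h2 := Real.exp_pos (-(3 * κ * ν) * x)
      nlinarith
  have hσσ := sign_mul_self hσ
  have hab : |b - a| = |σ * b - σ * a| := by rw [← mul_sub, abs_mul, abs_sign hσ, one_mul]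
  have ea : σ * (σ * a) = a := by rw [← mul_assoc, hσσ, one_mul]
  have eb : σ * (σ * b) = b := by rw [← mul_assoc, hσσ, one_mul]
  rw [hab]
  rcases le_total (σ * a) (σ * b) with hle | hle
  · have := hdn ha hb hle
    simp only [ea, eb] at this
    rw [abs_of_nonneg (sub_nonneg.mpr hle), mul_sub, sub_eq_add_neg, Real.exp_add, mul_comm (Real.exp _),
      ← mul_assoc]
    rw [neg_mul, Real.exp_neg, neg_mul, ← div_eq_mul_inv, div_le_iff₀ (Real.exp_pos _)] at this
    exact this
  · have := hup hb ha hle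
    simp only [ea, eb] at this
    rw [abs_of_nonpos (sub_nonpos.mpr hle), neg_sub, mul_sub, sub_eq_add_neg, Real.exp_add,
      Real.exp_neg, ← mul_assoc, ← div_eq_mul_inv, le_div_iff₀ (Real.exp_pos _)]
    exact this

lemma exists_potential_le_exp (h : IsAdmissible V ν μ R) :
    ∃ M, 0 < M ∧ ∀ φ, V φ ≤ M * Real.exp (3 * κ * ν * |φ|) := by
  obtain ⟨C, hC⟩ := (isCompact_Icc (a := -R) (b := R)).exists_bound_of_continuousOn
    h.toIsPotential.continuous.continuousOn
  have hC' : ∀ φ, |φ| ≤ R → V φ ≤ |C| + 1 := fun φ hφ => by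
    have := hC φ (abs_le.mp hφ)
    rw [Real.norm_eq_abs] at this
    linarith [le_abs_self (V φ), le_abs_self C]
  have hκν : 0 ≤ 3 * κ * ν := mul_nonneg (mul_nonneg (by norm_num) κ_pos.le) h.ν_nonneg
  refine ⟨|C| + 1, by positivity, fun φ => ?_⟩
  rcases le_total |φ| R with hφ | hφ
  · refine (hC' φ hφ).trans (le_mul_of_one_le_right (by positivity) ?_)
    exact Real.one_le_exp (by positivity)
  · obtain ⟨σ, hσ, hσφ⟩ : ∃ σ : ℝ, (σ = 1 ∨ σ = -1) ∧ σ * φ = |φ| := by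
      rcases le_total 0 φ with h0 | h0
      · exact ⟨1, .inl rfl, by rw [abs_of_nonneg h0, one_mul]⟩
      · exact ⟨-1, .inr rfl, by rw [abs_of_nonpos h0]; ring⟩
    have hσσ := sign_mul_self hσ
    have e1 : σ * (σ * R) = R := by rw [← mul_assoc, hσσ, one_mul]
    have e2 : |φ - σ * R| ≤ |φ| := by
      have : φ - σ * R = σ * (|φ| - R) := by rw [← hσφ, mul_sub, ← mul_assoc, hσσ, one_mul]
      rw [this, abs_mul, abs_sign hσ, one_mul, abs_of_nonneg (by linarith)]
      linarith [h.R_nonneg]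
    refine (potential_le h hσ (a := σ * R) (by rw [e1]) (by rwa [hσφ])).trans ?_
    refine mul_le_mul (hC' _ ?_) (Real.exp_le_exp.mpr (mul_le_mul_of_nonneg_left e2 hκν))
      (Real.exp_pos _).le (by positivity)
    rw [abs_mul, abs_sign hσ, one_mul, abs_of_nonneg h.R_nonneg]

/-- Initial data in neither basin. -/
def exceptional (V : ℝ → ℝ) (μ R : ℝ) : Set (ℝ × ℝ) :=
  {p | 0 < energy V p ∧ p ∉ basin V 1 μ R ∧ p ∉ basin V (-1) μ R}

lemma measurableSet_exceptional (hV : IsPotential V) : MeasurableSet (exceptional V μ R) :=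
  (isOpen_initialData hV).measurableSet.inter
    ((isOpen_basin hV 1 μ R).measurableSet.compl.inter (isOpen_basin hV (-1) μ R).measurableSet.compl)

/-- On exceptional data either the expansion is bounded, or the potential energy is a fixed
fraction of the total; so `ψ` is controlled by `√V`. -/
lemma exists_abs_snd_le_exp (h : IsAdmissible V ν μ R) :
    ∃ C, 0 < C ∧ ∀ p ∈ exceptional V μ R, |p.2| ≤ C * Real.exp (3 / 2 * κ * ν * |p.1|) := by
  obtain ⟨k₀, hk₀0, hk₀⟩ := exists_energy_bound h
  obtain ⟨M, hM0, hM⟩ := exists_potential_le_exp h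
  have hV := h.toIsPotential
  have hμ2 : 0 < 1 - μ ^ 2 := by nlinarith [h.μ_lt, h.μ_pos]
  have hκν : 0 ≤ 3 * κ * ν := mul_nonneg (mul_nonneg (by norm_num) κ_pos.le) h.ν_nonneg
  set A := k₀ + 3 * M / (1 - μ ^ 2) with hA
  have hA0 : 0 < A := by positivity
  refine ⟨√A, Real.sqrt_pos.mpr hA0, fun p hp => ?_⟩
  have hX : k₀ ≤ energy V p → |speed V p| ≤ κ * μ := by
    intro hk
    by_contra! hcon
    rcases lt_abs.mp hcon with hc | hc
    · exact hp.2.1 (mem_basin_of_speed h (.inl rfl) hk₀ hp.1 (by linarith) hk)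
    · exact hp.2.2 (mem_basin_of_speed h (.inr rfl) hk₀ hp.1 (by linarith) hk)
  have he1 : 1 ≤ Real.exp (3 * κ * ν * |p.1|) := Real.one_le_exp (by positivity)
  have hk : energy V p ≤ A * Real.exp (3 * κ * ν * |p.1|) := by
    rcases le_total k₀ (energy V p) with hk | hk
    · have h1 := speed_sq hV hp.1
      have h2 : speed V p ^ 2 ≤ 2 / 3 * μ ^ 2 := by
        have := sq_le_sq' (by linarith [neg_abs_le (speed V p), hX hk])
          ((le_abs_self _).trans (hX hk))
        rwa [mul_pow, pow_two κ, κ_mul_self] at this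
      have h3 : (1 - μ ^ 2) * energy V p ≤ 3 * V p.1 := by
        have : 1 - μ ^ 2 ≤ 3 * ratio V p := by linarith
        rwa [ratio, ← mul_div_assoc, le_div_iff₀ hp.1] at this
      have h4 : energy V p ≤ 3 * M / (1 - μ ^ 2) * Real.exp (3 * κ * ν * |p.1|) := by
        rw [div_mul_eq_mul_div, le_div_iff₀ hμ2]
        nlinarith [hM p.1]
      rw [hA, add_mul]
      have := mul_pos hk₀0 (Real.exp_pos (3 * κ * ν * |p.1|))
      linarith
    · rw [hA]
      have : 0 ≤ 3 * M / (1 - μ ^ 2) := by positivity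
      nlinarith
  have hs := abs_snd_le hV p
  have h5 : expansion V p ≤ √A * Real.exp (3 / 2 * κ * ν * |p.1|) := by
    refine (Real.sqrt_le_sqrt hk).trans (le_of_eq ?_)
    rw [Real.sqrt_mul hA0.le, ← Real.exp_half]
    ring_nf
  have := κ_lt_one
  have h6 : 0 ≤ expansion V p := Real.sqrt_nonneg _
  nlinarith [κ_pos]

/-- The exceptional set is invariant under the past flow, which expands area by the factor `e` per
unit of logarithmic time. For the weight `exp (-(3/2) κ μ |φ|)` its measure is finite, while the
weight loses at most the factor `exp (-μ)` per unit of time. As `μ < 1`, the measure is zero. -/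
lemma volume_exceptional (h : IsAdmissible V ν μ R) : volume (exceptional V μ R) = 0 := by
  have hV := h.toIsPotential
  set E := exceptional V μ R with hE
  have hEm : MeasurableSet E := measurableSet_exceptional hV
  -- this rate makes the weight integrable, as `ν < μ`, and its loss slower than `e`, as `μ < 1`
  set α := 3 / 2 * κ * μ with hα
  have hα0 : 0 < α := by have := κ_pos; have := h.μ_pos; positivity
  have hακ : α * κ = μ := by rw [hα]; linear_combination 3 / 2 * μ * κ_mul_self
  set ρ : ℝ × ℝ → ENNReal := fun p => ENNReal.ofReal (Real.exp (-α * |p.1|)) with hρ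
  have hρm : Measurable ρ := by
    have : Continuous fun p : ℝ × ℝ => Real.exp (-α * |p.1|) := by fun_prop
    exact this.measurable.ennreal_ofReal
  -- finiteness of the weighted measure
  have hfin : ∫⁻ p in E, ρ p ≠ ⊤ := by
    obtain ⟨C, hC0, hC⟩ := exists_abs_snd_le_exp h
    set g : ℝ → ℝ := fun x => C * Real.exp (3 / 2 * κ * ν * |x|) with hg
    set B : Set (ℝ × ℝ) := {p | p.2 ∈ Set.Icc (-g p.1) (g p.1)} with hB
    have hgc : Continuous g := by fun_prop
    have hBm : MeasurableSet B :=
      ((isClosed_le (hgc.comp continuous_fst).neg continuous_snd).inter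
        (isClosed_le continuous_snd (hgc.comp continuous_fst))).measurableSet
    have hEB : E ⊆ B := fun p hp => abs_le.mp (hC p hp)
    refine ne_top_of_le_ne_top ?_ (lintegral_mono_set hEB)
    rw [← lintegral_indicator hBm, Measure.volume_eq_prod,
      lintegral_prod _ (hρm.indicator hBm).aemeasurable]
    have hinner : ∀ x : ℝ, ∫⁻ y, B.indicator ρ (x, y)
        = ENNReal.ofReal (2 * C * Real.exp (-(α - 3 / 2 * κ * ν) * |x|)) := by
      intro x
      have : (fun y => B.indicator ρ (x, y)) =
          (Set.Icc (-g x) (g x)).indicator fun _ => ENNReal.ofReal (Real.exp (-α * |x|)) := by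
        ext y
        simp only [Set.indicator, hB, hρ]
        rfl
      rw [this, lintegral_indicator measurableSet_Icc, setLIntegral_const, Real.volume_Icc,
        ← ENNReal.ofReal_mul (Real.exp_pos _).le]
      congr 1
      simp only [hg]
      rw [show -(α - 3 / 2 * κ * ν) * |x| = -α * |x| + 3 / 2 * κ * ν * |x| by ring, Real.exp_add]
      ring
    simp_rw [hinner]
    have hint : Integrable fun x : ℝ => 2 * C * Real.exp (-(α - 3 / 2 * κ * ν) * |x|) := by
      refine Integrable.const_mul ?_ _
      have hb : 0 < α - 3 / 2 * κ * ν := by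
        have := κ_pos; have := h.ν_lt
        rw [hα]; nlinarith
      rw [← integrableOn_univ, ← Set.Iic_union_Ioi (a := (0 : ℝ)), integrableOn_union]
      constructor
      · refine (integrableOn_exp_mul_Iic hb 0).congr_fun (fun x hx => ?_) measurableSet_Iic
        simp only [abs_of_nonpos (Set.mem_Iic.mp hx), neg_mul_neg]
      · refine (integrableOn_exp_mul_Ioi (neg_lt_zero.mpr hb) 0).congr_fun (fun x hx => ?_)
          measurableSet_Ioi
        simp only [abs_of_pos (Set.mem_Ioi.mp hx)]
    exact hint.lintegral_lt_top.ne
  -- the past flow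
  have hpast : ∀ p ∈ E, logFlow V p (-1) ∈ E := fun p hp =>
    ⟨energy_logFlow_pos hV hp.1 _, fun hc => hp.2.1 ((logFlow_mem_basin_iff hV hp.1 _).mp hc),
      fun hc => hp.2.2 ((logFlow_mem_basin_iff hV hp.1 _).mp hc)⟩
  choose! D hD hdet using fun p (hp : p ∈ E) => exists_hasFDerivAt_logFlow hV hp.1
  have hinj : Set.InjOn (fun q => logFlow V q (-1)) E := by
    intro p hp q hq hpq
    have h1 := logFlow_neg_cancel hV hp.1 (-1)
    have h2 := logFlow_neg_cancel hV hq.1 (-1)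
    simp only at hpq
    rw [← h1, ← h2, hpq]
  have hcv := lintegral_image_eq_lintegral_abs_det_fderiv_mul volume hEm
    (fun p hp => (hD p hp).hasFDerivWithinAt) hinj ρ
  have hle : ENNReal.ofReal (Real.exp (1 - μ)) * ∫⁻ p in E, ρ p ≤ ∫⁻ p in E, ρ p := by
    calc ENNReal.ofReal (Real.exp (1 - μ)) * ∫⁻ p in E, ρ p
        = ∫⁻ p in E, ENNReal.ofReal (Real.exp (1 - μ)) * ρ p := (lintegral_const_mul _ hρm).symm
      -- the Jacobian is `e`, and `|φ|` grows by at most `κ`, with `α κ = μ`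
      _ ≤ ∫⁻ p in E, ENNReal.ofReal |(D p).det| * ρ (logFlow V p (-1)) := by
          refine setLIntegral_mono' hEm fun p hp => ?_
          rw [hdet p hp, abs_of_pos (Real.exp_pos _)]
          simp only [hρ]
          rw [← ENNReal.ofReal_mul (Real.exp_pos _).le, ← ENNReal.ofReal_mul (Real.exp_pos _).le,
            ← Real.exp_add, ← Real.exp_add]
          refine ENNReal.ofReal_le_ofReal (Real.exp_le_exp.mpr ?_)
          have hb := (logFlow_bounds hV hp.1 (-1)).1
          have hb2 : |(logFlow V p (-1)).1| ≤ |p.1| + κ := by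
            have := abs_sub_abs_le_abs_sub (logFlow V p (-1)).1 p.1
            simp only [abs_neg, abs_one, mul_one] at hb
            linarith
          nlinarith
      _ = ∫⁻ p in (fun q => logFlow V q (-1)) '' E, ρ p := hcv.symm
      _ ≤ ∫⁻ p in E, ρ p := lintegral_mono_set (Set.image_subset_iff.mpr hpast)
  have hzero : ∫⁻ p in E, ρ p = 0 := by
    by_contra hne
    have h1 : (1 : ENNReal) < ENNReal.ofReal (Real.exp (1 - μ)) := by
      rw [← ENNReal.ofReal_one]
      exact (ENNReal.ofReal_lt_ofReal_iff (Real.exp_pos _)).mpr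
        (Real.one_lt_exp_iff.mpr (by linarith [h.μ_lt]))
    have h2 := ENNReal.mul_lt_mul_left hne hfin h1
    rw [one_mul] at h2
    exact absurd hle (not_le.mpr h2)
  rw [lintegral_eq_zero_iff hρm] at hzero
  have : ∀ᵐ p ∂(volume.restrict E), False := by
    filter_upwards [hzero] with p hp
    simp only [hρ, Pi.zero_apply, ENNReal.ofReal_eq_zero] at hp
    exact absurd (Real.exp_pos _) (not_lt.mpr hp)
  rw [eventually_false_iff_eq_bot, ae_eq_bot, Measure.restrict_eq_zero] at this
  exact this

end FRW

namespace FRW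
/-! ### The asymptotic parameter of a trapped solution -/

variable {V : ℝ → ℝ} {ν μ R σ : ℝ}

/-- The quantity `ln K + σ √(3/2) φ`, which is constant along massless solutions of sign `σ`, with
value `-ln c`; note `√(3/2) = (3/2) κ`. -/
noncomputable def phase (V : ℝ → ℝ) (σ : ℝ) (p : ℝ × ℝ) : ℝ :=
  Real.log (expansion V p) + σ * (3 / 2 * κ) * p.1

/-- The past limit of `phase` along the solution through `p`; it exists for `p` in the basin of sign
`σ`, and carries no meaning for other `p`. -/
noncomputable def asymptote (V : ℝ → ℝ) (σ : ℝ) (p : ℝ × ℝ) : ℝ :=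
  limUnder atBot fun t => phase V σ (logFlow V p t)

lemma continuousAt_phase (hV : IsPotential V) {p : ℝ × ℝ} (hp : 0 < energy V p) :
    ContinuousAt (phase V σ) p := by
  have h1 : ContinuousAt (fun q => Real.log (expansion V q)) p :=
    (continuous_expansion hV).continuousAt.log (expansion_pos hp).ne'
  exact h1.add (by fun_prop)

lemma continuousAt_ratio (hV : IsPotential V) {p : ℝ × ℝ} (hp : 0 < energy V p) :
    ContinuousAt (ratio V) p :=
  (hV.continuous.comp continuous_fst).continuousAt.div (continuous_energy hV).continuousAt hp.ne'

lemma hasDerivAt_phase_logFlow (hV : IsPotential V) (hσ : σ = 1 ∨ σ = -1) {p : ℝ × ℝ}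
    (hp : 0 < energy V p) (t : ℝ) :
    HasDerivAt (fun s => phase V σ (logFlow V p s))
      (3 / 2 * (σ * speed V (logFlow V p t)) * (κ - σ * speed V (logFlow V p t))) t := by
  have hK := expansion_pos (energy_logFlow_pos hV hp t)
  convert! ((hasDerivAt_expansion_logFlow hV hp t).log hK.ne').add
    ((hasDerivAt_fst_logFlow hV hp t).const_mul (σ * (3 / 2 * κ))) using 1
  field_simp
  linear_combination (-speed V (logFlow V p t) ^ 2) * sign_mul_self hσ

section trapped

variable (h : IsAdmissible V ν μ R) (hσ : σ = 1 ∨ σ = -1)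
include h hσ

lemma sign_mul_speed_le (p : ℝ × ℝ) : σ * speed V p ≤ κ := by
  refine (le_abs_self _).trans ?_
  rw [abs_mul, abs_sign hσ, one_mul]
  exact abs_speed_le h.toIsPotential p

lemma sub_sign_mul_speed_le {p : ℝ × ℝ} (hp : p ∈ trapped V σ μ R) :
    κ - σ * speed V p ≤ 2 / κ * ratio V p := by
  have h1 := speed_sq h.toIsPotential hp.1
  have h2 : (σ * speed V p) ^ 2 = speed V p ^ 2 := by
    rw [mul_pow, pow_two σ, sign_mul_self hσ, one_mul]
  have h3 := κ_pos
  have h4 : 0 < σ * speed V p := (mul_pos κ_pos h.μ_pos).trans hp.2.2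
  have h5 := sign_mul_speed_le h hσ p
  rw [div_mul_eq_mul_div, le_div_iff₀ κ_pos]
  nlinarith [κ_mul_self]

/-- The right-hand side is the time derivative of the energy fraction of the potential, which
therefore decays exponentially to the past. -/
lemma ratio_deriv_ge {q : ℝ × ℝ} (hq : q ∈ trapped V σ μ R) :
    3 * (κ * (μ - ν)) * (σ * speed V q) * ratio V q ≤
      deriv V q.1 * speed V q / energy V q + 3 * speed V q ^ 2 * ratio V q := by
  have hR : R ≤ |q.1| := by
    have := neg_abs_le (σ * q.1)
    rw [abs_mul, abs_sign hσ, one_mul] at this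
    linarith [hq.2.1]
  have h1 := h.abs_deriv_le q.1 hR
  have h2 : |σ * (deriv V q.1 / energy V q)| ≤ 3 * κ * ν * ratio V q := by
    rw [abs_mul, abs_sign hσ, one_mul, abs_div, abs_of_pos hq.1, ratio, ← mul_div_assoc]
    have := hq.1
    gcongr
  have h3 := (abs_le.mp h2).1
  have hY := ratio_nonneg h.toIsPotential q
  have hσσ := sign_mul_self hσ
  set ξ := σ * speed V q with hξ
  have e1 : deriv V q.1 * speed V q / energy V q = ξ * (σ * (deriv V q.1 / energy V q)) := by
    rw [hξ]
    linear_combination (-(speed V q * (deriv V q.1 / energy V q))) * hσσ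
  have e2 : speed V q ^ 2 = ξ ^ 2 := by
    rw [hξ]
    linear_combination (-speed V q ^ 2) * hσσ
  have hξ1 : κ * μ < ξ := hq.2.2
  have hξ0 : 0 < ξ := (mul_pos κ_pos h.μ_pos).trans hξ1
  rw [e1, e2]
  have h5 : 0 ≤ ξ * ratio V q * (ξ - κ * μ) :=
    mul_nonneg (mul_nonneg hξ0.le hY) (by linarith)
  nlinarith [mul_le_mul_of_nonneg_left h3 hξ0.le]

/-- The time derivative of the phase is dominated by that of the energy fraction of the potential; so
the phase varies to the past by at most a multiple of its present energy fraction. -/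
lemma phase_deriv_le {q : ℝ × ℝ} (hq : q ∈ trapped V σ μ R) :
    3 / 2 * (σ * speed V q) * (κ - σ * speed V q) ≤ 3 / (2 * (μ - ν)) *
      (deriv V q.1 * speed V q / energy V q + 3 * speed V q ^ 2 * ratio V q) := by
  have h1 := ratio_deriv_ge h hσ hq
  have h2 := sub_sign_mul_speed_le h hσ hq
  have hξ0 : 0 < σ * speed V q := (mul_pos κ_pos h.μ_pos).trans hq.2.2
  have hμν : 0 < μ - ν := by linarith [h.ν_lt]
  calc 3 / 2 * (σ * speed V q) * (κ - σ * speed V q)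
      ≤ 3 / 2 * (σ * speed V q) * (2 / κ * ratio V q) :=
        mul_le_mul_of_nonneg_left h2 (by positivity)
    _ = 3 / (2 * (μ - ν)) * (3 * (κ * (μ - ν)) * (σ * speed V q) * ratio V q) := by
        have := κ_pos
        field_simp
        linear_combination (-3 * (σ * speed V q) * ratio V q) * κ_mul_self
    _ ≤ _ := mul_le_mul_of_nonneg_left h1 (by positivity)

variable {p : ℝ × ℝ} (hp : p ∈ trapped V σ μ R)
include hp

lemma phase_monotoneOn : MonotoneOn (fun t => phase V σ (logFlow V p t)) (Set.Iic 0) :=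
  monotoneOn_of_hasDerivAt_nonneg (convex_Iic 0)
    (fun t _ => hasDerivAt_phase_logFlow h.toIsPotential hσ hp.1 t) fun t ht => by
      have hq := (trapped_past h hσ hp ht).1
      have h1 := sign_mul_speed_le h hσ (logFlow V p t)
      have h2 : 0 < σ * speed V (logFlow V p t) := (mul_pos κ_pos h.μ_pos).trans hq.2.2
      exact mul_nonneg (by positivity) (by linarith)

lemma phase_sub_ratio_antitoneOn : AntitoneOn (fun t => phase V σ (logFlow V p t) -
    3 / (2 * (μ - ν)) * ratio V (logFlow V p t)) (Set.Iic 0) :=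
  antitoneOn_of_hasDerivAt_nonpos (convex_Iic 0)
    (fun t _ => (hasDerivAt_phase_logFlow h.toIsPotential hσ hp.1 t).sub
      ((hasDerivAt_ratio_logFlow h.toIsPotential hp.1 t).const_mul _)) fun t ht => by
      linarith [phase_deriv_le h hσ (trapped_past h hσ hp ht).1]

lemma ratio_logFlow_le {t : ℝ} (ht : t ≤ 0) :
    ratio V (logFlow V p t) ≤ ratio V p * Real.exp (2 * μ * (μ - ν) * t) := by
  have hE : ∀ c x : ℝ, HasDerivAt (fun x => Real.exp (c * x)) (Real.exp (c * x) * c) x :=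
    fun c x => by simpa using ((hasDerivAt_id x).const_mul c).exp
  have hm : ratio V (logFlow V p t) * Real.exp (-(2 * μ * (μ - ν)) * t) ≤
      ratio V (logFlow V p 0) * Real.exp (-(2 * μ * (μ - ν)) * 0) :=
    monotoneOn_of_hasDerivAt_nonneg (convex_Iic 0)
    (fun t _ => (hasDerivAt_ratio_logFlow h.toIsPotential hp.1 t).mul
      (hE (-(2 * μ * (μ - ν))) t)) (fun t ht => by
      have hq := (trapped_past h hσ hp ht).1
      have h1 := ratio_deriv_ge h hσ hq
      have hY := ratio_nonneg h.toIsPotential (logFlow V p t)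
      have hμν : 0 ≤ κ * (μ - ν) := mul_nonneg κ_pos.le (by linarith [h.ν_lt])
      have h2 : 3 * (κ * (μ - ν)) * (κ * μ) * ratio V (logFlow V p t) ≤
          3 * (κ * (μ - ν)) * (σ * speed V (logFlow V p t)) * ratio V (logFlow V p t) := by
        have := hq.2.2
        gcongr
      have h3 : 3 * (κ * (μ - ν)) * (κ * μ) = 2 * μ * (μ - ν) := by
        linear_combination (3 * μ * (μ - ν)) * κ_mul_self
      rw [h3] at h2
      have h4 := Real.exp_pos (-(2 * μ * (μ - ν)) * t)
      nlinarith) (show t ∈ Set.Iic 0 from ht) (Set.self_mem_Iic) ht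
  simp only [mul_zero, Real.exp_zero, mul_one, logFlow_zero h.toIsPotential hp.1] at hm
  rwa [neg_mul, Real.exp_neg, ← div_eq_mul_inv, div_le_iff₀ (Real.exp_pos _)] at hm

lemma tendsto_ratio_of_trapped :
    Tendsto (fun t => ratio V (logFlow V p t)) atBot (𝓝 0) := by
  have ha : 0 < 2 * μ * (μ - ν) := by
    have := h.μ_pos; have := h.ν_lt
    exact mul_pos (by linarith) (by linarith)
  have h1 : Tendsto (fun t => ratio V p * Real.exp (2 * μ * (μ - ν) * t)) atBot (𝓝 0) := by
    have := (Real.tendsto_exp_atBot.comp (tendsto_id.const_mul_atBot ha)).const_mul (ratio V p)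
    simpa using this
  refine tendsto_of_tendsto_of_tendsto_of_le_of_le' tendsto_const_nhds h1
    (Eventually.of_forall fun t => ratio_nonneg h.toIsPotential _) ?_
  filter_upwards [eventually_le_atBot 0] with t ht using ratio_logFlow_le h hσ hp ht

lemma exists_tendsto_phase :
    ∃ L ∈ Set.Icc (phase V σ p - 3 / (2 * (μ - ν)) * ratio V p) (phase V σ p),
      Tendsto (fun t => phase V σ (logFlow V p t)) atBot (𝓝 L) := by
  have hV := h.toIsPotential
  have hC : 0 ≤ 3 / (2 * (μ - ν)) := div_nonneg (by norm_num) (by linarith [h.ν_lt])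
  have hlow : ∀ t ≤ 0, phase V σ p - 3 / (2 * (μ - ν)) * ratio V p
      ≤ phase V σ (logFlow V p t) := by
    intro t ht
    have := phase_sub_ratio_antitoneOn h hσ hp (show t ∈ Set.Iic 0 from ht) Set.self_mem_Iic ht
    simp only [logFlow_zero hV hp.1] at this
    have := mul_nonneg hC (ratio_nonneg hV (logFlow V p t))
    linarith
  have hup : ∀ t ≤ 0, phase V σ (logFlow V p t) ≤ phase V σ p := by
    intro t ht
    have := phase_monotoneOn h hσ hp (show t ∈ Set.Iic 0 from ht) Set.self_mem_Iic ht
    simpa only [logFlow_zero hV hp.1] using this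
  -- extend by a constant to obtain a globally monotone function
  have hmono : Monotone fun t => phase V σ (logFlow V p (min t 0)) := fun s t hst =>
    phase_monotoneOn h hσ hp (Set.mem_Iic.mpr (min_le_right _ _)) (Set.mem_Iic.mpr (min_le_right _ _))
      (min_le_min_right 0 hst)
  have hbdd : BddBelow (Set.range fun t => phase V σ (logFlow V p (min t 0))) :=
    ⟨_, by rintro _ ⟨t, rfl⟩; exact hlow _ (min_le_right _ _)⟩
  have ht := tendsto_atBot_ciInf hmono hbdd
  refine ⟨_, ⟨le_ciInf fun t => hlow _ (min_le_right _ _), ?_⟩, ht.congr' ?_⟩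
  · exact ciInf_le_of_le hbdd 0 (hup _ (min_le_right _ _))
  · filter_upwards [eventually_le_atBot 0] with t ht
    rw [min_eq_left ht]

end trapped

section basin

variable (h : IsAdmissible V ν μ R) (hσ : σ = 1 ∨ σ = -1)
include h hσ

lemma tendsto_phase {p : ℝ × ℝ} (hp : p ∈ basin V σ μ R) :
    Tendsto (fun t => phase V σ (logFlow V p t)) atBot (𝓝 (asymptote V σ p)) := by
  obtain ⟨hp0, T, hT⟩ := hp
  obtain ⟨L, -, hL⟩ := exists_tendsto_phase h hσ hT
  refine tendsto_nhds_limUnder ⟨L, ?_⟩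
  have := hL.comp (tendsto_atBot_add_const_right atBot (-T) tendsto_id)
  refine this.congr fun t => ?_
  simp [logFlow_add h.toIsPotential hp0]

lemma asymptote_mem_Icc {p : ℝ × ℝ} (hp : p ∈ trapped V σ μ R) :
    asymptote V σ p ∈
      Set.Icc (phase V σ p - 3 / (2 * (μ - ν)) * ratio V p) (phase V σ p) := by
  obtain ⟨L, hL, hLt⟩ := exists_tendsto_phase h hσ hp
  rwa [tendsto_nhds_unique (tendsto_phase h hσ (trapped_subset_basin h.toIsPotential hp)) hLt]

lemma asymptote_logFlow {p : ℝ × ℝ} (hp : p ∈ basin V σ μ R) (s : ℝ) :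
    asymptote V σ (logFlow V p s) = asymptote V σ p := by
  have h1 := tendsto_phase h hσ ((logFlow_mem_basin_iff h.toIsPotential hp.1 s).mpr hp)
  have h2 := (tendsto_phase h hσ hp).comp (tendsto_atBot_add_const_left atBot s tendsto_id)
  refine tendsto_nhds_unique h1 (h2.congr fun t => ?_)
  simp [logFlow_add h.toIsPotential hp.1]

lemma tendsto_ratio {p : ℝ × ℝ} (hp : p ∈ basin V σ μ R) :
    Tendsto (fun t => ratio V (logFlow V p t)) atBot (𝓝 0) := by
  obtain ⟨hp0, T, hT⟩ := hp
  have := (tendsto_ratio_of_trapped h hσ hT).comp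
    (tendsto_atBot_add_const_right atBot (-T) tendsto_id)
  refine this.congr fun t => ?_
  simp [logFlow_add h.toIsPotential hp0]

lemma continuousAt_asymptote {p : ℝ × ℝ} (hp : p ∈ basin V σ μ R) :
    ContinuousAt (asymptote V σ) p := by
  have hV := h.toIsPotential
  rw [Metric.continuousAt_iff']
  intro ε hε
  set C := 3 / (2 * (μ - ν))
  have hC : 0 < C := div_pos (by norm_num) (by linarith [h.ν_lt])
  obtain ⟨T, hT⟩ := basin_eventually h hσ hp
  -- far enough in the past the phase determines its limit up to `ε / 3`, uniformly near `p`
  have hsmall : ∀ᶠ t in atBot, C * ratio V (logFlow V p t) < ε / 3 := by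
    have := (tendsto_ratio h hσ hp).const_mul C
    rw [mul_zero] at this
    exact this.eventually_lt_const (by positivity)
  obtain ⟨t, ht, htT⟩ := (hsmall.and (eventually_le_atBot T)).exists
  have hpt := hT t htT
  have hflow := continuousAt_logFlow hV hp.1 t
  have c1 : ContinuousAt (fun q => phase V σ (logFlow V q t)) p :=
    ContinuousAt.comp (f := fun q => logFlow V q t) (continuousAt_phase hV hpt.1) hflow
  have c2 : ContinuousAt (fun q => C * ratio V (logFlow V q t)) p :=
    continuousAt_const.mul
      (ContinuousAt.comp (f := fun q => logFlow V q t) (continuousAt_ratio hV hpt.1) hflow)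
  filter_upwards [hflow.eventually_mem ((isOpen_trapped hV σ μ R).mem_nhds hpt),
    c2.eventually_lt_const ht, Metric.continuousAt_iff'.mp c1 (ε / 3) (by positivity),
    (isOpen_basin hV σ μ R).mem_nhds hp] with q hq1 hq2 hq3 hq4
  have a1 := asymptote_mem_Icc h hσ hpt
  have a2 := asymptote_mem_Icc h hσ hq1
  rw [asymptote_logFlow h hσ hp] at a1
  rw [asymptote_logFlow h hσ hq4] at a2
  rw [Real.dist_eq, abs_lt] at hq3 ⊢
  constructor <;> linarith [a1.1, a1.2, a2.1, a2.2, hq3.1, hq3.2]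

/-- Every value of `φ` further out is attained in the past of a trapped state. -/
lemma exists_past_fst_eq {p : ℝ × ℝ} (hp : p ∈ trapped V σ μ R) {m : ℝ} (hm : m ≤ σ * p.1) :
    ∃ t ≤ 0, σ * (logFlow V p t).1 = m := by
  have hV := h.toIsPotential
  have hκμ : 0 < κ * μ := mul_pos κ_pos h.μ_pos
  set T := (m - σ * p.1) / (κ * μ) with hT
  have hT0 : T ≤ 0 := div_nonpos_of_nonpos_of_nonneg (by linarith) hκμ.le
  have h1 := (trapped_past h hσ hp hT0).2
  rw [hT, mul_div_cancel₀ _ hκμ.ne', ← hT] at h1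
  have hc : ContinuousOn (fun t => σ * (logFlow V p t).1) (Set.Icc T 0) :=
    (continuous_const.mul (continuous_fst.comp (continuous_logFlow hV hp.1))).continuousOn
  obtain ⟨t, ht, hte⟩ := intermediate_value_Icc hT0 hc
    (show m ∈ Set.Icc _ _ from ⟨by linarith, by simpa [logFlow_zero hV hp.1] using hm⟩)
  exact ⟨t, ht.2, hte⟩

omit hσ in
lemma eq_of_expansion_eq {p q : ℝ × ℝ} (hp : p ∈ trapped V σ μ R) (hq : q ∈ trapped V σ μ R)
    (h1 : p.1 = q.1) (h2 : expansion V p = expansion V q) : p = q := by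
  have hV := h.toIsPotential
  have e : p.2 ^ 2 = q.2 ^ 2 := by
    have : energy V p = energy V q := by rw [← expansion_sq hV, h2, expansion_sq hV]
    unfold energy at this
    rw [h1] at this
    linarith
  have hκμ : 0 < κ * μ := mul_pos κ_pos h.μ_pos
  have s1 : 0 < σ * p.2 / expansion V p := by
    rw [mul_div_assoc]; exact hκμ.trans hp.2.2
  have s2 : 0 < σ * q.2 / expansion V q := by
    rw [mul_div_assoc]; exact hκμ.trans hq.2.2
  have s1' : 0 < σ * p.2 := by
    by_contra! hc
    exact absurd s1 (not_lt.mpr (div_nonpos_of_nonpos_of_nonneg hc (Real.sqrt_nonneg _)))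
  have s2' : 0 < σ * q.2 := by
    by_contra! hc
    exact absurd s2 (not_lt.mpr (div_nonpos_of_nonpos_of_nonneg hc (Real.sqrt_nonneg _)))
  refine Prod.ext h1 ?_
  rcases sq_eq_sq_iff_eq_or_eq_neg.mp e with e | e
  · exact e
  · rw [e] at s1'; linarith

/-- Of two trapped states with the same `φ`, the one with the larger expansion has the larger
speed, hence the slower change of the phase with `φ`: their phases separate to the past. -/
lemma phase_lt_asymptote {p q : ℝ × ℝ} (hp : p ∈ trapped V σ μ R) (hq : q ∈ trapped V σ μ R)
    (h1 : p.1 = q.1) (h2 : phase V σ p < phase V σ q) :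
    phase V σ q - phase V σ p ≤ asymptote V σ q - asymptote V σ p := by
  have hV := h.toIsPotential
  have hκμ : 0 < κ * μ := mul_pos κ_pos h.μ_pos
  -- the solution through `q` stays trapped on some `(-∞, b)`, `b > 0`
  obtain ⟨b, hb, hbq⟩ : ∃ b > 0, ∀ t ∈ Set.Iio b, logFlow V q t ∈ trapped V σ μ R := by
    have : ∀ᶠ t in 𝓝 (0 : ℝ), logFlow V q t ∈ trapped V σ μ R :=
      (continuous_logFlow hV hq.1).continuousAt.eventually_mem
        (by rw [logFlow_zero hV hq.1]; exact (isOpen_trapped hV σ μ R).mem_nhds hq)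
    obtain ⟨b, hb, hbq⟩ := Metric.eventually_nhds_iff.mp this
    refine ⟨b, hb, fun t ht => ?_⟩
    rcases le_or_gt t 0 with h0 | h0
    · exact (trapped_past h hσ hq h0).1
    · exact hbq (by rw [Real.dist_eq, sub_zero, abs_of_pos h0]; exact ht)
  have hdφ : ∀ {r : ℝ × ℝ}, 0 < energy V r → ∀ t, HasDerivAt (fun s => σ * (logFlow V r s).1)
      (σ * speed V (logFlow V r t)) t := fun hr t => (hasDerivAt_fst_logFlow hV hr t).const_mul σ
  obtain ⟨τ, hτ, hτd⟩ := exists_hasDerivAt_inverse isOpen_Iio (convex_Iio b)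
    (fun t _ => hdφ hq.1 t)
    (continuous_const.mul (continuous_speed_logFlow hV hq.1)).continuousOn
    (fun t ht => hκμ.trans (hbq t ht).2.2)
  -- `θ t` is the time at which the second solution has the same `φ` as the first one at time `t`
  set θ : ℝ → ℝ := fun t => τ (σ * (logFlow V p t).1) with hθ
  have hθ1 : ∀ t ≤ 0, θ t ≤ 0 ∧ (logFlow V q (θ t)).1 = (logFlow V p t).1 := by
    intro t ht
    have hle : σ * (logFlow V p t).1 ≤ σ * q.1 := by
      have := (trapped_past h hσ hp ht).2
      have := mul_nonpos_of_nonneg_of_nonpos hκμ.le ht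
      rw [← h1]; linarith
    obtain ⟨r, hr0, hr⟩ := exists_past_fst_eq h hσ hq hle
    have : θ t = r := by
      rw [hθ]; simp only
      rw [← hr, hτ r (lt_of_le_of_lt hr0 hb)]
    rw [this]
    refine ⟨hr0, ?_⟩
    have hσ0 : σ ≠ 0 := by rcases hσ with rfl | rfl <;> norm_num
    exact mul_left_cancel₀ hσ0 hr
  set d : ℝ → ℝ := fun t => phase V σ (logFlow V q (θ t)) - phase V σ (logFlow V p t) with hd
  have hdd : ∀ t ≤ 0, HasDerivAt d (3 / 2 * (σ * speed V (logFlow V p t)) *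
      (σ * speed V (logFlow V p t) - σ * speed V (logFlow V q (θ t)))) t := by
    intro t ht
    obtain ⟨hθt, hθe⟩ := hθ1 t ht
    have e1 : HasDerivAt θ ((σ * speed V (logFlow V q (θ t)))⁻¹ *
        (σ * speed V (logFlow V p t))) t := by
      have := hτd (θ t) (lt_of_le_of_lt hθt hb)
      rw [hθe] at this
      exact this.comp t (hdφ hp.1 t)
    have e2 := (hasDerivAt_phase_logFlow hV hσ hq.1 (θ t)).comp t e1
    convert! e2.sub (hasDerivAt_phase_logFlow hV hσ hp.1 t) using 1
    have hne : σ * speed V (logFlow V q (θ t)) ≠ 0 :=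
      (hκμ.trans (trapped_past h hσ hq hθt).1.2.2).ne'
    generalize σ * speed V (logFlow V q (θ t)) = a at *
    generalize σ * speed V (logFlow V p t) = b at *
    field_simp
    ring
  have hd0 : d 0 = phase V σ q - phase V σ p := by
    have : θ 0 = 0 := by
      simp only [hθ, logFlow_zero hV hp.1, h1]
      have := hτ 0 hb
      rwa [logFlow_zero hV hq.1] at this
    simp only [hd, this, logFlow_zero hV hp.1, logFlow_zero hV hq.1]
  have hcmp : ∀ t ≤ 0, 0 < d t → ratio V (logFlow V q (θ t)) ≤ ratio V (logFlow V p t) ∧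
      speed V (logFlow V p t) ^ 2 ≤ speed V (logFlow V q (θ t)) ^ 2 := by
    intro t ht hdt
    obtain ⟨hθt, hθe⟩ := hθ1 t ht
    have k1 := energy_logFlow_pos hV hp.1 t
    have k2 := energy_logFlow_pos hV hq.1 (θ t)
    have hK : expansion V (logFlow V p t) < expansion V (logFlow V q (θ t)) := by
      simp only [hd, phase, hθe] at hdt
      exact (Real.log_lt_log_iff (expansion_pos k1) (expansion_pos k2)).mp (by linarith)
    have hk : energy V (logFlow V p t) ≤ energy V (logFlow V q (θ t)) := by
      rw [← expansion_sq hV, ← expansion_sq hV (logFlow V q (θ t))]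
      have := (expansion_pos k1).le
      gcongr
    have hr : ratio V (logFlow V q (θ t)) ≤ ratio V (logFlow V p t) := by
      rw [ratio, ratio, hθe]
      exact div_le_div_of_nonneg_left (hV.nonneg _) k1 hk
    exact ⟨hr, by linarith [speed_sq hV k1, speed_sq hV k2]⟩
  have hdneg : ∀ t ≤ 0, 0 < d t → 3 / 2 * (σ * speed V (logFlow V p t)) *
      (σ * speed V (logFlow V p t) - σ * speed V (logFlow V q (θ t))) ≤ 0 := by
    intro t ht hdt
    have s1 := hκμ.trans (trapped_past h hσ hp ht).1.2.2
    have s2 := hκμ.trans (trapped_past h hσ hq (hθ1 t ht).1).1.2.2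
    have s3 : (σ * speed V (logFlow V p t)) ^ 2 ≤ (σ * speed V (logFlow V q (θ t))) ^ 2 := by
      rw [mul_pow, mul_pow]
      exact mul_le_mul_of_nonneg_left (hcmp t ht hdt).2 (sq_nonneg σ)
    have s4 := le_of_sq_le_sq s3 s2.le
    exact mul_nonpos_of_nonneg_of_nonpos (by positivity) (by linarith)
  have hgrow : ∀ s ≥ 0, (∀ r, 0 ≤ r → r < s → 0 < d (-r)) → d 0 ≤ d (-s) := by
    intro s hs hr
    have := antitoneOn_of_hasDerivWithinAt_nonpos (convex_Icc (-s) 0)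
      (fun t ht => (hdd t ht.2).continuousAt.continuousWithinAt)
      (fun t ht => (hdd t (interior_subset ht).2).hasDerivWithinAt)
      (fun t ht => by
        rw [interior_Icc] at ht
        refine hdneg t ht.2.le ?_
        have := hr (-t) (by linarith [ht.2]) (by linarith [ht.1])
        rwa [neg_neg] at this)
    exact this ⟨le_rfl, by linarith⟩ ⟨by linarith, le_rfl⟩ (by linarith)
  have hpos : ∀ s ≥ 0, 0 < d (-s) := by
    have hcont : Continuous fun s => d (-(max s 0)) := by
      have : ContinuousOn d (Set.Iic 0) := fun t ht =>
        (hdd t ht).continuousAt.continuousWithinAt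
      exact this.comp_continuous (by fun_prop) (fun s => by simp)
    have := mem_of_continuous_induction hcont isOpen_Ioi (O := Set.Ioi 0) fun s hs hr => by
      simp only [Set.mem_Ioi, max_eq_left hs] at hr ⊢
      have := hgrow s hs fun r hr0 hrs => by
        have := hr r hr0 hrs
        rwa [max_eq_left hr0] at this
      rw [hd0] at this
      linarith
    intro s hs
    have := this s hs
    simpa only [Set.mem_Ioi, max_eq_left hs] using this
  have hge : ∀ t ≤ 0, phase V σ (logFlow V p t) + (phase V σ q - phase V σ p)
      - 3 / (2 * (μ - ν)) * ratio V (logFlow V p t) ≤ asymptote V σ q := by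
    intro t ht
    have a1 := hgrow (-t) (by linarith) fun r hr _ => hpos r hr
    have a2 := hpos (-t) (by linarith)
    rw [neg_neg] at a1 a2
    obtain ⟨hθt, hθe⟩ := hθ1 t ht
    have a3 := (asymptote_mem_Icc h hσ (trapped_past h hσ hq hθt).1).1
    rw [asymptote_logFlow h hσ (trapped_subset_basin hV hq)] at a3
    have hC : 0 ≤ 3 / (2 * (μ - ν)) := div_nonneg (by norm_num) (by linarith [h.ν_lt])
    have a4 := mul_le_mul_of_nonneg_left (hcmp t ht a2).1 hC
    rw [hd0] at a1
    simp only [hd] at a1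
    linarith
  have hpb := trapped_subset_basin hV hp
  have hlim : Tendsto (fun t => phase V σ (logFlow V p t) + (phase V σ q - phase V σ p)
      - 3 / (2 * (μ - ν)) * ratio V (logFlow V p t)) atBot
      (𝓝 (asymptote V σ p + (phase V σ q - phase V σ p) - 3 / (2 * (μ - ν)) * 0)) :=
    ((tendsto_phase h hσ hpb).add_const _).sub ((tendsto_ratio h hσ hpb).const_mul _)
  have := le_of_tendsto hlim
    (by filter_upwards [eventually_le_atBot 0] with t ht using hge t ht)
  linarith

/-- A solution in the basin is determined by its asymptotic parameter. -/
lemma exists_logFlow_eq_of_asymptote_eq {p q : ℝ × ℝ} (hp : p ∈ basin V σ μ R)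
    (hq : q ∈ basin V σ μ R) (hpq : asymptote V σ p = asymptote V σ q) :
    ∃ t, logFlow V p t = q := by
  have hV := h.toIsPotential
  have ⟨hp0, T, hT⟩ := hp
  have ⟨hq0, T', hT'⟩ := hq
  set m := min (σ * (logFlow V p T).1) (σ * (logFlow V q T').1)
  obtain ⟨t, ht0, ht⟩ := exists_past_fst_eq h hσ hT (m := m) (min_le_left _ _)
  obtain ⟨t', ht0', ht'⟩ := exists_past_fst_eq h hσ hT' (m := m) (min_le_right _ _)
  have hpt := (trapped_past h hσ hT ht0).1
  have hqt := (trapped_past h hσ hT' ht0').1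
  rw [logFlow_add hV hp0] at ht hpt
  rw [logFlow_add hV hq0] at ht' hqt
  have hσ0 : σ ≠ 0 := by rcases hσ with rfl | rfl <;> norm_num
  have hφ : (logFlow V p (T + t)).1 = (logFlow V q (T' + t')).1 :=
    mul_left_cancel₀ hσ0 (ht.trans ht'.symm)
  have hL : asymptote V σ (logFlow V p (T + t)) = asymptote V σ (logFlow V q (T' + t')) := by
    rw [asymptote_logFlow h hσ hp, asymptote_logFlow h hσ hq, hpq]
  have hphase : phase V σ (logFlow V p (T + t)) = phase V σ (logFlow V q (T' + t')) := by
    rcases lt_trichotomy (phase V σ (logFlow V p (T + t)))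
      (phase V σ (logFlow V q (T' + t'))) with hlt | heq | hlt
    · have := phase_lt_asymptote h hσ hpt hqt hφ hlt
      linarith
    · exact heq
    · have := phase_lt_asymptote h hσ hqt hpt hφ.symm hlt
      linarith
  have hK : expansion V (logFlow V p (T + t)) = expansion V (logFlow V q (T' + t')) := by
    simp only [phase, hφ, add_left_inj] at hphase
    exact Real.log_injOn_pos (expansion_pos hpt.1) (expansion_pos hqt.1) hphase
  have heq := eq_of_expansion_eq h hpt hqt hφ hK
  refine ⟨T + t - (T' + t'), ?_⟩
  rw [sub_eq_add_neg, ← logFlow_add hV hp0, heq, logFlow_neg_cancel hV hq0]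

end basin

/-- The initial data with given `φ` and expansion `K`, and with `ψ` of sign `σ`. -/
noncomputable def dataOf (V : ℝ → ℝ) (σ φ K : ℝ) : ℝ × ℝ :=
  (φ, σ * √(2 / 3 * (K ^ 2 - 3 * V φ)))

section dataOf

variable (hσ : σ = 1 ∨ σ = -1)
include hσ

lemma energy_dataOf {φ K : ℝ} (hK : 3 * V φ ≤ K ^ 2) : energy V (dataOf V σ φ K) = K ^ 2 := by
  simp only [energy, dataOf, mul_pow]
  rw [Real.sq_sqrt (by linarith), pow_two σ, sign_mul_self hσ]
  ring

lemma expansion_dataOf {φ K : ℝ} (hK0 : 0 ≤ K) (hK : 3 * V φ ≤ K ^ 2) :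
    expansion V (dataOf V σ φ K) = K := by
  rw [expansion, energy_dataOf hσ hK, Real.sqrt_sq hK0]

lemma dataOf_mem_trapped {φ K : ℝ} (hφ : σ * φ < -R) (hK0 : 0 < K)
    (hK : 3 * V φ < (1 - μ ^ 2) * K ^ 2) : dataOf V σ φ K ∈ trapped V σ μ R := by
  have hK' : 3 * V φ ≤ K ^ 2 := by nlinarith [sq_nonneg (μ * K)]
  refine ⟨by rw [energy_dataOf hσ hK']; positivity, hφ, ?_⟩
  rw [speed, expansion_dataOf hσ hK0.le hK']
  simp only [dataOf]
  rw [← mul_div_assoc, ← mul_assoc, sign_mul_self hσ, one_mul, lt_div_iff₀ hK0]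
  refine Real.lt_sqrt_of_sq_lt ?_
  rw [show (κ * μ * K) ^ 2 = κ * κ * (μ ^ 2 * K ^ 2) by ring, κ_mul_self]
  linarith

lemma dataOf_self (h : IsAdmissible V ν μ R) {p : ℝ × ℝ} (hp : p ∈ trapped V σ μ R) :
    3 * V p.1 < (1 - μ ^ 2) * expansion V p ^ 2 ∧ dataOf V σ p.1 (expansion V p) = p := by
  have hV := h.toIsPotential
  have hκμ : 0 < κ * μ := mul_pos κ_pos h.μ_pos
  have hlt : 3 * V p.1 < (1 - μ ^ 2) * expansion V p ^ 2 := by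
    have h1 := speed_sq hV hp.1
    have h2 : (κ * μ) ^ 2 < (σ * speed V p) ^ 2 := by
      have := hp.2.2
      gcongr
    rw [mul_pow, mul_pow, pow_two κ, κ_mul_self, pow_two σ, sign_mul_self hσ, one_mul] at h2
    have h3 : 3 * ratio V p < 1 - μ ^ 2 := by linarith
    rwa [ratio, ← mul_div_assoc, div_lt_iff₀ hp.1, ← expansion_sq hV] at h3
  refine ⟨hlt, ?_⟩
  have hK := expansion_pos hp.1
  have ht := dataOf_mem_trapped hσ (φ := p.1) hp.2.1 hK hlt
  refine eq_of_expansion_eq h ht hp rfl ?_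
  refine expansion_dataOf hσ hK.le ?_
  nlinarith [sq_nonneg (μ * expansion V p)]

omit hσ in
lemma continuous_dataOf (φ : ℝ) : Continuous fun K => dataOf V σ φ K := by
  unfold dataOf
  fun_prop

/-- The asymptotic parameter is an open map: at fixed `φ` it strictly increases with the expansion, by
`phase_lt_asymptote`, and it is continuous. -/
lemma image_asymptote_mem_nhds (h : IsAdmissible V ν μ R) {p : ℝ × ℝ}
    (hp : p ∈ trapped V σ μ R) {O : Set (ℝ × ℝ)} (hO : O ∈ 𝓝 p) :
    asymptote V σ '' (O ∩ trapped V σ μ R) ∈ 𝓝 (asymptote V σ p) := by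
  have hV := h.toIsPotential
  obtain ⟨hlt, hself⟩ := dataOf_self hσ h hp
  have hK := expansion_pos hp.1
  set c : ℝ → ℝ × ℝ := fun w => dataOf V σ p.1 (expansion V p * Real.exp w) with hc
  have hcc : Continuous c := (continuous_dataOf (σ := σ) p.1).comp (by fun_prop)
  have hc0 : c 0 = p := by simp [hc, hself]
  have hnear : ∀ᶠ w in 𝓝 (0 : ℝ), c w ∈ O ∩ trapped V σ μ R :=
    hcc.continuousAt.eventually_mem
      (by rw [hc0]; exact inter_mem hO ((isOpen_trapped hV σ μ R).mem_nhds hp))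
  obtain ⟨ε, hε, hεc⟩ := Metric.eventually_nhds_iff.mp hnear
  have hin : ∀ w ∈ Set.Icc (-(ε / 2)) (ε / 2), c w ∈ O ∩ trapped V σ μ R := by
    intro w hw
    refine hεc ?_
    rw [Real.dist_eq, sub_zero, abs_lt]
    constructor <;> linarith [hw.1, hw.2]
  have hphase : ∀ w ∈ Set.Icc (-(ε / 2)) (ε / 2), phase V σ (c w) = phase V σ p + w := by
    intro w hw
    have hw1 : 3 * V p.1 ≤ (expansion V p * Real.exp w) ^ 2 := by
      by_contra! hcon
      -- otherwise the square root vanishes and the state is not trapped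
      have h2 := (hin w hw).2.2.2
      have : √(2 / 3 * ((expansion V p * Real.exp w) ^ 2 - 3 * V p.1)) = 0 :=
        Real.sqrt_eq_zero_of_nonpos (by linarith)
      simp only [hc, speed, dataOf, this, mul_zero, zero_div] at h2
      exact absurd h2 (not_lt.mpr (mul_pos κ_pos h.μ_pos).le)
    have := expansion_dataOf hσ (V := V) (φ := p.1) (by positivity) hw1
    simp only [hc, phase, this]
    rw [Real.log_mul hK.ne' (Real.exp_pos _).ne', Real.log_exp]
    simp only [dataOf]
    ring
  have h0 : (0 : ℝ) ∈ Set.Icc (-(ε / 2)) (ε / 2) := ⟨by linarith, by linarith⟩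
  have hle : -(ε / 2) ≤ ε / 2 := by linarith
  have hcont : ContinuousOn (fun w => asymptote V σ (c w)) (Set.Icc (-(ε / 2)) (ε / 2)) :=
    fun w hw => (ContinuousAt.comp (f := c) (continuousAt_asymptote h hσ
      (trapped_subset_basin hV (hin w hw).2)) hcc.continuousAt).continuousWithinAt
  have hiv := intermediate_value_Icc hle hcont
  have hl : asymptote V σ (c (-(ε / 2))) < asymptote V σ p := by
    have hm : -(ε / 2) ∈ Set.Icc (-(ε / 2)) (ε / 2) := ⟨le_rfl, hle⟩
    have hph := hphase _ hm
    have := phase_lt_asymptote h hσ (hin _ hm).2 hp rfl (by linarith)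
    linarith
  have hr : asymptote V σ p < asymptote V σ (c (ε / 2)) := by
    have hm : ε / 2 ∈ Set.Icc (-(ε / 2)) (ε / 2) := ⟨hle, le_rfl⟩
    have hph := hphase _ hm
    have := phase_lt_asymptote h hσ hp (hin _ hm).2 rfl (by linarith)
    linarith
  refine mem_of_superset (Icc_mem_nhds hl hr) (hiv.trans ?_)
  rintro _ ⟨w, hw, rfl⟩
  exact ⟨c w, hin w hw, rfl⟩

/-- Every real number is the asymptotic parameter of a trapped solution: far out, the parameter
differs by less than `1` from the phase, which can be prescribed. -/
lemma exists_asymptote_eq (h : IsAdmissible V ν μ R) (L : ℝ) :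
    ∃ p ∈ trapped V σ μ R, asymptote V σ p = L := by
  have hV := h.toIsPotential
  obtain ⟨M, hM0, hM⟩ := exists_potential_le_exp h
  set C := 3 / (2 * (μ - ν)) with hC
  have hC0 : 0 < C := div_pos (by norm_num) (by linarith [h.ν_lt])
  have hμ2 : 0 < 1 - μ ^ 2 := by nlinarith [h.μ_lt, h.μ_pos]
  have hκ := κ_pos
  have hrate : 3 * κ * ν - 3 * κ < 0 := by nlinarith [h.ν_lt, h.μ_lt]
  have hlim : Tendsto (fun s => M * Real.exp ((3 * κ * ν - 3 * κ) * s - 2 * L)) atTop (𝓝 0) := by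
    have h1 : Tendsto (fun s : ℝ => (3 * κ * ν - 3 * κ) * s - 2 * L) atTop atBot :=
      tendsto_atBot_add_const_right _ _ (tendsto_id.const_mul_atTop_of_neg hrate)
    simpa using (Real.tendsto_exp_atBot.comp h1).const_mul M
  obtain ⟨s, hs1, hs2, hsR⟩ :=
    ((hlim.eventually_lt_const (show 0 < (1 - μ ^ 2) / 3 by positivity)).and
      ((hlim.eventually_lt_const (show 0 < 1 / C by positivity)).and
        (eventually_gt_atTop R))).exists
  set φ := -(σ * s) with hφ
  have hσφ : σ * φ = -s := by
    rw [hφ]; linear_combination (-s) * sign_mul_self hσ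
  have hs0 : 0 < s := h.R_nonneg.trans_lt hsR
  have hφs : |φ| = s := by rw [hφ, abs_neg, abs_mul, abs_sign hσ, one_mul, abs_of_pos hs0]
  set k : ℝ → ℝ := fun w => Real.exp (w + 3 / 2 * κ * s) with hk
  -- along this family the potential energy fraction is small
  have hY : ∀ w, L ≤ w → V φ ≤ M * Real.exp ((3 * κ * ν - 3 * κ) * s - 2 * L) * k w ^ 2 := by
    intro w hw
    refine (hM φ).trans ?_
    rw [hφs, hk]; simp only
    rw [← Real.exp_nat_mul, mul_assoc M, ← Real.exp_add]
    refine mul_le_mul_of_nonneg_left (Real.exp_le_exp.mpr ?_) hM0.le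
    push_cast
    linarith
  have hk0 : ∀ w, 0 < k w := fun w => Real.exp_pos _
  have hmem : ∀ w, L ≤ w → dataOf V σ φ (k w) ∈ trapped V σ μ R := by
    intro w hw
    refine dataOf_mem_trapped hσ (by rw [hσφ]; linarith) (hk0 w) ?_
    have := hY w hw
    have h2 : 0 < k w ^ 2 := pow_pos (hk0 w) 2
    nlinarith
  have hexp : ∀ w, L ≤ w → expansion V (dataOf V σ φ (k w)) = k w := by
    intro w hw
    refine expansion_dataOf hσ (hk0 w).le ?_
    have := hY w hw
    have h2 : 0 < k w ^ 2 := pow_pos (hk0 w) 2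
    nlinarith [h.μ_pos]
  have hphase : ∀ w, L ≤ w → phase V σ (dataOf V σ φ (k w)) = w := by
    intro w hw
    rw [phase, hexp w hw, hk]
    simp only [Real.log_exp, dataOf]
    linear_combination (3 / 2 * κ) * hσφ
  have hratio : ∀ w, L ≤ w → C * ratio V (dataOf V σ φ (k w)) ≤ 1 := by
    intro w hw
    have h2 : 0 < k w ^ 2 := pow_pos (hk0 w) 2
    rw [ratio, ← expansion_sq hV, hexp w hw]
    have : V φ / k w ^ 2 ≤ 1 / C := by
      rw [div_le_iff₀ h2]
      exact (hY w hw).trans (mul_le_mul_of_nonneg_right hs2.le h2.le)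
    calc C * (V φ / k w ^ 2) ≤ C * (1 / C) := mul_le_mul_of_nonneg_left this hC0.le
      _ = 1 := by field_simp
  have hcont : ContinuousOn (fun w => asymptote V σ (dataOf V σ φ (k w))) (Set.Icc L (L + 1)) := by
    intro w hw
    have hkc : Continuous fun w => dataOf V σ φ (k w) :=
      (continuous_dataOf (σ := σ) φ).comp (by fun_prop)
    exact (ContinuousAt.comp (f := fun w => dataOf V σ φ (k w)) (continuousAt_asymptote h hσ
      (trapped_subset_basin hV (hmem w hw.1))) hkc.continuousAt).continuousWithinAt
  have hL1 : L ≤ L + 1 := by linarith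
  obtain ⟨w, hw, hwe⟩ := intermediate_value_Icc hL1 hcont (show L ∈ Set.Icc _ _ from ⟨by
    have := (asymptote_mem_Icc h hσ (hmem L le_rfl)).2
    rwa [hphase L le_rfl] at this, by
    have := (asymptote_mem_Icc h hσ (hmem (L + 1) hL1)).1
    rw [hphase _ hL1] at this
    have := hratio _ hL1
    linarith⟩)
  exact ⟨_, hmem w hw.1, hwe⟩

end dataOf

end FRW

namespace FRW
/-! ### Cosmic time -/

variable {V : ℝ → ℝ} {ν μ R σ : ℝ}

lemma exists_antiderivative {f : ℝ → ℝ} (hf : Continuous f) (a : ℝ) :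
    ∃ F : ℝ → ℝ, F a = 0 ∧ ∀ x, HasDerivAt F (f x) x :=
  ⟨fun x => ∫ y in a..x, f y, by simp, fun x => (hf.integral_hasStrictDerivAt a x).hasDerivAt⟩

/-- The initial data `(φ, ψ)` of a physical state. -/
def PhaseSpace.data (p : PhaseSpace V) : ℝ × ℝ := p.1.2

lemma PhaseSpace.energy_data (p : PhaseSpace V) : energy V p.data = p.1.1 ^ 2 := p.2.2.symm

lemma PhaseSpace.energy_pos (p : PhaseSpace V) : 0 < energy V p.data := by
  rw [p.energy_data]; exact pow_pos p.2.1 2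

lemma PhaseSpace.expansion_data (p : PhaseSpace V) : expansion V p.data = p.1.1 := by
  rw [expansion, p.energy_data, Real.sqrt_sq p.2.1.le]

/-- The physical state with given initial data. -/
noncomputable def stateOf (hV : IsPotential V) {p : ℝ × ℝ} (hp : 0 < energy V p) : PhaseSpace V :=
  ⟨(expansion V p, p), expansion_pos hp, expansion_sq hV p⟩

/-- A clock along the solution through `p`: cosmic time as a function of logarithmic time. -/
def IsClock (V : ℝ → ℝ) (p : ℝ × ℝ) (T : ℝ → ℝ) : Prop :=
  ∀ τ, HasDerivAt T (expansion V (logFlow V p τ))⁻¹ τ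

section clock

variable (hV : IsPotential V) {p : ℝ × ℝ} (hp : 0 < energy V p)
include hV hp

lemma continuous_inv_expansion_logFlow :
    Continuous fun τ => (expansion V (logFlow V p τ))⁻¹ :=
  ((continuous_expansion hV).comp (continuous_logFlow hV hp)).inv₀
    fun τ => (expansion_pos (energy_logFlow_pos hV hp τ)).ne'

lemma exists_isClock : ∃ T, IsClock V p T :=
  let ⟨T, _, hT⟩ := exists_antiderivative (continuous_inv_expansion_logFlow hV hp) 0
  ⟨T, hT⟩

lemma IsClock.strictMono {T : ℝ → ℝ} (hT : IsClock V p T) : StrictMono T :=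
  strictMono_of_hasDerivAt_pos hT fun τ =>
    inv_pos.mpr (expansion_pos (energy_logFlow_pos hV hp τ))

/-- Reading the flow on a clock gives a solution in cosmic time. -/
lemma IsClock.exists_solution {T : ℝ → ℝ} (hT : IsClock V p T) :
    ∃ θ : ℝ → ℝ, (∀ τ, θ (T τ) = τ) ∧ IsSolutionOn V (Set.range T)
      (fun t => expansion V (logFlow V p (θ t))) (fun t => (logFlow V p (θ t)).1)
      (fun t => (logFlow V p (θ t)).2) := by
  obtain ⟨θ, hθ, hθd⟩ := exists_hasDerivAt_inverse isOpen_univ convex_univ (fun τ _ => hT τ)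
    (continuous_inv_expansion_logFlow hV hp).continuousOn
    (fun τ _ => inv_pos.mpr (expansion_pos (energy_logFlow_pos hV hp τ)))
  refine ⟨θ, fun τ => hθ τ trivial, ?_⟩
  rintro _ ⟨τ, rfl⟩
  have hk := energy_logFlow_pos hV hp τ
  have hK := expansion_pos hk
  have hd := hθd τ trivial
  have e := hθ τ trivial
  rw [inv_inv] at hd
  have hz : HasDerivAt (fun t => logFlow V p (θ t))
      (expansion V (logFlow V p τ) • logField V (logFlow V p τ)) (T τ) := by
    have h0 := hasDerivAt_logFlow hV hp (θ (T τ))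
    rw [e] at h0
    exact HasDerivAt.scomp (T τ) (by rw [e]; exact h0) hd
  have hKd : HasDerivAt (fun t => expansion V (logFlow V p (θ t)))
      (-(3 / 2) * speed V (logFlow V p τ) ^ 2 * expansion V (logFlow V p τ)
        * expansion V (logFlow V p τ)) (T τ) := by
    have h0 : HasDerivAt (fun s => expansion V (logFlow V p s))
        (-(3 / 2) * speed V (logFlow V p τ) ^ 2 * expansion V (logFlow V p τ)) (θ (T τ)) := by
      rw [e]; exact hasDerivAt_expansion_logFlow hV hp τ
    exact h0.comp (T τ) hd
  simp only [e]
  refine ⟨?_, ?_, ?_, hK, ?_⟩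
  · convert! hasDerivAt_fst hz using 1
    simp only [logField, Prod.smul_mk, smul_eq_mul]
    field_simp
  · convert! hasDerivAt_snd hz using 1
    simp only [logField, Prod.smul_mk, smul_eq_mul]
    field_simp
  · convert! hKd using 1
    simp only [speed]
    field_simp
  · exact expansion_sq hV _

end clock

lemma IsSolutionOn.mono {I J : Set ℝ} {K φ ψ : ℝ → ℝ} (h : IsSolutionOn V I K φ ψ) (hJ : J ⊆ I) :
    IsSolutionOn V J K φ ψ := fun t ht => h t (hJ ht)

/-- The state of a solution at time `t`. -/
def IsSolutionOn.stateAt {I : Set ℝ} {K φ ψ : ℝ → ℝ} (h : IsSolutionOn V I K φ ψ) {t : ℝ}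
    (ht : t ∈ I) : PhaseSpace V :=
  ⟨(K t, φ t, ψ t), (h t ht).2.2.2⟩

/-- A solution in cosmic time follows the flow in logarithmic time. -/
lemma exists_logFlow_eq_of_sameOrbit (hV : IsPotential V) {p q : PhaseSpace V}
    (h : SameOrbit V p q) : ∃ τ, logFlow V p.data τ = q.data := by
  obtain ⟨a, b, K, φ, ψ, hsol, ⟨t₁, ht₁, hp⟩, ⟨t₂, ht₂, hq⟩⟩ := h
  -- a compact subinterval with both times in its interior, on which `K` is extended continuously
  obtain ⟨a', ha', ha₁, ha₂⟩ : ∃ a', a < a' ∧ a' < t₁ ∧ a' < t₂ := by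
    obtain ⟨a', h1, h2⟩ := exists_between (lt_min ht₁.1 ht₂.1)
    exact ⟨a', h1, lt_min_iff.mp h2⟩
  obtain ⟨b', hb', hb₁, hb₂⟩ : ∃ b', b' < b ∧ t₁ < b' ∧ t₂ < b' := by
    obtain ⟨b', h1, h2⟩ := exists_between (max_lt ht₁.2 ht₂.2)
    exact ⟨b', h2, max_lt_iff.mp h1⟩
  have hab : a' ≤ b' := (ha₁.trans hb₁).le
  have hsub : Set.Icc a' b' ⊆ Set.Ioo a b := fun t ht => ⟨ha'.trans_le ht.1, ht.2.trans_lt hb'⟩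
  have hKc : ContinuousOn K (Set.Icc a' b') := fun t ht =>
    (hsol t (hsub ht)).2.2.1.continuousAt.continuousWithinAt
  set Ke : ℝ → ℝ := Set.IccExtend hab ((Set.Icc a' b').domRestrict K) with hKe
  have hKec : Continuous Ke := (continuousOn_iff_continuous_domRestrict.mp hKc).Icc_extend'
  have hKe_eq : ∀ t ∈ Set.Icc a' b', Ke t = K t := fun t ht => Set.IccExtend_of_mem hab _ ht
  have hKpos : ∀ t, 0 < Ke t := fun t => by
    simp only [hKe, Set.IccExtend, Function.comp_apply]
    exact (hsol _ (hsub (Set.projIcc a' b' hab t).2)).2.2.2.1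
  obtain ⟨θ, hθ0, hθ⟩ := exists_antiderivative hKec t₁
  have hθm : StrictMono θ := strictMono_of_hasDerivAt_pos hθ hKpos
  have hθc : Continuous θ := continuous_iff_continuousAt.mpr fun t => (hθ t).continuousAt
  obtain ⟨η, hη, hηd⟩ := exists_hasDerivAt_inverse isOpen_univ convex_univ (fun t _ => hθ t)
    hKec.continuousOn (fun t _ => hKpos t)
  have hrange : ∀ r ∈ Set.Ioo (θ a') (θ b'), ∃ t ∈ Set.Ioo a' b', θ t = r := by
    intro r hr
    obtain ⟨t, ht, hte⟩ := intermediate_value_Icc hab hθc.continuousOn ⟨hr.1.le, hr.2.le⟩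
    refine ⟨t, ⟨?_, ?_⟩, hte⟩
    · exact hθm.lt_iff_lt.mp (hte ▸ hr.1)
    · exact hθm.lt_iff_lt.mp (hte ▸ hr.2)
  set w : ℝ → ℝ × ℝ := fun r => (φ (η r), ψ (η r)) with hw
  have hKeq : ∀ t ∈ Set.Ioo a b, expansion V (φ t, ψ t) = K t := fun t ht => by
    obtain ⟨-, -, -, h1, h2⟩ := hsol t ht
    rw [expansion, energy, ← h2, Real.sqrt_sq h1.le]
  have hwd : ∀ r ∈ Set.Ioo (θ a') (θ b'), HasDerivAt w (logField V (w r)) r := by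
    intro r hr
    obtain ⟨t, ht, rfl⟩ := hrange r hr
    have htI := hsub (Set.Ioo_subset_Icc_self ht)
    obtain ⟨h1, h2, -, hK, -⟩ := hsol t htI
    have hd := hηd t trivial
    have e := hη t trivial
    rw [hKe_eq t (Set.Ioo_subset_Icc_self ht)] at hd
    have d1 : HasDerivAt (fun r => φ (η r)) (ψ t * (K t)⁻¹) (θ t) :=
      HasDerivAt.comp (θ t) (by rw [e]; exact h1) hd
    have d2 : HasDerivAt (fun r => ψ (η r)) ((-K t * ψ t - deriv V (φ t)) * (K t)⁻¹) (θ t) :=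
      HasDerivAt.comp (θ t) (by rw [e]; exact h2) hd
    convert! d1.prodMk d2 using 1
    simp only [hw, e, logField, hKeq t htI]
    ext
    · simp only [div_eq_mul_inv]
    · field_simp
  have hp0 : (φ t₁, ψ t₁) = p.data := by
    rw [PhaseSpace.data, ← hp]
  have hq0 : (φ t₂, ψ t₂) = q.data := by
    rw [PhaseSpace.data, ← hq]
  have h0mem : (0 : ℝ) ∈ Set.Ioo (θ a') (θ b') := by
    rw [← hθ0]; exact ⟨hθm ha₁, hθm hb₁⟩
  have heq := eqOn_Ioo_of_contDiffAt (f := logFlow V p.data) (g := w) h0mem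
    (fun t _ => contDiffAt_logField hV (energy_logFlow_pos hV p.energy_pos t))
    (fun t _ => hasDerivAt_logFlow hV p.energy_pos t) hwd (by
      have := hη t₁ trivial
      rw [hθ0] at this
      rw [logFlow_zero hV p.energy_pos, hw]; simp only [this, hp0])
  refine ⟨θ t₂, ?_⟩
  rw [heq ⟨hθm ha₂, hθm hb₂⟩, hw]
  simp only [hη t₂ trivial, hq0]

lemma sameOrbit_of_logFlow_eq (hV : IsPotential V) {p q : PhaseSpace V} {τ : ℝ}
    (h : logFlow V p.data τ = q.data) : SameOrbit V p q := by
  obtain ⟨T, hT⟩ := exists_isClock hV p.energy_pos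
  obtain ⟨θ, hθ, hsol⟩ := hT.exists_solution hV p.energy_pos
  have hm := hT.strictMono hV p.energy_pos
  have hc : Continuous T := continuous_iff_continuousAt.mpr fun t => (hT t).continuousAt
  have hstate : ∀ s : ℝ, ∀ r : PhaseSpace V, logFlow V p.data s = r.data →
      (expansion V (logFlow V p.data (θ (T s))), (logFlow V p.data (θ (T s))).1,
        (logFlow V p.data (θ (T s))).2) = r.1 := by
    intro s r hr
    rw [hθ, hr, r.expansion_data]
    rfl
  refine ⟨T (-(|τ| + 1)), T (|τ| + 1), _, _, _, hsol.mono ?_,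
    ⟨T 0, ⟨hm (by linarith [abs_nonneg τ]), hm (by linarith [abs_nonneg τ])⟩,
      hstate 0 p (logFlow_zero hV p.energy_pos)⟩,
    ⟨T τ, ⟨hm (by linarith [neg_abs_le τ]), hm (by linarith [le_abs_self τ])⟩, hstate τ q h⟩⟩
  intro t ht
  exact mem_range_of_exists_le_of_exists_ge hc ⟨_, ht.1.le⟩ ⟨_, ht.2.le⟩

/-- Two states represent the same cosmology if and only if the flow joins them. -/
lemma cosmologyOf_eq_iff (hV : IsPotential V) {p q : PhaseSpace V} :
    cosmologyOf p = cosmologyOf q ↔ ∃ τ, logFlow V p.data τ = q.data := by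
  constructor
  · intro h
    induction Quot.eqvGen_exact h with
    | rel x y hxy => exact exists_logFlow_eq_of_sameOrbit hV hxy
    | refl x => exact ⟨0, logFlow_zero hV x.energy_pos⟩
    | symm x y _ ih =>
      obtain ⟨τ, hτ⟩ := ih (Quot.eqvGen_sound ‹_›)
      exact ⟨-τ, by rw [← hτ, logFlow_neg_cancel hV x.energy_pos]⟩
    | trans x y z _ _ ih1 ih2 =>
      obtain ⟨τ, hτ⟩ := ih1 (Quot.eqvGen_sound ‹_›)
      obtain ⟨τ', hτ'⟩ := ih2 (Quot.eqvGen_sound ‹_›)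
      exact ⟨τ + τ', by rw [← logFlow_add hV x.energy_pos, hτ, hτ']⟩
  · rintro ⟨τ, hτ⟩
    exact Quot.sound (sameOrbit_of_logFlow_eq hV hτ)

lemma IsHistory.cosmologyOf_stateAt {s : Cosmology V} {t₀ : ℝ} {K φ ψ : ℝ → ℝ}
    (h : IsHistory V s t₀ K φ ψ) {t : ℝ} (ht : t ∈ Set.Ioi t₀) :
    cosmologyOf (h.1.stateAt ht) = s := by
  obtain ⟨hsol, t₁, ht₁, p, hp, rfl⟩ := h
  refine Quot.sound ⟨t₀, max t t₁ + 1, K, φ, ψ, hsol.mono fun r hr => hr.1, ⟨t, ⟨ht, ?_⟩, rfl⟩,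
    ⟨t₁, ⟨ht₁, ?_⟩, hp.symm⟩⟩
  · linarith [le_max_left t t₁]
  · linarith [le_max_right t t₁]

/-! ### The initial singularity -/

section singularity

variable (h : IsAdmissible V ν μ R) (hσ : σ = 1 ∨ σ = -1)
include h hσ

lemma tendsto_expansion {p : ℝ × ℝ} (hp : p ∈ basin V σ μ R) :
    Tendsto (fun τ => expansion V (logFlow V p τ)) atBot atTop := by
  have hV := h.toIsPotential
  have hκμ : 0 < κ * μ := mul_pos κ_pos h.μ_pos
  have ⟨hp0, T, hT⟩ := hp
  -- `ln K` is the phase, which converges, minus a multiple of `σ φ`, which tends to `-∞`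
  have hφ : Tendsto (fun τ => -(σ * (3 / 2 * κ)) * (logFlow V p τ).1) atBot atTop := by
    have h1 : Tendsto (fun τ : ℝ => 3 / 2 * κ * (-(σ * (logFlow V p T).1) + κ * μ * (T - τ)))
        atBot atTop := by
      refine Tendsto.const_mul_atTop (mul_pos (by norm_num) κ_pos)
        (tendsto_atTop_add_const_left _ _ (Tendsto.const_mul_atTop hκμ ?_))
      exact tendsto_atTop_add_const_left _ _ tendsto_neg_atBot_atTop
    refine tendsto_atTop_mono' _ ?_ h1
    filter_upwards [eventually_le_atBot T] with τ hτ
    have h2 := (trapped_past h hσ hT (t := τ - T) (by linarith)).2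
    rw [logFlow_add hV hp0, add_sub_cancel] at h2
    have h3 : 0 < 3 / 2 * κ := mul_pos (by norm_num) κ_pos
    nlinarith
  have hlog : Tendsto (fun τ => Real.log (expansion V (logFlow V p τ))) atBot atTop := by
    refine ((tendsto_phase h hσ hp).add_atTop hφ).congr fun τ => ?_
    rw [phase]; ring
  refine (Real.tendsto_exp_atTop.comp hlog).congr fun τ => ?_
  exact Real.exp_log (expansion_pos (energy_logFlow_pos hV hp0 τ))

omit hσ in
lemma hasDerivAt_inv_expansion {p : ℝ × ℝ} (hp : 0 < energy V p) (τ : ℝ) :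
    HasDerivAt (fun τ => (expansion V (logFlow V p τ))⁻¹)
      ((1 - 3 * ratio V (logFlow V p τ)) * (expansion V (logFlow V p τ))⁻¹) τ := by
  have hV := h.toIsPotential
  have hk := energy_logFlow_pos hV hp τ
  have hK := expansion_pos hk
  convert! (hasDerivAt_expansion_logFlow hV hp τ).inv hK.ne' using 1
  rw [← speed_sq hV hk]
  field_simp

/-- The solutions in the basin have a finite past: a clock can be set to vanish at the
singularity, and then shows all positive times. -/
lemma exists_clock_of_basin {p : ℝ × ℝ} (hp : p ∈ basin V σ μ R) :
    ∃ T, IsClock V p T ∧ Tendsto T atBot (𝓝 0) ∧ Set.range T = Set.Ioi 0 := by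
  have hV := h.toIsPotential
  have ⟨hp0, _⟩ := hp
  obtain ⟨T₁, hT₁⟩ := basin_eventually h hσ hp
  obtain ⟨T₀, hT₀⟩ := exists_isClock hV hp0
  have hm₀ := hT₀.strictMono hV hp0
  have hμ2 : 0 < μ ^ 2 := pow_pos h.μ_pos 2
  have hKi : ∀ τ, 0 < (expansion V (logFlow V p τ))⁻¹ := fun τ =>
    inv_pos.mpr (expansion_pos (energy_logFlow_pos hV hp0 τ))
  -- to the past, `1 / K` decreases at least `μ²` times as fast as the clock
  have hanti : AntitoneOn (fun τ => μ ^ 2 * T₀ τ - (expansion V (logFlow V p τ))⁻¹)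
      (Set.Iic T₁) := by
    refine antitoneOn_of_hasDerivAt_nonpos (convex_Iic T₁)
      (fun τ _ => ((hT₀ τ).const_mul (μ ^ 2)).sub (hasDerivAt_inv_expansion h hp0 τ))
      fun τ hτ => ?_
    have hq := hT₁ τ hτ
    have h1 := speed_sq hV hq.1
    have h2 : (κ * μ) ^ 2 ≤ (σ * speed V (logFlow V p τ)) ^ 2 := by
      have := hq.2.2.le
      have := (mul_pos κ_pos h.μ_pos).le
      gcongr
    rw [mul_pow, mul_pow, pow_two κ, κ_mul_self, pow_two σ, sign_mul_self hσ, one_mul] at h2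
    have h3 := (hKi τ).le
    nlinarith
  have hbdd : BddBelow (Set.range T₀) := by
    refine ⟨T₀ T₁ - (μ ^ 2)⁻¹ * (expansion V (logFlow V p T₁))⁻¹, ?_⟩
    rintro _ ⟨τ, rfl⟩
    rcases le_total τ T₁ with hτ | hτ
    · have h1 := hanti (show τ ∈ Set.Iic T₁ from hτ) Set.self_mem_Iic hτ
      simp only at h1
      have h2 := hKi τ
      rw [sub_le_iff_le_add, ← sub_le_iff_le_add', le_inv_mul_iff₀ hμ2]
      linarith
    · have h1 := hm₀.monotone hτ
      have h2 := mul_pos (inv_pos.mpr hμ2) (hKi T₁)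
      linarith
  have hlim := tendsto_atBot_ciInf hm₀.monotone hbdd
  set t₀ := ⨅ τ, T₀ τ with ht₀
  have hT : IsClock V p fun τ => T₀ τ - t₀ := fun τ => (hT₀ τ).sub_const t₀
  have hTm := hT.strictMono hV hp0
  have hT0 : Tendsto (fun τ => T₀ τ - t₀) atBot (𝓝 0) := by
    simpa using hlim.sub_const t₀
  have htop : ∀ τ ≥ 0, T₀ 0 + (expansion V p)⁻¹ * τ ≤ T₀ τ := by
    intro τ hτ
    have hmono := monotoneOn_of_hasDerivAt_nonneg (convex_Ici 0)
      (fun τ _ => (hT₀ τ).sub ((hasDerivAt_id τ).const_mul (expansion V p)⁻¹))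
      (fun τ hτ => by
        have h1 : expansion V (logFlow V p τ) ≤ expansion V p := by
          have := energy_logFlow_antitone hV hp0 (show (0 : ℝ) ≤ τ from hτ)
          simp only [logFlow_zero hV hp0] at this
          exact Real.sqrt_le_sqrt this
        have h2 := inv_anti₀ (expansion_pos (energy_logFlow_pos hV hp0 τ)) h1
        simp only [mul_one]
        linarith) Set.self_mem_Ici (show τ ∈ Set.Ici 0 from hτ) hτ
    have hmono' : T₀ 0 - (expansion V p)⁻¹ * 0 ≤ T₀ τ - (expansion V p)⁻¹ * τ := hmono
    linarith
  refine ⟨_, hT, hT0, Set.Subset.antisymm ?_ ?_⟩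
  · rintro _ ⟨τ, rfl⟩
    have h1 : 0 ≤ T₀ (τ - 1) - t₀ := hTm.monotone.le_of_tendsto hT0 _
    have h2 : T₀ (τ - 1) - t₀ < T₀ τ - t₀ := hTm (by linarith)
    exact h1.trans_lt h2
  · intro t ht
    have hc : Continuous fun τ => T₀ τ - t₀ :=
      continuous_iff_continuousAt.mpr fun τ => (hT τ).continuousAt
    obtain ⟨τ₁, hτ₁⟩ := (hT0.eventually_lt_const ht).exists
    refine mem_range_of_exists_le_of_exists_ge hc ⟨τ₁, hτ₁.le⟩ ?_
    have hK := expansion_pos hp0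
    refine ⟨expansion V p * |t + t₀ - T₀ 0|, ?_⟩
    have := htop (expansion V p * |t + t₀ - T₀ 0|) (by positivity)
    rw [inv_mul_cancel_left₀ hK.ne'] at this
    linarith [le_abs_self (t + t₀ - T₀ 0)]

/-- With the clock set to vanish at the singularity, `1 / K` is the clock reading up to a relative
error controlled by the potential energy fraction. -/
lemma clock_bounds {p : ℝ × ℝ} (hp : p ∈ basin V σ μ R) {T : ℝ → ℝ} (hT : IsClock V p T)
    (hT0 : Tendsto T atBot (𝓝 0)) :
    (∀ τ, (expansion V (logFlow V p τ))⁻¹ ≤ T τ) ∧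
      ∀ᶠ τ in atBot,
        T τ * (1 - 3 * ratio V (logFlow V p τ)) ≤ (expansion V (logFlow V p τ))⁻¹ := by
  have hV := h.toIsPotential
  have hp0 := hp.1
  have hKi : ∀ τ, 0 < (expansion V (logFlow V p τ))⁻¹ := fun τ =>
    inv_pos.mpr (expansion_pos (energy_logFlow_pos hV hp0 τ))
  have hK0 : Tendsto (fun τ => (expansion V (logFlow V p τ))⁻¹) atBot (𝓝 0) :=
    (tendsto_expansion h hσ hp).inv_tendsto_atTop
  have hA : ∀ τ, (expansion V (logFlow V p τ))⁻¹ ≤ T τ := by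
    intro τ
    have hmono : Monotone fun τ => T τ - (expansion V (logFlow V p τ))⁻¹ := by
      refine monotone_of_hasDerivAt_nonneg
        (fun τ => (hT τ).sub (hasDerivAt_inv_expansion h hp0 τ)) fun τ => ?_
      have h1 := hKi τ
      have h2 := ratio_nonneg hV (logFlow V p τ)
      change 0 ≤ (expansion V (logFlow V p τ))⁻¹ -
        (1 - 3 * ratio V (logFlow V p τ)) * (expansion V (logFlow V p τ))⁻¹
      nlinarith
    have hl : Tendsto (fun τ => T τ - (expansion V (logFlow V p τ))⁻¹) atBot (𝓝 0) := by
      simpa using hT0.sub hK0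
    have := hmono.le_of_tendsto hl τ
    linarith
  refine ⟨hA, ?_⟩
  obtain ⟨T₁, hT₁⟩ := basin_eventually h hσ hp
  filter_upwards [eventually_le_atBot T₁] with τ hτ
  have hd := fun τ => (hasDerivAt_inv_expansion h hp0 τ).sub
    ((hT τ).mul (((hasDerivAt_ratio_logFlow hV hp0 τ).const_mul 3).const_sub 1))
  have hmono : MonotoneOn (fun τ => (expansion V (logFlow V p τ))⁻¹ -
      T τ * (1 - 3 * ratio V (logFlow V p τ))) (Set.Iic T₁) := by
    refine monotoneOn_of_hasDerivAt_nonneg (convex_Iic T₁) (fun τ _ => hd τ) fun τ hτ => ?_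
    have hq := hT₁ τ hτ
    have h1 := ratio_deriv_ge h hσ hq
    have h2 : 0 ≤ 3 * (κ * (μ - ν)) * (σ * speed V (logFlow V p τ)) *
        ratio V (logFlow V p τ) := by
      have := (mul_pos κ_pos h.μ_pos).trans hq.2.2
      have := ratio_nonneg hV (logFlow V p τ)
      have : 0 ≤ κ * (μ - ν) := mul_nonneg κ_pos.le (by linarith [h.ν_lt])
      positivity
    have h3 := (hKi τ).le.trans (hA τ)
    have := mul_nonneg h3 (h2.trans h1)
    linarith
  have hl : Tendsto (fun τ => (expansion V (logFlow V p τ))⁻¹ -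
      T τ * (1 - 3 * ratio V (logFlow V p τ))) atBot (𝓝 (0 - 0 * (1 - 3 * 0))) :=
    hK0.sub (hT0.mul (((tendsto_ratio h hσ hp).const_mul 3).const_sub 1))
  have : (0 : ℝ) - 0 * (1 - 3 * 0) ≤ _ := le_of_tendsto hl (by
    filter_upwards [eventually_le_atBot τ] with s hs
    exact hmono (hs.trans hτ) hτ hs)
  linarith

/-- Pointwise comparison of a trapped state, at the time `t` after the singularity, with the
massless solution having the same asymptotic parameter `L`. -/
lemma trapped_estimates {q : ℝ × ℝ} (hq : q ∈ trapped V σ μ R) {t L : ℝ} (ht : 0 < t)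
    (h1 : (expansion V q)⁻¹ ≤ t) (h2 : t * (1 - 3 * ratio V q) ≤ (expansion V q)⁻¹)
    (hL : L ∈ Set.Icc (phase V σ q - 3 / (2 * (μ - ν)) * ratio V q) (phase V σ q)) :
    |expansion V q - 1 / t| ≤ 3 * (t * V q.1) ∧
    |q.2 - σ * κ / t| ≤ (3 * κ + 2 / κ) * (t * V q.1) ∧
    |q.1 - σ * κ * (Real.log t + L)| ≤
      κ * (3 / (2 * (μ - ν)) + 3 / μ ^ 2) * (t * (t * V q.1)) ∧
    |q.1 - σ * κ * (Real.log t + L)| ≤ κ * (3 / (2 * (μ - ν)) + 3 / μ ^ 2) := by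
  have hV := h.toIsPotential
  have hK := expansion_pos hq.1
  set K := expansion V q with hKdef
  set Y := ratio V q with hYdef
  have hY0 : 0 ≤ Y := ratio_nonneg hV q
  have hV0 := hV.nonneg q.1
  have hKt : 1 ≤ K * t := by rwa [inv_le_iff_one_le_mul₀' hK] at h1
  have hKt2 : K * t * (1 - 3 * Y) ≤ 1 := by
    calc K * t * (1 - 3 * Y) = K * (t * (1 - 3 * Y)) := by ring
      _ ≤ K * K⁻¹ := mul_le_mul_of_nonneg_left h2 hK.le
      _ = 1 := mul_inv_cancel₀ hK.ne'
  have hVK : V q.1 = Y * K ^ 2 := by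
    rw [hYdef, ratio, hKdef, expansion_sq hV, div_mul_cancel₀ _ hq.1.ne']
  have hYV : Y ≤ t * (t * V q.1) := by
    rw [hVK]; nlinarith [mul_nonneg hY0 (sub_nonneg.mpr hKt)]
  have hYK : Y * K ≤ t * V q.1 := by
    rw [hVK]; nlinarith [mul_nonneg (mul_nonneg hY0 hK.le) (sub_nonneg.mpr hKt)]
  have hμ2 : 0 < μ ^ 2 := pow_pos h.μ_pos 2
  have hY1 : μ ^ 2 ≤ 1 - 3 * Y := by
    have := (dataOf_self hσ h hq).1
    rw [hVK] at this
    have hK2 := pow_pos hK 2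
    nlinarith
  have hKtμ : K * t ≤ 1 / μ ^ 2 := by
    rw [le_div_iff₀ hμ2]
    have : 0 < K * t := by positivity
    nlinarith
  have hC0 : 0 ≤ 3 / (2 * (μ - ν)) := div_nonneg (by norm_num) (by linarith [h.ν_lt])
  have hξ1 := sub_sign_mul_speed_le h hσ hq
  have hξ2 := sign_mul_speed_le h hσ q
  have hκ := κ_pos
  -- the defect of `K t`, and of `K`
  have hdef : K * t - 1 ≤ 3 * Y * (K * t) := by linarith
  have hKd : K - 1 / t ≤ 3 * (Y * K) := by
    rw [sub_le_iff_le_add, ← sub_le_iff_le_add', le_div_iff₀ ht]; linarith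
  have hKd0 : 0 ≤ K - 1 / t := by
    rw [sub_nonneg, div_le_iff₀ ht]; exact hKt
  have hlog0 : 0 ≤ Real.log (K * t) := Real.log_nonneg hKt
  have hlog1 : Real.log (K * t) ≤ 3 / μ ^ 2 * Y := by
    have := Real.log_le_sub_one_of_pos (show 0 < K * t by positivity)
    have e : 3 / μ ^ 2 * Y = 3 * Y * (1 / μ ^ 2) := by ring
    rw [e]
    exact this.trans (hdef.trans (mul_le_mul_of_nonneg_left hKtμ (by positivity)))
  have hφ : q.1 - σ * κ * (Real.log t + L) = σ * κ * ((phase V σ q - L) - Real.log (K * t)) := by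
    rw [phase, Real.log_mul hK.ne' ht.ne']
    linear_combination (-(3 / 2 * κ * κ * q.1)) * sign_mul_self hσ - (3 / 2 * q.1) * κ_mul_self
  have hφY : |q.1 - σ * κ * (Real.log t + L)| ≤ κ * (3 / (2 * (μ - ν)) + 3 / μ ^ 2) * Y := by
    rw [hφ, abs_mul, abs_mul, abs_sign hσ, one_mul, abs_of_pos hκ, mul_assoc]
    refine mul_le_mul_of_nonneg_left ?_ hκ.le
    have e1 : 0 ≤ 3 / μ ^ 2 * Y := by positivity
    have e2 : 0 ≤ 3 / (2 * (μ - ν)) * Y := by positivity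
    rw [abs_le, add_mul]
    constructor <;> linarith [hL.1, hL.2]
  refine ⟨?_, ?_, ?_, ?_⟩
  · rw [abs_of_nonneg hKd0]; linarith
  · have e : |q.2 - σ * κ / t| = |σ * speed V q * K - κ / t| := by
      rw [show σ * speed V q * K - κ / t = σ * (q.2 - σ * κ / t) by
        rw [speed, ← hKdef]
        field_simp
        linear_combination κ * sign_mul_self hσ, abs_mul, abs_sign hσ, one_mul]
    have e2 : σ * speed V q * K - κ / t = κ * (K - 1 / t) - (κ - σ * speed V q) * K := by ring
    rw [e, e2]
    have e3 : 0 ≤ (κ - σ * speed V q) * K := mul_nonneg (by linarith) hK.le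
    have e4 : (κ - σ * speed V q) * K ≤ 2 / κ * (t * V q.1) := by
      have := mul_le_mul_of_nonneg_right hξ1 hK.le
      rw [mul_assoc] at this
      exact this.trans (mul_le_mul_of_nonneg_left hYK (by positivity))
    have e5 : κ * (K - 1 / t) ≤ 3 * κ * (t * V q.1) := by nlinarith
    have e6 : 0 ≤ κ * (K - 1 / t) := mul_nonneg hκ.le hKd0
    have e7 : 0 ≤ t * V q.1 := by positivity
    have e8 : 0 ≤ 2 / κ * (t * V q.1) := by positivity
    have e9 : 0 ≤ 3 * κ * (t * V q.1) := by positivity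
    rw [abs_le, add_mul]
    constructor <;> linarith
  · exact hφY.trans (mul_le_mul_of_nonneg_left hYV (by positivity))
  · exact hφY.trans (mul_le_of_le_one_right (by positivity) (by linarith))

/-- Every solution in the basin has, after a shift of the time origin, the asymptotic form of the
massless solution with `ln c = -L`, where `L` is the asymptotic parameter. -/
lemma exists_history {p : PhaseSpace V} (hp : p.data ∈ basin V σ μ R) :
    ∃ K φ ψ : ℝ → ℝ, IsHistory V (cosmologyOf p) 0 K φ ψ ∧ (∀ t > 0, 1 ≤ K t * t) ∧
      (fun t => K t - 1 / t) =O[𝓝[>] 0] errorFn V σ ∧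
      (fun t => φ t - masslessField σ (Real.exp (-asymptote V σ p.data)) t)
        =O[𝓝[>] 0] (fun t => t * errorFn V σ t) ∧
      (fun t => ψ t - σ * √(2 / 3) / t) =O[𝓝[>] 0] errorFn V σ := by
  have hV := h.toIsPotential
  have hκ := κ_pos
  obtain ⟨T, hT, hT0, hrange⟩ := exists_clock_of_basin h hσ hp
  obtain ⟨θ, hθ, hsol⟩ := hT.exists_solution hV hp.1
  obtain ⟨hb1, hb2⟩ := clock_bounds h hσ hp hT hT0
  have hm := hT.strictMono hV hp.1
  have hTpos : ∀ τ, 0 < T τ := fun τ => by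
    have : T τ ∈ Set.range T := ⟨τ, rfl⟩
    rwa [hrange] at this
  rw [hrange] at hsol
  have hTθ : ∀ t > 0, T (θ t) = t := by
    intro t ht
    have : t ∈ Set.range T := by rw [hrange]; exact ht
    obtain ⟨τ, rfl⟩ := this
    rw [hθ]
  have hθbot : Tendsto θ (𝓝[>] 0) atBot := by
    rw [tendsto_atBot]
    intro τ
    have : Set.Ioo 0 (T τ) ∈ 𝓝[>] (0 : ℝ) := Ioo_mem_nhdsGT (hTpos τ)
    filter_upwards [this] with t ht
    refine hm.le_iff_le.mp ?_
    rw [hTθ t ht.1]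
    exact ht.2.le
  set L := asymptote V σ p.data with hL
  set D := κ * (3 / (2 * (μ - ν)) + 3 / μ ^ 2) with hD
  set E := Real.exp (3 * κ * ν * (D + κ * |L|)) with hE
  have hC0 : 0 ≤ 3 / (2 * (μ - ν)) := div_nonneg (by norm_num) (by linarith [h.ν_lt])
  have hD0 : 0 ≤ D := by positivity
  obtain ⟨T₁, hT₁⟩ := basin_eventually h hσ hp
  have hlogbot : Tendsto (fun t => -(κ * Real.log t)) (𝓝[>] 0) atTop := by
    refine tendsto_neg_atBot_atTop.comp (Tendsto.const_mul_atBot hκ ?_)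
    exact Real.tendsto_log_nhdsGT_zero
  -- all estimates, with `V φ` replaced by its value on the massless solution
  have key : ∀ᶠ t in 𝓝[>] (0 : ℝ), 0 < t ∧
      |expansion V (logFlow V p.data (θ t)) - 1 / t| ≤ 3 * E * errorFn V σ t ∧
      |(logFlow V p.data (θ t)).2 - σ * κ / t| ≤ (3 * κ + 2 / κ) * E * errorFn V σ t ∧
      |(logFlow V p.data (θ t)).1 - σ * κ * (Real.log t + L)| ≤ D * E * (t * errorFn V σ t) := by
    filter_upwards [self_mem_nhdsWithin, hθbot.eventually hb2,
      hθbot.eventually (eventually_le_atBot T₁), hlogbot.eventually_ge_atTop R]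
      with t ht hbt hθt hlt
    have ht0 : 0 < t := ht
    set q := logFlow V p.data (θ t) with hq
    have hqt : q ∈ trapped V σ μ R := hT₁ _ hθt
    have a1 := hb1 (θ t)
    rw [hTθ t ht0] at a1 hbt
    have a2 := asymptote_mem_Icc h hσ hqt
    rw [hq, asymptote_logFlow h hσ hp, ← hq, ← hL] at a2
    obtain ⟨e1, e2, e3, e4⟩ := trapped_estimates h hσ hqt ht0 a1 hbt a2
    have hσσ := sign_mul_self hσ
    have hVle : V q.1 ≤ E * V (σ * √(2 / 3) * Real.log t) := by
      have hs : -σ = 1 ∨ -σ = -1 := by rcases hσ with rfl | rfl <;> norm_num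
      have := potential_le h hs (a := σ * κ * Real.log t) (b := q.1) (by
        have : -σ * (σ * κ * Real.log t) = -(κ * Real.log t) := by
          linear_combination (-(κ * Real.log t)) * hσσ
        rw [this]; exact hlt) (by linarith [hqt.2.1])
      rw [mul_comm] at this
      refine this.trans (mul_le_mul_of_nonneg_right (Real.exp_le_exp.mpr ?_) (hV.nonneg _))
      refine mul_le_mul_of_nonneg_left ?_ (mul_nonneg (by positivity) h.ν_nonneg)
      have : |σ * κ * L| = κ * |L| := by
        rw [abs_mul, abs_mul, abs_sign hσ, one_mul, abs_of_pos hκ]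
      calc |q.1 - σ * κ * Real.log t|
          = |(q.1 - σ * κ * (Real.log t + L)) + σ * κ * L| := by ring_nf
        _ ≤ D + κ * |L| := (abs_add_le _ _).trans (by linarith)
    have hVt : t * V q.1 ≤ E * errorFn V σ t := by
      rw [errorFn]
      calc t * V q.1 ≤ t * (E * V (σ * √(2 / 3) * Real.log t)) :=
            mul_le_mul_of_nonneg_left hVle ht0.le
        _ = _ := by ring
    refine ⟨ht0, e1.trans ?_, e2.trans ?_, e3.trans ?_⟩
    · rw [mul_assoc]; gcongr
    · rw [mul_assoc]; gcongr
    · rw [mul_assoc D, ← mul_assoc E, mul_comm E t, mul_assoc t]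
      gcongr
  have herr : ∀ t, 0 < t → 0 ≤ errorFn V σ t := fun t ht => mul_nonneg ht.le (hV.nonneg _)
  refine ⟨_, _, _, ⟨hsol, T 0, hTpos 0, p, ?_, rfl⟩, ?_, ?_, ?_, ?_⟩
  · rw [hθ, logFlow_zero hV hp.1, p.expansion_data]; rfl
  · intro t ht
    have := hb1 (θ t)
    rw [hTθ t ht] at this
    rwa [inv_le_iff_one_le_mul₀' (expansion_pos (energy_logFlow_pos hV hp.1 _))] at this
  · refine IsBigO.of_bound (3 * E) ?_
    filter_upwards [key] with t ht
    rw [Real.norm_eq_abs, Real.norm_eq_abs, abs_of_nonneg (herr t ht.1)]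
    exact ht.2.1
  · refine IsBigO.of_bound (D * E) ?_
    filter_upwards [key] with t ht
    rw [Real.norm_eq_abs, Real.norm_eq_abs, abs_of_nonneg (mul_nonneg ht.1.le (herr t ht.1))]
    have : masslessField σ (Real.exp (-L)) t = σ * κ * (Real.log t + L) := by
      rw [masslessField, Real.log_div ht.1.ne' (Real.exp_pos _).ne', Real.log_exp, sub_neg_eq_add, κ]
    rw [this]
    exact ht.2.2.2
  · refine IsBigO.of_bound ((3 * κ + 2 / κ) * E) ?_
    filter_upwards [key] with t ht
    rw [Real.norm_eq_abs, Real.norm_eq_abs, abs_of_nonneg (herr t ht.1)]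
    exact ht.2.2.1

/-- Since `K ≥ 1 / t`, the expansion diverges at `t = 0` and the scale factor is at most a multiple of
`t ^ (1/3)`. -/
lemma hasInitialSingularity {p : PhaseSpace V} (hp : p.data ∈ basin V σ μ R) :
    HasInitialSingularity V (cosmologyOf p) := by
  obtain ⟨K, φ, ψ, hist, hK, -⟩ := exists_history h hσ hp
  refine ⟨0, K, φ, ψ, hist, ?_, fun a ha => ?_⟩
  · refine tendsto_atTop_mono' _ ?_ tendsto_inv_nhdsGT_zero
    filter_upwards [self_mem_nhdsWithin] with t ht
    rw [inv_le_iff_one_le_mul₀ ht]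
    exact hK t ht
  · -- as `K ≥ 1 / t`, the quotient of `a` by `t ^ (1/3)` is nondecreasing
    have hmono : MonotoneOn (fun t => Real.log (a t) - 1 / 3 * Real.log t) (Set.Ioi 0) := by
      refine monotoneOn_of_hasDerivAt_nonneg (convex_Ioi 0)
        (fun t ht => (((ha t ht).2.1.hasDerivAt).log (ha t ht).1.ne').sub
          ((Real.hasDerivAt_log (ne_of_gt ht)).const_mul (1 / 3))) fun t ht => ?_
      have h1 := hK t ht
      rw [(ha t ht).2.2] at h1
      have ht0 : 0 < t := ht
      have : t⁻¹ ≤ 3 * (deriv a t / a t) := by rwa [inv_le_iff_one_le_mul₀ ht0]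
      linarith
    have hlim : Tendsto (fun t => Real.exp (Real.log (a 1) + 1 / 3 * Real.log t)) (𝓝[>] 0)
        (𝓝 0) :=
      Real.tendsto_exp_atBot.comp (tendsto_atBot_add_const_left _ _
        (Tendsto.const_mul_atBot (by norm_num) Real.tendsto_log_nhdsGT_zero))
    refine tendsto_of_tendsto_of_tendsto_of_le_of_le' tendsto_const_nhds hlim ?_ ?_
    · filter_upwards [self_mem_nhdsWithin] with t ht using (ha t ht).1.le
    · filter_upwards [Ioo_mem_nhdsGT (zero_lt_one (α := ℝ))] with t ht
      have h1 := hmono (show t ∈ Set.Ioi 0 from ht.1) (Set.mem_Ioi.mpr one_pos) ht.2.le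
      simp only [Real.log_one, mul_zero, sub_zero] at h1
      rw [← Real.log_le_iff_le_exp (ha t ht.1).1]
      linarith

/-- The error function is small compared with `1 / t`. -/
lemma tendsto_mul_errorFn :
    Tendsto (fun t => t * errorFn V σ t) (𝓝[>] 0) (𝓝 0) := by
  have hV := h.toIsPotential
  obtain ⟨M, hM0, hM⟩ := exists_potential_le_exp h
  have hlim : Tendsto (fun t => M * Real.exp (2 * (1 - ν) * Real.log t)) (𝓝[>] 0) (𝓝 0) := by
    have := (Real.tendsto_exp_atBot.comp (Tendsto.const_mul_atBot
      (show 0 < 2 * (1 - ν) by linarith [h.ν_lt, h.μ_lt]) Real.tendsto_log_nhdsGT_zero)).const_mul M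
    simpa using this
  refine tendsto_of_tendsto_of_tendsto_of_le_of_le' tendsto_const_nhds hlim ?_ ?_
  · filter_upwards [self_mem_nhdsWithin] with t ht
    have : 0 < t := ht
    have := hV.nonneg (σ * √(2 / 3) * Real.log t)
    unfold errorFn; positivity
  · filter_upwards [Ioo_mem_nhdsGT (zero_lt_one (α := ℝ))] with t ht
    have hl := Real.log_neg ht.1 ht.2
    have h1 := hM (σ * κ * Real.log t)
    rw [abs_mul, abs_mul, abs_sign hσ, one_mul, abs_of_pos κ_pos, abs_of_neg hl] at h1
    have h2 : t * t = Real.exp (2 * Real.log t) := by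
      rw [two_mul, Real.exp_add, Real.exp_log ht.1]
    have h3 : 2 * (1 - ν) * Real.log t = 2 * Real.log t + 3 * κ * ν * (κ * -Real.log t) := by
      linear_combination (3 * ν * Real.log t) * κ_mul_self
    rw [h3, Real.exp_add, ← h2, errorFn]
    have h4 : 0 ≤ t * t := mul_nonneg ht.1.le ht.1.le
    have := mul_le_mul_of_nonneg_left h1 h4
    rw [κ] at this ⊢
    linarith

/-- A solution with massless asymptotics lies in the corresponding basin, and its asymptotic
parameter is `-ln c`. -/
lemma mem_basin_of_hasMasslessAsymptotics {p : PhaseSpace V} {c : ℝ} (hc : 0 < c)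
    (hp : HasMasslessAsymptotics V (cosmologyOf p) σ c) :
    p.data ∈ basin V σ μ R ∧ asymptote V σ p.data = -Real.log c := by
  have hV := h.toIsPotential
  have hκ := κ_pos
  obtain ⟨K, φ, ψ, hist, hKO, hφO, hψO⟩ := hp
  have hsol := hist.1
  have herr := tendsto_mul_errorFn h hσ
  have hid : (fun t : ℝ => t) =O[𝓝[>] 0] fun t : ℝ => t := isBigO_refl _ _
  have hKt : Tendsto (fun t => K t * t) (𝓝[>] 0) (𝓝 1) := by
    have := ((hid.mul hKO).trans_tendsto herr).const_add 1
    rw [add_zero] at this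
    refine this.congr' ?_
    filter_upwards [self_mem_nhdsWithin] with t ht
    have : t ≠ 0 := ne_of_gt ht
    field_simp
    ring
  have hψt : Tendsto (fun t => ψ t * t) (𝓝[>] 0) (𝓝 (σ * κ)) := by
    have := ((hid.mul hψO).trans_tendsto herr).const_add (σ * κ)
    rw [add_zero] at this
    refine this.congr' ?_
    filter_upwards [self_mem_nhdsWithin] with t ht
    have : t ≠ 0 := ne_of_gt ht
    rw [← κ]
    field_simp
    ring
  have hφt := hφO.trans_tendsto herr
  have hstate : ∀ t (ht : t ∈ Set.Ioi (0 : ℝ)), 0 < energy V (φ t, ψ t) ∧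
      expansion V (φ t, ψ t) = K t ∧ ∃ τ, logFlow V p.data τ = (φ t, ψ t) := by
    intro t ht
    refine ⟨(hsol.stateAt ht).energy_pos, (hsol.stateAt ht).expansion_data, ?_⟩
    exact (cosmologyOf_eq_iff hV).mp (hist.cosmologyOf_stateAt ht).symm
  have hspeed : Tendsto (fun t => speed V (φ t, ψ t)) (𝓝[>] 0) (𝓝 (σ * κ)) := by
    have := hψt.div hKt one_ne_zero
    rw [div_one] at this
    refine this.congr' ?_
    filter_upwards [self_mem_nhdsWithin] with t ht
    have h0 : t ≠ 0 := ne_of_gt ht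
    simp only [Pi.div_apply, speed, (hstate t ht).2.1]
    rw [mul_div_mul_right _ _ h0]
  have hσφ : Tendsto (fun t => σ * φ t) (𝓝[>] 0) atBot := by
    have h1 : Tendsto (fun t => κ * (Real.log t - Real.log c)) (𝓝[>] 0) atBot :=
      Tendsto.const_mul_atBot hκ
        (tendsto_atBot_add_const_right _ (-Real.log c) Real.tendsto_log_nhdsGT_zero)
    refine ((hφt.const_mul σ).add_atBot h1).congr' ?_
    filter_upwards [self_mem_nhdsWithin] with t ht
    rw [masslessField, Real.log_div (ne_of_gt ht) hc.ne', ← κ]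
    linear_combination (-(κ * (Real.log t - Real.log c))) * sign_mul_self hσ
  have htrap : ∀ᶠ t in 𝓝[>] (0 : ℝ), (φ t, ψ t) ∈ trapped V σ μ R := by
    have h1 : Tendsto (fun t => σ * speed V (φ t, ψ t)) (𝓝[>] 0) (𝓝 κ) := by
      have := hspeed.const_mul σ
      rwa [← mul_assoc, sign_mul_self hσ, one_mul] at this
    have h2 : κ * μ < κ := by nlinarith [h.μ_lt]
    filter_upwards [self_mem_nhdsWithin, h1.eventually_const_lt h2,
      hσφ.eventually_lt_atBot (-R)] with t ht a1 a2
    exact ⟨(hstate t ht).1, a2, a1⟩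
  have hbasin : p.data ∈ basin V σ μ R := by
    obtain ⟨t, ht, ht0⟩ := (htrap.and self_mem_nhdsWithin).exists
    obtain ⟨τ, hτ⟩ := (hstate t ht0).2.2
    exact ⟨p.energy_pos, τ, by rwa [hτ]⟩
  refine ⟨hbasin, ?_⟩
  have hphase : Tendsto (fun t => phase V σ (φ t, ψ t)) (𝓝[>] 0) (𝓝 (-Real.log c)) := by
    have h1 : Tendsto (fun t => Real.log (K t * t)) (𝓝[>] 0) (𝓝 0) := by
      have := hKt.log one_ne_zero
      rwa [Real.log_one] at this
    have h2 := (h1.add (hφt.const_mul (σ * (3 / 2 * κ)))).add_const (-Real.log c)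
    simp only [mul_zero, add_zero, zero_add] at h2
    refine h2.congr' ?_
    filter_upwards [self_mem_nhdsWithin] with t ht
    have hKpos := (hsol t ht).2.2.2.1
    rw [phase, (hstate t ht).2.1, masslessField, Real.log_div (ne_of_gt ht) hc.ne', ← κ,
      Real.log_mul hKpos.ne' (ne_of_gt ht)]
    linear_combination (-(3 / 2 * κ * κ * (Real.log t - Real.log c))) * sign_mul_self hσ
      - (3 / 2 * (Real.log t - Real.log c)) * κ_mul_self
  have hratio : Tendsto (fun t => 3 / (2 * (μ - ν)) * ratio V (φ t, ψ t)) (𝓝[>] 0) (𝓝 0) := by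
    have h1 : Tendsto (fun t => 3 / (2 * (μ - ν)) * ((1 - 3 / 2 * speed V (φ t, ψ t) ^ 2) / 3))
        (𝓝[>] 0) (𝓝 (3 / (2 * (μ - ν)) * ((1 - 3 / 2 * (σ * κ) ^ 2) / 3))) :=
      ((((hspeed.pow 2).const_mul (3 / 2)).const_sub 1).div_const 3).const_mul _
    have e : (3 / (2 * (μ - ν)) * ((1 - 3 / 2 * (σ * κ) ^ 2) / 3)) = 0 := by
      rw [mul_pow, pow_two σ, sign_mul_self hσ, pow_two κ, κ_mul_self]; norm_num
    rw [e] at h1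
    refine h1.congr' ?_
    filter_upwards [self_mem_nhdsWithin] with t ht
    rw [speed_sq hV (hstate t ht).1]
    ring
  have hconst : ∀ᶠ t in 𝓝[>] (0 : ℝ), asymptote V σ p.data ∈ Set.Icc
      (phase V σ (φ t, ψ t) - 3 / (2 * (μ - ν)) * ratio V (φ t, ψ t)) (phase V σ (φ t, ψ t)) := by
    filter_upwards [htrap, self_mem_nhdsWithin] with t ht ht0
    obtain ⟨τ, hτ⟩ := (hstate t ht0).2.2
    have := asymptote_mem_Icc h hσ ht
    rwa [← hτ, asymptote_logFlow h hσ hbasin, hτ] at this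
  have hlow := hphase.sub hratio
  rw [sub_zero] at hlow
  exact le_antisymm (ge_of_tendsto hphase (hconst.mono fun _ ht => ht.2))
    (le_of_tendsto hlow (hconst.mono fun _ ht => ht.1))

end singularity

end FRW

namespace FRW
/-! ### The space of cosmologies with an initial singularity -/

variable {V : ℝ → ℝ} {ν μ R σ : ℝ}

lemma PhaseSpace.continuous_data : Continuous (PhaseSpace.data : PhaseSpace V → ℝ × ℝ) :=
  continuous_snd.comp continuous_subtype_val

lemma exists_cosmologyOf_eq (s : Cosmology V) : ∃ p, cosmologyOf p = s := Quot.exists_rep s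

/-- The cosmologies whose initial data lie in a basin. -/
def basinCosmologies (V : ℝ → ℝ) (σ μ R : ℝ) : Set (Cosmology V) :=
  {s | ∃ p : PhaseSpace V, p.data ∈ basin V σ μ R ∧ cosmologyOf p = s}

/-- The asymptotic parameter of a cosmology, read off from an arbitrary representative. -/
noncomputable def cosmologyAsymptote (V : ℝ → ℝ) (σ : ℝ) (s : Cosmology V) : ℝ :=
  asymptote V σ (exists_cosmologyOf_eq s).choose.data

lemma cosmologyOf_mem_iff (hV : IsPotential V) (p : PhaseSpace V) :
    cosmologyOf p ∈ basinCosmologies V σ μ R ↔ p.data ∈ basin V σ μ R := by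
  constructor
  · rintro ⟨q, hq, hqp⟩
    obtain ⟨τ, hτ⟩ := (cosmologyOf_eq_iff hV).mp hqp
    rw [← hτ]
    exact (logFlow_mem_basin_iff hV q.energy_pos τ).mpr hq
  · exact fun hp => ⟨p, hp, rfl⟩

lemma cosmologyAsymptote_cosmologyOf (h : IsAdmissible V ν μ R) (hσ : σ = 1 ∨ σ = -1)
    {p : PhaseSpace V} (hp : p.data ∈ basin V σ μ R) :
    cosmologyAsymptote V σ (cosmologyOf p) = asymptote V σ p.data := by
  have hV := h.toIsPotential
  obtain ⟨τ, hτ⟩ :=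
    (cosmologyOf_eq_iff hV).mp (exists_cosmologyOf_eq (cosmologyOf p)).choose_spec.symm
  rw [cosmologyAsymptote, ← hτ, asymptote_logFlow h hσ hp]

lemma isOpen_basinCosmologies (hV : IsPotential V) : IsOpen (basinCosmologies V σ μ R) := by
  rw [← (isQuotientMap_quot_mk (r := SameOrbit V)).isOpen_preimage]
  convert (isOpen_basin hV σ μ R).preimage (PhaseSpace.continuous_data (V := V)) using 1
  ext p
  exact cosmologyOf_mem_iff hV p

lemma continuousOn_cosmologyAsymptote (h : IsAdmissible V ν μ R) (hσ : σ = 1 ∨ σ = -1) :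
    ContinuousOn (cosmologyAsymptote V σ) (basinCosmologies V σ μ R) := by
  have hV := h.toIsPotential
  rw [(isQuotientMap_quot_mk (r := SameOrbit V)).continuousOn_isOpen_iff
    (isOpen_basinCosmologies hV)]
  have hc : ContinuousOn (fun p : PhaseSpace V => asymptote V σ p.data)
      (Quot.mk (SameOrbit V) ⁻¹' basinCosmologies V σ μ R) := fun p hp =>
    (ContinuousAt.comp (f := PhaseSpace.data)
      (continuousAt_asymptote h hσ ((cosmologyOf_mem_iff hV p).mp hp))
      PhaseSpace.continuous_data.continuousAt).continuousWithinAt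
  exact hc.congr fun p hp => cosmologyAsymptote_cosmologyOf h hσ ((cosmologyOf_mem_iff hV p).mp hp)

/-- A cosmology has massless asymptotics exactly if it lies in the basin and has the asymptotic
parameter of the massless cosmology. -/
lemma hasMasslessAsymptotics_iff (h : IsAdmissible V ν μ R) (hσ : σ = 1 ∨ σ = -1) {c : ℝ}
    (hc : 0 < c) (s : Cosmology V) : HasMasslessAsymptotics V s σ c ↔
      s ∈ basinCosmologies V σ μ R ∧ cosmologyAsymptote V σ s = -Real.log c := by
  have hV := h.toIsPotential
  obtain ⟨p, rfl⟩ := exists_cosmologyOf_eq s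
  rw [cosmologyOf_mem_iff hV]
  constructor
  · intro hp
    obtain ⟨h1, h2⟩ := mem_basin_of_hasMasslessAsymptotics h hσ hc hp
    exact ⟨h1, by rw [cosmologyAsymptote_cosmologyOf h hσ h1, h2]⟩
  · rintro ⟨h1, h2⟩
    rw [cosmologyAsymptote_cosmologyOf h hσ h1] at h2
    obtain ⟨K, φ, ψ, hist, -, hK, hφ, hψ⟩ := exists_history h hσ h1
    rw [h2, neg_neg, Real.exp_log hc] at hφ
    exact ⟨K, φ, ψ, hist, hK, hφ, hψ⟩

/-- The sign `±1` encoded by a truth value. -/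
noncomputable def signOf (b : Bool) : ℝ := if b then 1 else -1

lemma signOf_eq (b : Bool) : signOf b = 1 ∨ signOf b = -1 := by cases b <;> simp [signOf]

lemma exists_signOf_eq (hσ : σ = 1 ∨ σ = -1) : ∃ b, signOf b = σ := by
  rcases hσ with rfl | rfl
  · exact ⟨true, by simp [signOf]⟩
  · exact ⟨false, by simp [signOf]⟩

/-- The cosmologies with massless asymptotics, of either sign. -/
def singularCosmologies (V : ℝ → ℝ) (μ R : ℝ) : Set (Cosmology V) :=
  {s | ∃ b, s ∈ basinCosmologies V (signOf b) μ R}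

open Classical in
/-- Sign and asymptotic parameter of a cosmology, meaningful on `singularCosmologies`. -/
noncomputable def parameters (V : ℝ → ℝ) (μ R : ℝ) (s : Cosmology V) : Bool × ℝ :=
  if s ∈ basinCosmologies V 1 μ R then (true, cosmologyAsymptote V 1 s)
  else (false, cosmologyAsymptote V (-1) s)

lemma parameters_eq (h : IsAdmissible V ν μ R) {b : Bool} {s : Cosmology V}
    (hs : s ∈ basinCosmologies V (signOf b) μ R) :
    parameters V μ R s = (b, cosmologyAsymptote V (signOf b) s) := by
  have hV := h.toIsPotential
  cases b with
  | true =>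
    simp only [signOf, if_true] at hs ⊢
    rw [parameters, if_pos hs]
  | false =>
    simp only [signOf, Bool.false_eq_true, if_false] at hs ⊢
    rw [parameters, if_neg]
    intro hs'
    obtain ⟨p, rfl⟩ := exists_cosmologyOf_eq s
    rw [cosmologyOf_mem_iff hV] at hs hs'
    exact Set.disjoint_left.mp (basin_disjoint h) hs' hs

lemma continuous_parameters (h : IsAdmissible V ν μ R) :
    Continuous fun s : singularCosmologies V μ R => parameters V μ R s := by
  have : ContinuousOn (parameters V μ R) (singularCosmologies V μ R) := by
    rintro s ⟨b, hs⟩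
    have hnhds := (isOpen_basinCosmologies h.toIsPotential).mem_nhds hs
    have h1 := (continuousOn_cosmologyAsymptote h (signOf_eq b)).continuousAt hnhds
    refine ContinuousAt.continuousWithinAt ?_
    refine ((continuousAt_const (y := b)).prodMk h1).congr ?_
    filter_upwards [hnhds] with s' hs' using (parameters_eq h hs').symm
  exact continuousOn_iff_continuous_domRestrict.mp this

lemma parameters_injOn (h : IsAdmissible V ν μ R) :
    Set.InjOn (parameters V μ R) (singularCosmologies V μ R) := by
  rintro s ⟨b, hs⟩ s' ⟨b', hs'⟩ heq
  have hV := h.toIsPotential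
  rw [parameters_eq h hs, parameters_eq h hs', Prod.mk.injEq] at heq
  obtain ⟨rfl, heq⟩ := heq
  obtain ⟨p, rfl⟩ := exists_cosmologyOf_eq s
  obtain ⟨q, rfl⟩ := exists_cosmologyOf_eq s'
  rw [cosmologyOf_mem_iff hV] at hs hs'
  rw [cosmologyAsymptote_cosmologyOf h (signOf_eq b) hs,
    cosmologyAsymptote_cosmologyOf h (signOf_eq b) hs'] at heq
  exact (cosmologyOf_eq_iff hV).mpr (exists_logFlow_eq_of_asymptote_eq h (signOf_eq b) hs hs' heq)

lemma exists_parameters_eq (h : IsAdmissible V ν μ R) (x : Bool × ℝ) :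
    ∃ s ∈ singularCosmologies V μ R, parameters V μ R s = x := by
  have hV := h.toIsPotential
  obtain ⟨b, L⟩ := x
  obtain ⟨p, hp, hL⟩ := exists_asymptote_eq (signOf_eq b) h L
  have hb : (stateOf hV hp.1).data ∈ basin V (signOf b) μ R := trapped_subset_basin hV hp
  have hs := (cosmologyOf_mem_iff hV _).mpr hb
  refine ⟨_, ⟨b, hs⟩, ?_⟩
  rw [parameters_eq h hs, cosmologyAsymptote_cosmologyOf h (signOf_eq b) hb]
  exact congrArg (Prod.mk b) hL

lemma isOpenMap_parameters (h : IsAdmissible V ν μ R) :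
    IsOpenMap fun s : singularCosmologies V μ R => parameters V μ R s := by
  have hV := h.toIsPotential
  rw [isOpenMap_iff_nhds_le]
  rintro ⟨s, b, hs⟩ N hN
  rw [mem_map, mem_nhds_subtype] at hN
  obtain ⟨O', hO', hON⟩ := hN
  obtain ⟨O, hOO', hO, hsO⟩ := mem_nhds_iff.mp hO'
  obtain ⟨p₀, rfl⟩ := exists_cosmologyOf_eq s
  -- a trapped representative
  obtain ⟨hp₀, τ, hτ⟩ := (cosmologyOf_mem_iff hV p₀).mp hs
  set p := stateOf hV hτ.1 with hp
  have hpp₀ : cosmologyOf p₀ = cosmologyOf p := (cosmologyOf_eq_iff hV).mpr ⟨τ, rfl⟩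
  have hpb : p.data ∈ basin V (signOf b) μ R := trapped_subset_basin hV hτ
  -- the data of states whose cosmology is in `O`
  have hpre : IsOpen ((cosmologyOf : PhaseSpace V → Cosmology V) ⁻¹' O) :=
    (isQuotientMap_quot_mk (r := SameOrbit V)).isOpen_preimage.mpr hO
  obtain ⟨W, hW, hWO⟩ := isOpen_induced_iff.mp hpre
  have hdata : {q : ℝ × ℝ | ∃ hq : 0 < energy V q, cosmologyOf (stateOf hV hq) ∈ O}
      ∈ 𝓝 p.data := by
    have hc : Continuous fun q : ℝ × ℝ => (expansion V q, q) :=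
      (continuous_expansion hV).prodMk continuous_id
    have hpW : (expansion V p.data, p.data) ∈ W := by
      have : p ∈ Subtype.val ⁻¹' W := by
        rw [hWO, Set.mem_preimage, ← hpp₀]; exact hsO
      exact this
    filter_upwards [hc.continuousAt.eventually_mem (hW.mem_nhds hpW),
      (isOpen_initialData hV).mem_nhds p.energy_pos] with q hqW hq
    refine ⟨hq, ?_⟩
    have : stateOf hV hq ∈ Subtype.val ⁻¹' W := hqW
    rwa [hWO] at this
  have himg := image_asymptote_mem_nhds (signOf_eq b) h hτ hdata
  have hval : parameters V μ R (cosmologyOf p₀) = (b, asymptote V (signOf b) p.data) := by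
    rw [parameters_eq h hs, hpp₀, cosmologyAsymptote_cosmologyOf h (signOf_eq b) hpb]
  rw [hval]
  refine mem_of_superset (prod_mem_nhds (mem_nhds_discrete.mpr (Set.mem_singleton b)) himg) ?_
  rintro ⟨b', L⟩ ⟨hb', q, ⟨⟨hq, hqO⟩, hqt⟩, rfl⟩
  obtain rfl : b' = b := hb'
  have hqb : (stateOf hV hq).data ∈ basin V (signOf b') μ R := trapped_subset_basin hV hqt
  have hqs := (cosmologyOf_mem_iff hV _).mpr hqb
  have hmem : (⟨cosmologyOf (stateOf hV hq), b', hqs⟩ : singularCosmologies V μ R) ∈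
      (fun s : singularCosmologies V μ R => parameters V μ R s) ⁻¹' N := hON (hOO' hqO)
  have he : parameters V μ R (cosmologyOf (stateOf hV hq)) =
      (b', asymptote V (signOf b') q) := by
    rw [parameters_eq h hqs, cosmologyAsymptote_cosmologyOf h (signOf_eq b') hqb]
    rfl
  rw [Set.mem_preimage, he] at hmem
  exact hmem

/-- Sign and asymptotic parameter are global coordinates on the space of cosmologies with massless
asymptotics. -/
noncomputable def parametersHomeomorph (h : IsAdmissible V ν μ R) :
    singularCosmologies V μ R ≃ₜ Bool × ℝ :=
  (Equiv.ofBijective (fun s : singularCosmologies V μ R => parameters V μ R s)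
    ⟨fun s s' hss => Subtype.ext (parameters_injOn h s.2 s'.2 hss),
      fun x => let ⟨s, hs, hx⟩ := exists_parameters_eq h x; ⟨⟨s, hs⟩, hx⟩⟩)
    |>.toHomeomorphOfContinuousOpen (continuous_parameters h) (isOpenMap_parameters h)

/-! ### Massless cosmologies -/

/-- The zero potential is admissible; any `μ` in `(0, 1)` would do. -/
lemma isAdmissible_zero : IsAdmissible (fun _ => 0) 0 (1 / 2) 0 where
  contDiff := contDiff_const
  nonneg _ := le_rfl
  ν_nonneg := le_rfl
  ν_lt := by norm_num
  μ_lt := by norm_num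
  R_nonneg := le_rfl
  abs_deriv_le φ _ := by simp

/-- A massless field always has maximal speed, hence every massless cosmology lies in a basin. -/
lemma singularCosmologies_zero : singularCosmologies (fun _ => 0) (1 / 2) 0 = Set.univ := by
  rw [Set.eq_univ_iff_forall]
  intro s
  obtain ⟨p, rfl⟩ := exists_cosmologyOf_eq s
  have hV := isAdmissible_zero.toIsPotential
  have hp := p.energy_pos
  have h1 := speed_sq hV hp
  have h2 : |speed (fun _ => 0) p.data| = κ := by
    rw [← abs_of_pos κ_pos, ← sq_eq_sq_iff_abs_eq_abs, pow_two κ, κ_mul_self]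
    simp only [ratio, zero_div, mul_zero, sub_zero] at h1
    linarith
  obtain ⟨σ, hσ, hσs⟩ : ∃ σ : ℝ, (σ = 1 ∨ σ = -1) ∧ σ * speed (fun _ => 0) p.data = κ := by
    rcases abs_choice (speed (fun _ => 0) p.data) with h | h
    · exact ⟨1, .inl rfl, by rw [one_mul, ← h, h2]⟩
    · exact ⟨-1, .inr rfl, by rw [neg_one_mul, ← h, h2]⟩
  obtain ⟨b, rfl⟩ := exists_signOf_eq hσ
  refine ⟨b, (cosmologyOf_mem_iff hV p).mpr ?_⟩
  refine mem_basin_of_speed isAdmissible_zero hσ (k₀ := energy (fun _ => 0) p.data) ?_ hp ?_ le_rfl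
  · intro φ _
    have : (0 : ℝ) < (1 - (1 / 2) ^ 2) * energy (fun _ => 0) p.data := mul_pos (by norm_num) hp
    simpa using this
  · rw [hσs]
    linarith [κ_pos]

lemma isSolutionOn_massless (hσ : σ = 1 ∨ σ = -1) {c : ℝ} (hc : 0 < c) :
    IsSolutionOn (fun _ => 0) (Set.Ioi 0) (fun t => 1 / t) (masslessField σ c)
      (fun t => σ * √(2 / 3) / t) := by
  intro t ht
  have ht0 : 0 < t := ht
  have hinv : HasDerivAt (fun t : ℝ => 1 / t) (-(t ^ 2)⁻¹) t := by
    simpa using hasDerivAt_inv ht0.ne'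
  have hsq : (σ * √(2 / 3)) ^ 2 = 2 / 3 := by
    rw [mul_pow, pow_two σ, sign_mul_self hσ, one_mul]
    exact Real.sq_sqrt (by norm_num)
  have hψ : (fun t : ℝ => σ * √(2 / 3) / t) = fun t => σ * √(2 / 3) * (1 / t) := by
    ext t; rw [mul_one_div]
  refine ⟨?_, ?_, ?_, by positivity, ?_⟩
  · have h1 : HasDerivAt (fun t : ℝ => Real.log (t / c)) (1 / c / (t / c)) t :=
      ((hasDerivAt_id t).div_const c).log (by positivity)
    convert! h1.const_mul (σ * √(2 / 3)) using 1
    field_simp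
  · rw [hψ]
    convert! hinv.const_mul (σ * √(2 / 3)) using 1
    simp only [deriv_const]
    field_simp
    ring
  · convert! hinv using 1
    rw [div_pow, hsq]
    field_simp
  · change (1 / t) ^ 2 = 3 * 0 + 3 / 2 * (σ * √(2 / 3) / t) ^ 2
    rw [div_pow (σ * √(2 / 3)), hsq]
    field_simp
    ring

/-- The massless cosmology with parameters `σ`, `c` is the one with sign `σ` and asymptotic parameter
`-ln c`. -/
lemma isMasslessWith_iff (hσ : σ = 1 ∨ σ = -1) {c : ℝ} (hc : 0 < c)
    (m : Cosmology fun _ => 0) : IsMasslessWith m σ c ↔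
      m ∈ basinCosmologies (fun _ => 0) σ (1 / 2) 0 ∧
        cosmologyAsymptote (fun _ => 0) σ m = -Real.log c := by
  have hasym : ∀ m', IsMasslessWith m' σ c → HasMasslessAsymptotics (fun _ => 0) m' σ c := by
    intro m' hm'
    refine ⟨_, _, _, hm', ?_, ?_, ?_⟩ <;>
    · simp only [sub_self]
      exact isBigO_zero _ _
  constructor
  · exact fun hm => (hasMasslessAsymptotics_iff isAdmissible_zero hσ hc m).mp (hasym m hm)
  · intro hm
    -- the exact solution has the same parameters, hence represents the same cosmology
    have hsol := isSolutionOn_massless hσ hc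
    have h1 : (1 : ℝ) ∈ Set.Ioi 0 := Set.mem_Ioi.mpr one_pos
    have hm' : IsMasslessWith (cosmologyOf (hsol.stateAt h1)) σ c :=
      ⟨hsol, 1, one_pos, hsol.stateAt h1, rfl, rfl⟩
    have hp' := (hasMasslessAsymptotics_iff isAdmissible_zero hσ hc _).mp (hasym _ hm')
    obtain ⟨b, rfl⟩ := exists_signOf_eq hσ
    have heq : m = cosmologyOf (hsol.stateAt h1) := by
      refine parameters_injOn isAdmissible_zero ⟨b, hm.1⟩ ⟨b, hp'.1⟩ ?_
      rw [parameters_eq isAdmissible_zero hm.1, parameters_eq isAdmissible_zero hp'.1, hm.2, hp'.2]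
    rw [heq]
    exact hm'

/-! ### Well-behaved potentials are admissible -/

lemma eventually_abs_deriv_le {N a : ℝ} (hV : WellBehavedAtInfinity V N) (ha : |N| < a) :
    ∀ᶠ φ in atTop, |deriv V φ| ≤ a * V φ := by
  obtain ⟨-, -, φ₀, -, hpos, hlim⟩ := hV
  have h1 : ∀ᶠ φ in atTop, |deriv V φ / V φ - N| < a - |N| := by
    have := hlim.abs
    rw [abs_zero] at this
    exact this.eventually_lt_const (by linarith)
  filter_upwards [h1, eventually_gt_atTop φ₀] with φ h2 h3
  have hp := hpos φ h3
  have h4 : |deriv V φ / V φ| ≤ a := by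
    have := abs_sub_abs_le_abs_sub (deriv V φ / V φ) N
    linarith
  rwa [abs_div, abs_of_pos hp, div_le_iff₀ hp] at h4

/-- The condition `N² < 6` leaves room for `ν` and `μ` with `|N| < 3 κ ν` and `ν < μ < 1`, because
`(3 κ)² = 6`. -/
lemma exists_isAdmissible {Nplus Nminus : ℝ} (hplus : WellBehavedAtInfinity V Nplus)
    (hminus : WellBehavedAtInfinity (fun φ => V (-φ)) Nminus) (hNplus : Nplus ^ 2 < 6)
    (hNminus : Nminus ^ 2 < 6) : ∃ ν μ R, IsAdmissible V ν μ R := by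
  have hκ := κ_pos
  have h6 : (3 * κ) ^ 2 = 6 := by linear_combination 9 * κ_mul_self
  have hp : |Nplus| < 3 * κ := abs_lt_of_sq_lt_sq (by rw [h6]; exact hNplus) (by positivity)
  have hm : |Nminus| < 3 * κ := abs_lt_of_sq_lt_sq (by rw [h6]; exact hNminus) (by positivity)
  obtain ⟨a, ha, ha3⟩ := exists_between (max_lt hp hm)
  obtain ⟨hap, ham⟩ := max_lt_iff.mp ha
  have ha0 : 0 ≤ a := (abs_nonneg _).trans hap.le
  have hν1 : a / (3 * κ) < 1 := (div_lt_one (by positivity)).mpr ha3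
  obtain ⟨μ, hμ, hμ1⟩ := exists_between hν1
  obtain ⟨R₁, hR₁⟩ := eventually_atTop.mp (eventually_abs_deriv_le hplus hap)
  obtain ⟨R₂, hR₂⟩ := eventually_atTop.mp (eventually_abs_deriv_le hminus ham)
  refine ⟨a / (3 * κ), μ, max 0 (max R₁ R₂), ?_⟩
  exact
    { contDiff := hplus.1
      nonneg := hplus.2.1
      ν_nonneg := by positivity
      ν_lt := hμ
      μ_lt := hμ1
      R_nonneg := le_max_left _ _
      abs_deriv_le := fun φ hφ => by
        rw [mul_div_cancel₀ _ (by positivity)]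
        have h12 := le_trans (le_max_right _ _) hφ
        rcases le_total 0 φ with h0 | h0
        · rw [abs_of_nonneg h0] at h12
          exact hR₁ φ (le_trans (le_max_left _ _) h12)
        · rw [abs_of_nonpos h0] at h12
          have := hR₂ (-φ) (le_trans (le_max_right _ _) h12)
          rwa [deriv_comp_neg, neg_neg, abs_neg] at this }

end FRW

theorem mainTheorem1 (V : ℝ → ℝ) (Nplus Nminus : ℝ)
    (hplus : FRW.ClassWellBehaved 2 V Nplus)
    (hminus : FRW.ClassWellBehaved 2 (fun φ => V (-φ)) Nminus)
    (hNplus : Nplus ^ 2 < 6) (hNminus : Nminus ^ 2 < 6) :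
    ∃ (S : Set (FRW.Cosmology V)) (e : S ≃ₜ FRW.Cosmology (fun _ => 0)),
      volume {q : ℝ × ℝ | ∃ p : FRW.PhaseSpace V, p.1.2 = q ∧ FRW.cosmologyOf p ∉ S} = 0 ∧
      (∀ s ∈ S, FRW.HasInitialSingularity V s) ∧
      (∀ (s : FRW.Cosmology V) (m : FRW.Cosmology (fun _ => 0)),
        (∃ hs : s ∈ S, e ⟨s, hs⟩ = m) ↔
          ∃ σ c : ℝ, (σ = 1 ∨ σ = -1) ∧ 0 < c ∧ FRW.IsMasslessWith m σ c ∧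
            FRW.HasMasslessAsymptotics V s σ c) := by
  obtain ⟨ν, μ, R, h⟩ := FRW.exists_isAdmissible hplus.2.1 hminus.2.1 hNplus hNminus
  have hV := h.toIsPotential
  have h0 := FRW.isAdmissible_zero
  -- match cosmologies with the same sign and asymptotic parameter
  set e : FRW.singularCosmologies V μ R ≃ₜ FRW.Cosmology (fun _ => 0) :=
    (FRW.parametersHomeomorph h).trans ((FRW.parametersHomeomorph h0).symm.trans
      ((Homeomorph.setCongr FRW.singularCosmologies_zero).trans (Homeomorph.Set.univ _))) with he
  have hparam : ∀ (s : FRW.singularCosmologies V μ R),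
      FRW.parameters (fun _ => 0) (1 / 2) 0 (e s) = FRW.parameters V μ R s := fun s =>
    (FRW.parametersHomeomorph h0).apply_symm_apply (FRW.parametersHomeomorph h s)
  have hall : ∀ m, m ∈ FRW.singularCosmologies (fun _ => 0) (1 / 2) 0 := fun m => by
    rw [FRW.singularCosmologies_zero]; trivial
  refine ⟨FRW.singularCosmologies V μ R, e, ?_, ?_, fun s m => ⟨?_, ?_⟩⟩
  · refine measure_mono_null ?_ (FRW.volume_exceptional h)
    rintro _ ⟨p, rfl, hp⟩
    refine ⟨p.energy_pos, fun hb => hp ⟨true, ?_⟩, fun hb => hp ⟨false, ?_⟩⟩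
    · exact (FRW.cosmologyOf_mem_iff hV p).mpr hb
    · exact (FRW.cosmologyOf_mem_iff hV p).mpr hb
  · rintro s ⟨b, hs⟩
    obtain ⟨p, rfl⟩ := FRW.exists_cosmologyOf_eq s
    exact FRW.hasInitialSingularity h (FRW.signOf_eq b) ((FRW.cosmologyOf_mem_iff hV p).mp hs)
  · rintro ⟨⟨b, hs⟩, rfl⟩
    have hp := hparam ⟨s, b, hs⟩
    obtain ⟨b', hb'⟩ := hall (e ⟨s, b, hs⟩)
    rw [FRW.parameters_eq h hs, FRW.parameters_eq h0 hb', Prod.mk.injEq] at hp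
    obtain ⟨rfl, hL⟩ := hp
    refine ⟨FRW.signOf b', Real.exp (-FRW.cosmologyAsymptote V (FRW.signOf b') s),
      FRW.signOf_eq b', Real.exp_pos _, ?_, ?_⟩
    · rw [FRW.isMasslessWith_iff (FRW.signOf_eq b') (Real.exp_pos _), Real.log_exp, neg_neg]
      exact ⟨hb', hL⟩
    · rw [FRW.hasMasslessAsymptotics_iff h (FRW.signOf_eq b') (Real.exp_pos _), Real.log_exp,
        neg_neg]
      exact ⟨hs, rfl⟩
  · rintro ⟨σ, c, hσ, hc, hm, hs⟩
    rw [FRW.isMasslessWith_iff hσ hc] at hm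
    rw [FRW.hasMasslessAsymptotics_iff h hσ hc] at hs
    obtain ⟨b, rfl⟩ := FRW.exists_signOf_eq hσ
    refine ⟨⟨b, hs.1⟩, FRW.parameters_injOn h0 (hall _) (hall _) ?_⟩
    rw [hparam, FRW.parameters_eq h hs.1, FRW.parameters_eq h0 hm.1, hs.2, hm.2]
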